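/- Let $d, D \ge 0$ be integers, let $\Sigma \subset \mathbb{R}^d$ be compact and let $c > 0$. Call $(\psi,t)$ an admissible flow if $\psi(u,s) \in \mathbb{R}^D$ is $C^\infty$ on a neighbourhood $U \times I$ of $\Sigma \times \{t\}$ ($U$, $I$ open), $\psi(\cdot,t)$ is an immersion on $\Sigma$, and $\partial_t\psi(\cdot,t)$ vanishes on $U$ outside a compact subset of the interior of $\Sigma$. Let $g_{ij} = \langle \partial_i\psi, \partial_j\psi\rangle$ be the metric induced at time $t$, $\Delta_g$ its Laplace–Beltrami operator (acting componentwise on $\mathbb{R}^D$-valued maps), $\Gamma$ its Christoffel symbols, $R^\alpha{}_\beta$ its mixed Ricci tensor (positive on round spheres), and $\Delta_H = d\delta + \delta d$ its Hodge–de Rham Laplacian, acting on vector fields through the metric. Denote by ${}^\top$ and ${}^\perp$ the tangential and normal projections along $\psi(\cdot,t)$, by $\Pi_{ij} = (\partial_i\partial_j\psi)^\perp$ the second fundamental form, by $A_\xi$ the Weingarten map, $\langle A_\xi(\partial_\mu), \partial_\nu\psi\rangle = \langle \Pi_{\mu\nu}, \xi\rangle$, and split $\partial_t\psi = W + V^\perp$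 with $W = W^\alpha\partial_\alpha\psi$ tangential and $V^\perp$ normal. Put $$\dot E = \int_\Sigma g^{ij}\big(\langle \partial_t\partial_i\psi, \partial_j\psi\rangle + \langle \partial_i\psi, \partial_t\partial_j\psi\rangle\big)\sqrt{\det g}\,du, \qquad \mathcal{L} = \big|\,c - |\dot E|\,\big|,$$ $$X_H = -(\Delta_H W)^\alpha\partial_\alpha\psi,\quad X_{\mathrm{Ric}} = R^\alpha{}_\beta W^\beta\partial_\alpha\psi,\quad X_A = -g^{\mu\nu}W^\alpha A_{\Pi_{\nu\alpha}}(\partial_\mu),\quad X_V = (\Delta_g V^\perp)^\top,\quad X_N = (\Delta_g\partial_t\psi)^\perp,$$ and $\langle\!\langle X, Y\rangle\!\rangle = \int_\Sigma \langle X, Y\rangle\sqrt{\det g}\,du$. (1) For every admissible flow, $\dot E$ is the derivative at $s = t$ of $s \mapsto \int_\Sigma g^{ij}\langle\partial_i\psi(u,s), \partial_j\psi(u,s)\rangle\sqrt{\det g}\,du$, where $g$ is kept fixed (the metric induced at time $t$), and $$\dot E = -2\langle\!\langle \partial_t\psi, \Delta_g\psi\rangle\!\rangle = -2\langle\!\langle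 \psi, \Delta_g\partial_t\psi\rangle\!\rangle .$$ On $\Sigma$ one has $(\Delta_g W)^\top = X_H + X_{\mathrm{Ric}} + X_A$, and the loss is $$\mathcal{L} = \Big|\,c - 2\,\big|\langle\!\langle\psi, X_H\rangle\!\rangle + \langle\!\langle\psi, X_{\mathrm{Ric}}\rangle\!\rangle + \langle\!\langle\psi, X_A\rangle\!\rangle + \langle\!\langle\psi, X_V\rangle\!\rangle + \langle\!\langle\psi, X_N\rangle\!\rangle\big|\,\Big| .$$ (2) The dependence on the Ricci curvature is nontrivial: if $2 \le d < D$ and $\Sigma$ has nonempty interior, there are two admissible flows (at the same time $t$) with the same tangential velocity components $W^\alpha$ on $\Sigma$ and with equal values of each of $\langle\!\langle\psi, X_H\rangle\!\rangle$, $\langle\!\langle\psi, X_A\rangle\!\rangle$, $\langle\!\langle\psi, X_V\rangle\!\rangle$, $\langle\!\langle\psi, X_N\rangle\!\rangle$, the first one Ricci-flat on $\Sigma$, whose losses $\mathcal{L}$ differ. -/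

import Mathlib

open MeasureTheory
open scoped ContDiff

namespace HarmonicFlow

noncomputable section

/-- Coordinate partial derivative `∂f/∂uⁱ` of a map defined on `ℝᵈ`. -/
def pd {d : ℕ} {F : Type*} [NormedAddCommGroup F] [NormedSpace ℝ F]
    (i : Fin d) (f : EuclideanSpace ℝ (Fin d) → F) (u : EuclideanSpace ℝ (Fin d)) : F :=
  fderiv ℝ f u (EuclideanSpace.single i 1)

section Intrinsic

/-! Intrinsic geometry of a metric `g`, given by its coefficient matrix in the coordinates `u`. -/

variable {d : ℕ} (g : EuclideanSpace ℝ (Fin d) → Matrix (Fin d) (Fin d) ℝ)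

/-- The volume density `√det g`. -/
def volDensity (u : EuclideanSpace ℝ (Fin d)) : ℝ := Real.sqrt (g u).det

/-- Christoffel symbols of the Levi-Civita connection,
`Γ_{ij}^k = ½ g^{kl} (∂_i g_{jl} + ∂_j g_{il} - ∂_l g_{ij})`. -/
def christoffel (k i j : Fin d) (u : EuclideanSpace ℝ (Fin d)) : ℝ :=
  (1 / 2) * ∑ l, (g u)⁻¹ k l *
    (pd i (fun v => g v j l) u + pd j (fun v => g v i l) u - pd l (fun v => g v i j) u)

/-- Riemann curvature: `R(∂_i, ∂_j) ∂_k = (riemann g l i j k) ∂_l`, with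
`R(X, Y) Z = ∇_X ∇_Y Z - ∇_Y ∇_X Z - ∇_[X,Y] Z`. -/
def riemann (l i j k : Fin d) (u : EuclideanSpace ℝ (Fin d)) : ℝ :=
  pd i (christoffel g l j k) u - pd j (christoffel g l i k) u
    + ∑ m, (christoffel g l i m u * christoffel g m j k u
        - christoffel g l j m u * christoffel g m i k u)

/-- Ricci curvature `R_{jk}`, the trace of `X ↦ R(X, ∂_j) ∂_k`
(positive on round spheres of dimension at least two). -/
def ricci (j k : Fin d) (u : EuclideanSpace ℝ (Fin d)) : ℝ := ∑ i, riemann g i i j k u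

/-- Mixed Ricci tensor `R^a_b = g^{ac} R_{cb}`. -/
def ricciMixed (a b : Fin d) (u : EuclideanSpace ℝ (Fin d)) : ℝ :=
  ∑ c, (g u)⁻¹ a c * ricci g c b u

/-- Laplace–Beltrami operator `(det g)^{-1/2} ∂_i ((det g)^{1/2} g^{ij} ∂_j f)`, acting on
scalar functions, and componentwise on functions with values in a vector space. -/
def laplaceBeltrami {F : Type*} [NormedAddCommGroup F] [NormedSpace ℝ F]
    (f : EuclideanSpace ℝ (Fin d) → F) (u : EuclideanSpace ℝ (Fin d)) : F :=
  (volDensity g u)⁻¹ •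
    ∑ i, pd i (fun v => volDensity g v • ∑ j, (g v)⁻¹ i j • pd j f v) u

/-- The one-form `W^♭`, `(W^♭)_i = g_{ij} W^j`. -/
def flat (W : Fin d → EuclideanSpace ℝ (Fin d) → ℝ) (i : Fin d)
    (u : EuclideanSpace ℝ (Fin d)) : ℝ := ∑ j, g u i j * W j u

/-- Exterior derivative of a one-form, `(dα)_{ij} = ∂_i α_j - ∂_j α_i`. -/
def dOne (α : Fin d → EuclideanSpace ℝ (Fin d) → ℝ) (i j : Fin d)
    (u : EuclideanSpace ℝ (Fin d)) : ℝ := pd i (α j) u - pd j (α i) u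

/-- Codifferential of a one-form, `δα = -(det g)^{-1/2} ∂_i ((det g)^{1/2} g^{ij} α_j)`. -/
def codiffOne (α : Fin d → EuclideanSpace ℝ (Fin d) → ℝ) (u : EuclideanSpace ℝ (Fin d)) : ℝ :=
  -((volDensity g u)⁻¹ * ∑ i, pd i (fun v => volDensity g v * ∑ j, (g v)⁻¹ i j * α j v) u)

/-- Codifferential of a two-form, `(δη)_j = -∇^i η_{ij}
= -(det g)^{-1/2} g_{jl} ∂_i ((det g)^{1/2} g^{ia} g^{lb} η_{ab})`. -/
def codiffTwo (η : Fin d → Fin d → EuclideanSpace ℝ (Fin d) → ℝ) (j : Fin d)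
    (u : EuclideanSpace ℝ (Fin d)) : ℝ :=
  -((volDensity g u)⁻¹ * ∑ l, g u j l * ∑ i, pd i (fun v => volDensity g v *
      ∑ a, ∑ b, (g v)⁻¹ i a * (g v)⁻¹ l b * η a b v) u)

/-- Hodge–de Rham Laplacian `Δ_H = dδ + δd` on vector fields (through the metric
identification with one-forms), in components: `(Δ_H W)^a`. -/
def hodgeLaplacian (W : Fin d → EuclideanSpace ℝ (Fin d) → ℝ) (a : Fin d)
    (u : EuclideanSpace ℝ (Fin d)) : ℝ :=
  ∑ j, (g u)⁻¹ a j *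
    (pd j (codiffOne g (flat g W)) u + codiffTwo g (dOne (flat g W)) j u)

end Intrinsic

section Extrinsic

/-! Extrinsic geometry of an immersion `φ` into `ℝᴰ`. -/

variable {d D : ℕ} (φ : EuclideanSpace ℝ (Fin d) → EuclideanSpace ℝ (Fin D))

/-- The induced metric `g_{ij} = ⟨∂_i φ, ∂_j φ⟩`. -/
def inducedMetric (u : EuclideanSpace ℝ (Fin d)) : Matrix (Fin d) (Fin d) ℝ :=
  Matrix.of fun i j => inner ℝ (pd i φ u) (pd j φ u)

/-- Components `X^a = g^{ab} ⟨x, ∂_b φ⟩` of the tangential part of `x ∈ ℝᴰ`. -/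
def tangentCoeff (u : EuclideanSpace ℝ (Fin d)) (x : EuclideanSpace ℝ (Fin D))
    (a : Fin d) : ℝ :=
  ∑ b, (inducedMetric φ u)⁻¹ a b * inner ℝ x (pd b φ u)

/-- Tangential projection `x^⊤ = X^a ∂_a φ`. -/
def tangentProj (u : EuclideanSpace ℝ (Fin d)) (x : EuclideanSpace ℝ (Fin D)) :
    EuclideanSpace ℝ (Fin D) :=
  ∑ a, tangentCoeff φ u x a • pd a φ u

/-- Normal projection `x^⊥ = x - x^⊤`. -/
def normalProj (u : EuclideanSpace ℝ (Fin d)) (x : EuclideanSpace ℝ (Fin D)) :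
    EuclideanSpace ℝ (Fin D) :=
  x - tangentProj φ u x

/-- Second fundamental form `Π_{ij} = (∂_i ∂_j φ)^⊥`. -/
def secondFF (i j : Fin d) (u : EuclideanSpace ℝ (Fin d)) : EuclideanSpace ℝ (Fin D) :=
  normalProj φ u (pd i (pd j φ) u)

/-- Weingarten map `A_ξ(∂_m)`, the tangent vector with
`⟨A_ξ(∂_m), ∂_c φ⟩ = ⟨Π_{mc}, ξ⟩`. -/
def weingarten (ξ : EuclideanSpace ℝ (Fin D)) (m : Fin d) (u : EuclideanSpace ℝ (Fin d)) :
    EuclideanSpace ℝ (Fin D) :=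
  ∑ b, (∑ c, (inducedMetric φ u)⁻¹ b c * inner ℝ (secondFF φ m c u) ξ) • pd b φ u

end Extrinsic

section Energy

/-! The extrinsic energy, and the loss built from its time derivative. -/

variable {d D : ℕ} (S : Set (EuclideanSpace ℝ (Fin d)))
  (g : EuclideanSpace ℝ (Fin d) → Matrix (Fin d) (Fin d) ℝ)

/-- The extrinsic energy `∫_S g^{ij} ⟨∂_i φ, ∂_j φ⟩ √det g du`. -/
def energy (φ : EuclideanSpace ℝ (Fin d) → EuclideanSpace ℝ (Fin D)) : ℝ :=
  ∫ u in S, (∑ i, ∑ j, (g u)⁻¹ i j * inner ℝ (pd i φ u) (pd j φ u)) * volDensity g u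

/-- `∫_S g^{ij} (⟨∂_t ∂_i ψ, ∂_j ψ⟩ + ⟨∂_i ψ, ∂_t ∂_j ψ⟩) √det g du` at time `t`. -/
def energyRate (ψ : EuclideanSpace ℝ (Fin d) → ℝ → EuclideanSpace ℝ (Fin D)) (t : ℝ) : ℝ :=
  ∫ u in S, (∑ i, ∑ j, (g u)⁻¹ i j *
      (inner ℝ (deriv (fun s => pd i (fun v => ψ v s) u) t) (pd j (fun v => ψ v t) u)
        + inner ℝ (pd i (fun v => ψ v t) u) (deriv (fun s => pd j (fun v => ψ v s) u) t)))
    * volDensity g u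

/-- The harmonic-energy loss with constant `c`. -/
def harmonicLoss (c : ℝ) (ψ : EuclideanSpace ℝ (Fin d) → ℝ → EuclideanSpace ℝ (Fin D))
    (t : ℝ) : ℝ :=
  |c - abs (energyRate S g ψ t)|

end Energy

section Flow

/-! A family `ψ(u, t)`: at time `t` the metric is the one induced by `ψ(·, t)`, and the velocity
is split into its tangential and its normal part. -/

variable {d D : ℕ} (ψ : EuclideanSpace ℝ (Fin d) → ℝ → EuclideanSpace ℝ (Fin D)) (t : ℝ)

/-- The metric induced by the map `ψ(·, t)`. -/
def metricAt : EuclideanSpace ℝ (Fin d) → Matrix (Fin d) (Fin d) ℝ :=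
  inducedMetric (fun v => ψ v t)

/-- The velocity `∂_t ψ`. -/
def velocity (u : EuclideanSpace ℝ (Fin d)) : EuclideanSpace ℝ (Fin D) :=
  deriv (fun s => ψ u s) t

/-- Components `W^a` of the tangential part of the velocity. -/
def tangentVelCoeff (a : Fin d) (u : EuclideanSpace ℝ (Fin d)) : ℝ :=
  tangentCoeff (fun v => ψ v t) u (velocity ψ t u) a

/-- Tangential velocity `W = W^a ∂_a ψ`. -/
def tangentVel (u : EuclideanSpace ℝ (Fin d)) : EuclideanSpace ℝ (Fin D) :=
  tangentProj (fun v => ψ v t) u (velocity ψ t u)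

/-- Normal velocity `V^⊥`. -/
def normalVel (u : EuclideanSpace ℝ (Fin d)) : EuclideanSpace ℝ (Fin D) :=
  normalProj (fun v => ψ v t) u (velocity ψ t u)

/-- `-(Δ_H W)^a ∂_a ψ`. -/
def hodgeTerm (u : EuclideanSpace ℝ (Fin d)) : EuclideanSpace ℝ (Fin D) :=
  -∑ a, hodgeLaplacian (metricAt ψ t) (tangentVelCoeff ψ t) a u • pd a (fun v => ψ v t) u

/-- The Ricci term `R^a_b W^b ∂_a ψ`. -/
def ricciTerm (u : EuclideanSpace ℝ (Fin d)) : EuclideanSpace ℝ (Fin D) :=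
  ∑ a, (∑ b, ricciMixed (metricAt ψ t) a b u * tangentVelCoeff ψ t b u) •
    pd a (fun v => ψ v t) u

/-- `-g^{mn} W^a A_{Π_{na}}(∂_m)`. -/
def weingartenTerm (u : EuclideanSpace ℝ (Fin d)) : EuclideanSpace ℝ (Fin D) :=
  -∑ m, ∑ n, ∑ a, ((metricAt ψ t u)⁻¹ m n * tangentVelCoeff ψ t a u) •
    weingarten (fun v => ψ v t) (secondFF (fun v => ψ v t) n a u) m u

/-- `(Δ_g V^⊥)^⊤`. -/
def normalVelTerm (u : EuclideanSpace ℝ (Fin d)) : EuclideanSpace ℝ (Fin D) :=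
  tangentProj (fun v => ψ v t) u (laplaceBeltrami (metricAt ψ t) (normalVel ψ t) u)

/-- The remaining term, the normal part `(Δ_g ∂_t ψ)^⊥`. -/
def otherTerm (u : EuclideanSpace ℝ (Fin d)) : EuclideanSpace ℝ (Fin D) :=
  normalProj (fun v => ψ v t) u (laplaceBeltrami (metricAt ψ t) (velocity ψ t) u)

/-- `∫_S ⟨X, Y⟩ √det g du`. -/
def pairing (S : Set (EuclideanSpace ℝ (Fin d)))
    (X Y : EuclideanSpace ℝ (Fin d) → EuclideanSpace ℝ (Fin D)) : ℝ :=
  ∫ u in S, inner ℝ (X u) (Y u) * volDensity (metricAt ψ t) u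

/-- Standing assumptions: the parameter domain `S` is compact, `ψ` is smooth on a neighbourhood
`U × I` of `S × {t}`, `ψ(·, t)` is an immersion on `S`, and the velocity at time `t` has compact
support in the interior of `S`. -/
structure Admissible (S U : Set (EuclideanSpace ℝ (Fin d))) (I : Set ℝ) : Prop where
  compact : IsCompact S
  isOpen_space : IsOpen U
  subset : S ⊆ U
  isOpen_time : IsOpen I
  mem_time : t ∈ I
  smooth : ContDiffOn ℝ ∞ (fun p : EuclideanSpace ℝ (Fin d) × ℝ => ψ p.1 p.2) (U ×ˢ I)
  immersion : ∀ u ∈ S, Function.Injective (fderiv ℝ (fun v => ψ v t) u)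
  support : ∃ K : Set (EuclideanSpace ℝ (Fin d)), IsCompact K ∧ K ⊆ interior S ∧
    ∀ u ∈ U \ K, velocity ψ t u = 0

end Flow

end

end HarmonicFlow

open HarmonicFlow

namespace HarmonicFlow

noncomputable section

/-! Part (1). Compactness of the domain bounds the time derivative of the integrand near time t, so
the energy may be differentiated under the integral (`hasDerivAt_energy`). With the metric frozen,
the rate is twice the Dirichlet form of velocity and position. The velocity has compact support in
the interior, so Green's identity (`integral_inner_laplaceBeltrami`) has no boundary term and can
put the Laplacian on either factor. It remains to decompose Δ_g of the velocity W + V^⊥. By the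
Gauss formula ∂_j W = ∇_j W + Π(∂_j, W). Differentiating once more and projecting, the normal part
of this derivative contributes -A_Π and the tangential part the rough Laplacian of W. The
Weitzenböck formula (`weitzenbock`) rewrites the rough Laplacian as -Δ_H W + Ric W: the two differ
by ∇_i∇^a W^i - ∇^a∇_i W^i, and the curvature is the commutator of covariant derivatives
(`sum_riemann_mul`).

Part (2). The first flow moves a linear isometric embedding tangentially by w times a constant
vector. The metric is constant, Π vanishes, the position is tangential and its Laplacian is zero, so
every pairing and the energy rate vanish and the loss is c (`flat_flow_properties`).

The second flow starts from a torus of revolution times ℝ^(d-2), which needs only d + 1 dimensions,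
and has velocity wτ + φν, with τ the unit meridian tangent, ν the unit normal and w, φ test
functions. The tangential part of the position is the gradient of half its squared length, and the
normal part is the support function times ν. Integration by parts therefore moves all derivatives
from w and φ onto explicit functions of the meridian angle. With T_i = `tangentMoment i` and N_i =
`normalMoment i`, the Hodge pairing is ∫ w T_0, the Weingarten pairing ∫ w T_1, the V pairing ∫ φ
N_0 - ∫ φ N_1, the N pairing ∫ w T_2 + ∫ φ N_1, and the energy rate is -2 ∫ φ N_0.

The T_i are linearly independent, and so are the N_i. By analyticity this persists on every nonempty
open set, so the moments can be prescribed (`exists_testFunction_integral_eq`). The values 0, 0,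
-c/2 for w and c/2, c/2 for φ make the four pairings vanish while the energy rate is -c. The second
loss is thus 0, and by part (1) the Ricci pairing alone carries the difference. -/

/-- The coordinate space `ℝᵈ`. -/
abbrev Coord (d : ℕ) := EuclideanSpace ℝ (Fin d)

/-! ### Partial derivatives, and the calculus of matrix-valued maps. -/

section Calculus

variable {d : ℕ} {F H : Type*} [NormedAddCommGroup F] [NormedSpace ℝ F]
  [NormedAddCommGroup H] [InnerProductSpace ℝ H] {O : Set (Coord d)} {u : Coord d}

theorem differentiableAt_of_smooth {f : Coord d → F} (hO : IsOpen O) (hf : ContDiffOn ℝ ∞ f O)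
    (hu : u ∈ O) : DifferentiableAt ℝ f u :=
  (hf.contDiffAt (hO.mem_nhds hu)).differentiableAt (by simp)

theorem contDiffOn_pd {f : Coord d → F} (hO : IsOpen O) (hf : ContDiffOn ℝ ∞ f O) (i : Fin d) :
    ContDiffOn ℝ ∞ (pd i f) O :=
  (hf.fderiv_of_isOpen hO (by simp)).clm_apply contDiffOn_const

theorem pd_congr {f f' : Coord d → F} (hO : IsOpen O) (h : Set.EqOn f f' O) (hu : u ∈ O)
    (i : Fin d) : pd i f u = pd i f' u := by
  unfold pd
  rw [(h.eventuallyEq_of_mem (hO.mem_nhds hu)).fderiv_eq]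

@[simp]
theorem pd_const (i : Fin d) (x : F) : pd i (fun _ => x) u = 0 := by simp [pd]

theorem pd_add {f f' : Coord d → F} (hf : DifferentiableAt ℝ f u) (hf' : DifferentiableAt ℝ f' u)
    (i : Fin d) : pd i (fun v => f v + f' v) u = pd i f u + pd i f' u := by
  simp [pd, fderiv_fun_add hf hf']

theorem pd_sub {f f' : Coord d → F} (hf : DifferentiableAt ℝ f u) (hf' : DifferentiableAt ℝ f' u)
    (i : Fin d) : pd i (fun v => f v - f' v) u = pd i f u - pd i f' u := by
  simp [pd, fderiv_fun_sub hf hf']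

theorem pd_sum {ι : Type*} {s : Finset ι} {f : ι → Coord d → F}
    (hf : ∀ k ∈ s, DifferentiableAt ℝ (f k) u) (i : Fin d) :
    pd i (fun v => ∑ k ∈ s, f k v) u = ∑ k ∈ s, pd i (f k) u := by
  simp [pd, fderiv_fun_sum hf]

theorem pd_smul {a : Coord d → ℝ} {f : Coord d → F} (ha : DifferentiableAt ℝ a u)
    (hf : DifferentiableAt ℝ f u) (i : Fin d) :
    pd i (fun v => a v • f v) u = pd i a u • f u + a u • pd i f u := by
  simp [pd, fderiv_fun_smul ha hf, add_comm]

theorem pd_mul {a b : Coord d → ℝ} (ha : DifferentiableAt ℝ a u)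
    (hb : DifferentiableAt ℝ b u) (i : Fin d) :
    pd i (fun v => a v * b v) u = pd i a u * b u + a u * pd i b u := by
  simpa using pd_smul ha hb i

theorem pd_inner {f f' : Coord d → H} (hf : DifferentiableAt ℝ f u)
    (hf' : DifferentiableAt ℝ f' u) (i : Fin d) :
    pd i (fun v => inner ℝ (f v) (f' v)) u
      = inner ℝ (pd i f u) (f' u) + inner ℝ (f u) (pd i f' u) := by
  simp [pd, fderiv_inner_apply ℝ hf hf', add_comm]

theorem pd_comm {f : Coord d → F} (hO : IsOpen O) (hf : ContDiffOn ℝ ∞ f O) (hu : u ∈ O)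
    (i j : Fin d) : pd i (pd j f) u = pd j (pd i f) u := by
  have hd : DifferentiableAt ℝ (fderiv ℝ f) u :=
    differentiableAt_of_smooth hO (hf.fderiv_of_isOpen hO (by simp)) hu
  have key : ∀ i j : Fin d, pd i (pd j f) u
      = fderiv ℝ (fderiv ℝ f) u (EuclideanSpace.single i 1) (EuclideanSpace.single j 1) := by
    intro i j
    unfold pd
    rw [fderiv_clm_apply hd (differentiableAt_const _)]
    simp
  rw [key, key]
  exact ((hf.contDiffAt (hO.mem_nhds hu)).isSymmSndFDerivAt
    (by rw [minSmoothness_of_isRCLikeNormedField]; exact WithTop.coe_le_coe.2 le_top)) _ _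

/-- Entrywise partial derivative of a matrix-valued map. -/
def pdMat {m n : Type*} (i : Fin d) (A : Coord d → Matrix m n ℝ) (u : Coord d) : Matrix m n ℝ :=
  Matrix.of fun a b => pd i (fun v => A v a b) u

/-- Entrywise smoothness of a matrix-valued map. -/
def SmoothMatOn {m n : Type*} (A : Coord d → Matrix m n ℝ) (O : Set (Coord d)) : Prop :=
  ∀ a b, ContDiffOn ℝ ∞ (fun v => A v a b) O

theorem pdMat_mul {l m n : Type*} [Fintype m] {A : Coord d → Matrix l m ℝ}
    {B : Coord d → Matrix m n ℝ} (hO : IsOpen O) (hA : SmoothMatOn A O) (hB : SmoothMatOn B O)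
    (hu : u ∈ O) (i : Fin d) :
    pdMat i (fun v => A v * B v) u = pdMat i A u * B u + A u * pdMat i B u := by
  ext a b
  have dA := fun a b => differentiableAt_of_smooth hO (hA a b) hu
  have dB := fun a b => differentiableAt_of_smooth hO (hB a b) hu
  simp only [pdMat, Matrix.mul_apply, Matrix.of_apply, Matrix.add_apply]
  rw [pd_sum (f := fun k v => A v a k * B v k b) fun k _ => (dA a k).mul (dB k b),
    ← Finset.sum_add_distrib]
  exact Finset.sum_congr rfl fun k _ => pd_mul (dA a k) (dB k b) i

theorem SmoothMatOn.mul {l m n : Type*} [Fintype m] {A : Coord d → Matrix l m ℝ}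
    {B : Coord d → Matrix m n ℝ} (hA : SmoothMatOn A O) (hB : SmoothMatOn B O) :
    SmoothMatOn (fun v => A v * B v) O := fun a b => by
  simp only [Matrix.mul_apply]
  exact ContDiffOn.sum fun k _ => (hA a k).mul (hB k b)

theorem SmoothMatOn.det {n : Type*} [Fintype n] [DecidableEq n] {A : Coord d → Matrix n n ℝ}
    (hA : SmoothMatOn A O) : ContDiffOn ℝ ∞ (fun v => (A v).det) O := by
  simp only [Matrix.det_apply]
  exact ContDiffOn.sum fun σ _ => (contDiffOn_prod fun k _ => hA (σ k) k).const_smul _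

/-- Cramer's rule: each entry is the reciprocal determinant times an entry of the adjugate, itself
the determinant of a matrix with one row replaced by a constant one. -/
theorem SmoothMatOn.inv {n : Type*} [Fintype n] [DecidableEq n] {A : Coord d → Matrix n n ℝ}
    (hA : SmoothMatOn A O) (hdet : ∀ v ∈ O, (A v).det ≠ 0) : SmoothMatOn (fun v => (A v)⁻¹) O := by
  intro a b
  simp only [Matrix.inv_def, Ring.inverse_eq_inv', Matrix.smul_apply, smul_eq_mul,
    Matrix.adjugate_apply]
  refine (hA.det.inv hdet).mul (SmoothMatOn.det fun p q => ?_)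
  by_cases hp : p = b
  · subst hp
    simpa using contDiffOn_const
  · simpa [Matrix.updateRow_ne hp] using hA p q

/-- Differentiate A⁻¹A = 1 and multiply by A⁻¹ from the right. -/
theorem pdMat_inv {n : Type*} [Fintype n] [DecidableEq n] {A : Coord d → Matrix n n ℝ}
    (hO : IsOpen O) (hA : SmoothMatOn A O) (hdet : ∀ v ∈ O, (A v).det ≠ 0) (hu : u ∈ O)
    (i : Fin d) :
    pdMat i (fun v => (A v)⁻¹) u = -((A u)⁻¹ * pdMat i A u * (A u)⁻¹) := by
  have h1 := pdMat_mul hO (hA.inv hdet) hA hu i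
  have h2 : pdMat i (fun v => (A v)⁻¹ * A v) u = 0 := by
    ext a b
    simp only [pdMat, Matrix.of_apply, Matrix.zero_apply]
    rw [pd_congr (f' := fun _ => (1 : Matrix n n ℝ) a b) hO (fun v hv => ?_) hu, pd_const]
    simp only []
    rw [Matrix.nonsing_inv_mul _ (isUnit_iff_ne_zero.2 (hdet v hv))]
  rw [h2] at h1
  have h3 := congrArg (· * (A u)⁻¹) h1
  simp only [zero_mul, add_mul, Matrix.mul_assoc,
    Matrix.mul_nonsing_inv _ (isUnit_iff_ne_zero.2 (hdet u hu)), mul_one] at h3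
  rw [Matrix.mul_assoc]
  exact eq_neg_of_add_eq_zero_left h3.symm

theorem contDiff_det_of {n : Type*} [Fintype n] [DecidableEq n] :
    ContDiff ℝ ∞ fun M : n → n → ℝ => (Matrix.of M).det := by
  simp only [Matrix.det_apply, Matrix.of_apply]
  exact ContDiff.sum fun σ _ => (contDiff_prod fun k _ => by fun_prop).const_smul _

/-- Jacobi's formula. -/
theorem pd_det {n : Type*} [Fintype n] [DecidableEq n] {A : Coord d → Matrix n n ℝ}
    (hO : IsOpen O) (hA : SmoothMatOn A O) (hdet : (A u).det ≠ 0) (hu : u ∈ O)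
    (i : Fin d) :
    pd i (fun v => (A v).det) u = (A u).det * ((A u)⁻¹ * pdMat i A u).trace := by
  set f : (n → n → ℝ) → ℝ := fun M => (Matrix.of M).det
  have hf : DifferentiableAt ℝ f (fun a b => A u a b) :=
    contDiff_det_of.contDiffAt.differentiableAt (by simp)
  have hA' : HasFDerivAt (fun v a b => A v a b)
      (ContinuousLinearMap.pi fun a => ContinuousLinearMap.pi fun b =>
        fderiv ℝ (fun v => A v a b) u) u :=
    hasFDerivAt_pi.2 fun a => hasFDerivAt_pi.2 fun b =>
      (differentiableAt_of_smooth hO (hA a b) hu).hasFDerivAt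
  have h1 : pd i (fun v => (A v).det) u = fderiv ℝ f (fun a b => A u a b) (pdMat i A u) := by
    have := (hf.hasFDerivAt.comp u hA').fderiv
    unfold pd
    rw [show (fun v => (A v).det) = f ∘ fun v a b => A v a b from rfl, this]
    rfl
  -- The derivative of det in the direction ∂_i A is computed along the line A + t ∂_i A. There det
  -- factors as det A · det(1 + t A⁻¹∂_i A), a polynomial in t whose linear coefficient is a trace.
  have hline : HasDerivAt (fun t : ℝ => A u + t • pdMat i A u : ℝ → n → n → ℝ)
      (pdMat i A u) 0 := by
    refine hasDerivAt_pi.2 fun a => hasDerivAt_pi.2 fun b => ?_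
    simpa using ((hasDerivAt_id (0 : ℝ)).mul_const (pdMat i A u a b)).const_add (A u a b)
  have h2 : HasDerivAt (fun t : ℝ => (A u + t • pdMat i A u).det)
      (fderiv ℝ f (fun a b => A u a b) (pdMat i A u)) 0 := by
    refine hf.hasFDerivAt.comp_hasDerivAt_of_eq (0 : ℝ) hline ?_
    ext a b
    simp
  have h3 : HasDerivAt (fun t : ℝ => (A u + t • pdMat i A u).det)
      ((A u).det * ((A u)⁻¹ * pdMat i A u).trace) 0 := by
    have e : (fun t : ℝ => (A u + t • pdMat i A u).det) = fun t : ℝ => (A u).det *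
        (1 + ((A u)⁻¹ * pdMat i A u).trace * t
          + (((Matrix.det (1 + (Polynomial.X : Polynomial ℝ) •
            ((A u)⁻¹ * pdMat i A u).map Polynomial.C)).divX.divX).eval t) * t ^ 2) := by
      ext t
      rw [← Matrix.det_one_add_smul, ← Matrix.det_mul, mul_add, mul_one, Matrix.mul_smul,
        ← Matrix.mul_assoc, Matrix.mul_nonsing_inv _ (isUnit_iff_ne_zero.2 hdet), one_mul]
    rw [e]
    set p := ((Matrix.det (1 + (Polynomial.X : Polynomial ℝ) •
            ((A u)⁻¹ * pdMat i A u).map Polynomial.C)).divX.divX)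
    have := ((((hasDerivAt_id (0 : ℝ)).const_mul ((A u)⁻¹ * pdMat i A u).trace).const_add 1).add
      ((p.hasDerivAt 0).mul ((hasDerivAt_id (0 : ℝ)).pow 2))).const_mul (A u).det
    simpa using this
  rw [h1, h2.unique h3]

end Calculus

/-! ### Levi-Civita connection and curvature of a metric in coordinates. -/

section Metric

variable {d : ℕ} {g : Coord d → Matrix (Fin d) (Fin d) ℝ} {O : Set (Coord d)} {u : Coord d}

/-- `g` is the coefficient matrix of a smooth nondegenerate metric on the open set `O`. -/
structure IsMetricOn (g : Coord d → Matrix (Fin d) (Fin d) ℝ) (O : Set (Coord d)) : Prop where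
  isOpen : IsOpen O
  smooth : SmoothMatOn g O
  symm : ∀ v ∈ O, (g v).transpose = g v
  det_pos : ∀ v ∈ O, 0 < (g v).det

/-- The matrix `Γ_i` of Christoffel symbols, `(Γ_i)^a_b = Γ_{ib}^a`. -/
def christoffelMat (g : Coord d → Matrix (Fin d) (Fin d) ℝ) (i : Fin d) (u : Coord d) :
    Matrix (Fin d) (Fin d) ℝ :=
  Matrix.of fun a b => christoffel g a i b u

/-- The covariant derivative of a vector field, `(∇W)^a_j = ∂_j W^a + Γ_{jb}^a W^b`. -/
def covDeriv (g : Coord d → Matrix (Fin d) (Fin d) ℝ) (W : Fin d → Coord d → ℝ) (u : Coord d) :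
    Matrix (Fin d) (Fin d) ℝ :=
  Matrix.of fun a j => pd j (W a) u + ∑ b, christoffel g a j b u * W b u

/-- The covariant derivative of a vector field with the second index raised. -/
def covDerivUp (g : Coord d → Matrix (Fin d) (Fin d) ℝ) (W : Fin d → Coord d → ℝ) (u : Coord d) :
    Matrix (Fin d) (Fin d) ℝ :=
  covDeriv g W u * (g u)⁻¹

namespace IsMetricOn

theorem det_ne_zero (hg : IsMetricOn g O) : ∀ v ∈ O, (g v).det ≠ 0 :=
  fun v hv => (hg.det_pos v hv).ne'

theorem mul_inv (hg : IsMetricOn g O) (hu : u ∈ O) : g u * (g u)⁻¹ = 1 :=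
  Matrix.mul_nonsing_inv _ (isUnit_iff_ne_zero.2 (hg.det_ne_zero u hu))

theorem inv_mul (hg : IsMetricOn g O) (hu : u ∈ O) : (g u)⁻¹ * g u = 1 :=
  Matrix.nonsing_inv_mul _ (isUnit_iff_ne_zero.2 (hg.det_ne_zero u hu))

theorem inv_symm (hg : IsMetricOn g O) (hu : u ∈ O) : ((g u)⁻¹).transpose = (g u)⁻¹ := by
  rw [Matrix.transpose_nonsing_inv, hg.symm u hu]

theorem symm_apply (hg : IsMetricOn g O) (hu : u ∈ O) (i j : Fin d) : g u i j = g u j i := by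
  conv_lhs => rw [← hg.symm u hu, Matrix.transpose_apply]

theorem smooth_inv (hg : IsMetricOn g O) : SmoothMatOn (fun v => (g v)⁻¹) O :=
  hg.smooth.inv hg.det_ne_zero

theorem vol_pos (hg : IsMetricOn g O) (hu : u ∈ O) : 0 < volDensity g u :=
  Real.sqrt_pos.2 (hg.det_pos u hu)

theorem smooth_vol (hg : IsMetricOn g O) : ContDiffOn ℝ ∞ (volDensity g) O :=
  hg.smooth.det.sqrt hg.det_ne_zero

theorem smooth_christoffel (hg : IsMetricOn g O) (k i j : Fin d) :
    ContDiffOn ℝ ∞ (christoffel g k i j) O := by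
  unfold christoffel
  refine contDiffOn_const.mul (ContDiffOn.sum fun l _ => (hg.smooth_inv k l).mul ?_)
  exact ((contDiffOn_pd hg.isOpen (hg.smooth j l) i).add
    (contDiffOn_pd hg.isOpen (hg.smooth i l) j)).sub (contDiffOn_pd hg.isOpen (hg.smooth i j) l)

theorem christoffel_symm (hg : IsMetricOn g O) (hu : u ∈ O) (k i j : Fin d) :
    christoffel g k i j u = christoffel g k j i u := by
  unfold christoffel
  congr 1
  refine Finset.sum_congr rfl fun l _ => ?_
  rw [pd_congr hg.isOpen (fun v hv => hg.symm_apply hv i j) hu l]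
  ring

/-- The Christoffel symbols of the first kind. -/
theorem sum_mul_christoffel (hg : IsMetricOn g O) (hu : u ∈ O) (a i j : Fin d) :
    ∑ k, g u a k * christoffel g k i j u
      = (1 / 2) * (pd i (fun v => g v j a) u + pd j (fun v => g v i a) u
          - pd a (fun v => g v i j) u) := by
  have h : (g u).mulVec (fun k => christoffel g k i j u)
      = (1 / 2 : ℝ) • fun l => (pd i (fun v => g v j l) u + pd j (fun v => g v i l) u
          - pd l (fun v => g v i j) u) := by
    have : (fun k => christoffel g k i j u) = (g u)⁻¹.mulVec ((1 / 2 : ℝ) • fun l =>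
        (pd i (fun v => g v j l) u + pd j (fun v => g v i l) u - pd l (fun v => g v i j) u)) := by
      rw [Matrix.mulVec_smul]
      rfl
    rw [this, Matrix.mulVec_mulVec, hg.mul_inv hu, Matrix.one_mulVec]
  exact congrFun h a

/-- The Levi-Civita connection is compatible with the metric. -/
theorem pdMat_eq (hg : IsMetricOn g O) (hu : u ∈ O) (i : Fin d) :
    pdMat i g u = (christoffelMat g i u).transpose * g u + g u * christoffelMat g i u := by
  ext a b
  have h1 := hg.sum_mul_christoffel hu a i b
  have h2 := hg.sum_mul_christoffel hu b i a
  simp only [pdMat, christoffelMat, Matrix.add_apply, Matrix.mul_apply, Matrix.transpose_apply,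
    Matrix.of_apply]
  rw [h1]
  have h3 : ∑ k, christoffel g k i a u * g u k b = ∑ k, g u b k * christoffel g k i a u :=
    Finset.sum_congr rfl fun k _ => by rw [hg.symm_apply hu k b, mul_comm]
  rw [h3, h2, pd_congr hg.isOpen (fun v hv => hg.symm_apply hv b a) hu i]
  ring

/-- The inverse metric is parallel as well; insert metric compatibility into the derivative of an
inverse. -/
theorem pdMat_inv_eq (hg : IsMetricOn g O) (hu : u ∈ O) (i : Fin d) :
    pdMat i (fun v => (g v)⁻¹) u
      = -((g u)⁻¹ * (christoffelMat g i u).transpose + christoffelMat g i u * (g u)⁻¹) := by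
  rw [pdMat_inv hg.isOpen hg.smooth hg.det_ne_zero hu, hg.pdMat_eq hu, mul_add, add_mul,
    ← Matrix.mul_assoc, ← Matrix.mul_assoc, hg.inv_mul hu, Matrix.one_mul,
    Matrix.mul_assoc _ (g u) _, hg.mul_inv hu, Matrix.mul_one]

/-- In Jacobi's formula each of the two terms of ∂_i g contributes one trace of Γ_i, and the square
root halves the result. This identity turns coordinate divergences weighted by the density into
covariant ones. -/
theorem pd_vol (hg : IsMetricOn g O) (hu : u ∈ O) (i : Fin d) :
    pd i (volDensity g) u = volDensity g u * (christoffelMat g i u).trace := by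
  have h1 := pd_det hg.isOpen hg.smooth (hg.det_ne_zero u hu) hu i
  have h2 : ((g u)⁻¹ * pdMat i g u).trace = 2 * (christoffelMat g i u).trace := by
    rw [hg.pdMat_eq hu, mul_add, Matrix.trace_add, ← Matrix.mul_assoc (g u)⁻¹ (g u), hg.inv_mul hu,
      Matrix.one_mul, ← Matrix.mul_assoc, Matrix.trace_mul_comm, ← Matrix.mul_assoc, hg.mul_inv hu,
      Matrix.one_mul, Matrix.trace_transpose]
    ring
  have hd := differentiableAt_of_smooth hg.isOpen hg.smooth.det hu
  have h3 : pd i (volDensity g) u = 1 / (2 * volDensity g u) * pd i (fun v => (g v).det) u := by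
    unfold pd
    have := (hd.hasFDerivAt.sqrt (hg.det_ne_zero u hu)).fderiv
    rw [show volDensity g = fun v => Real.sqrt (g v).det from rfl, this]
    simp
  rw [h3, h1, h2]
  have hv := hg.vol_pos hu
  have : (g u).det = volDensity g u * volDensity g u :=
    (Real.mul_self_sqrt (hg.det_pos u hu).le).symm
  rw [this]
  field_simp

end IsMetricOn

/-- The curvature is the commutator of covariant derivatives. -/
theorem sum_riemann_mul (hg : IsMetricOn g O) {W : Fin d → Coord d → ℝ}
    (hW : ∀ a, ContDiffOn ℝ ∞ (W a) O) (hu : u ∈ O) (l i k : Fin d) :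
    ∑ b, riemann g l i k b u * W b u
      = pd i (fun v => covDeriv g W v l k) u - pd k (fun v => covDeriv g W v l i) u
        + ∑ b, christoffel g l i b u * covDeriv g W u b k
        - ∑ b, christoffel g l k b u * covDeriv g W u b i := by
  have dW := fun b => differentiableAt_of_smooth hg.isOpen (hW b) hu
  have dG := fun a b c => differentiableAt_of_smooth hg.isOpen (hg.smooth_christoffel a b c) hu
  have key : ∀ i k, pd i (fun v => covDeriv g W v l k) u = pd i (pd k (W l)) u
      + (∑ b, pd i (christoffel g l k b) u * W b u + ∑ b, christoffel g l k b u * pd i (W b) u) := by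
    intro i k
    simp only [covDeriv, Matrix.of_apply]
    rw [pd_add (differentiableAt_of_smooth hg.isOpen (contDiffOn_pd hg.isOpen (hW l) k) hu)
      (DifferentiableAt.fun_sum fun b _ => (dG l k b).fun_mul (dW b)),
      pd_sum (f := fun b v => christoffel g l k b v * W b v) fun b _ => (dG l k b).fun_mul (dW b),
      ← Finset.sum_add_distrib]
    congr 1
    exact Finset.sum_congr rfl fun b _ => pd_mul (dG l k b) (dW b) i
  -- After antisymmetrising in i and k the second derivatives of W cancel by symmetry and the terms
  -- Γ∂W cancel in pairs. Only ∂Γ and ΓΓ acting on W survive. The connection terms for the lower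
  -- index are symmetric in i, k and hence never have to appear.
  rw [key, key, pd_comm hg.isOpen (hW l) hu i k]
  simp only [covDeriv, riemann, Matrix.of_apply, add_mul, sub_mul, mul_add, Finset.mul_sum,
    Finset.sum_mul, Finset.sum_add_distrib, Finset.sum_sub_distrib, ← mul_assoc]
  rw [Finset.sum_comm (f := fun b c => christoffel g l i b u * christoffel g b k c u * W c u),
    Finset.sum_comm (f := fun b c => christoffel g l k b u * christoffel g b i c u * W c u)]
  ring

/-! ### Hodge Laplacian of a vector field and the Weitzenböck formula. -/

section VectorField

variable {W : Fin d → Coord d → ℝ}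

theorem smoothMatOn_covDeriv (hg : IsMetricOn g O) (hW : ∀ a, ContDiffOn ℝ ∞ (W a) O) :
    SmoothMatOn (covDeriv g W) O := fun a j => by
  simp only [covDeriv, Matrix.of_apply]
  exact (contDiffOn_pd hg.isOpen (hW a) j).add
    (ContDiffOn.sum fun b _ => (hg.smooth_christoffel a j b).mul (hW b))

theorem smoothMatOn_covDerivUp (hg : IsMetricOn g O) (hW : ∀ a, ContDiffOn ℝ ∞ (W a) O) :
    SmoothMatOn (covDerivUp g W) O :=
  (smoothMatOn_covDeriv hg hW).mul hg.smooth_inv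

theorem sum_inv_mul_flat (hg : IsMetricOn g O) (hu : u ∈ O) (i : Fin d) :
    ∑ j, (g u)⁻¹ i j * flat g W j u = W i u := by
  have h : (g u)⁻¹.mulVec ((g u).mulVec fun j => W j u) = fun j => W j u := by
    rw [Matrix.mulVec_mulVec, hg.inv_mul hu, Matrix.one_mulVec]
  exact congrFun h i

/-- The codifferential of `W^♭` is minus the divergence of `W`. -/
theorem codiffOne_flat (hg : IsMetricOn g O) (hW : ∀ a, ContDiffOn ℝ ∞ (W a) O) (hu : u ∈ O) :
    codiffOne g (flat g W) u = -(covDeriv g W u).trace := by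
  have hv := (hg.vol_pos hu).ne'
  unfold codiffOne
  have h : ∀ i, pd i (fun v => volDensity g v * ∑ j, (g v)⁻¹ i j * flat g W j v) u
      = volDensity g u * (∑ b, christoffel g b i b u * W i u + pd i (W i) u) := by
    intro i
    rw [pd_congr (f' := fun v => volDensity g v * W i v) hg.isOpen
      (fun v hv => by simp only [sum_inv_mul_flat hg hv]) hu,
      pd_mul (differentiableAt_of_smooth hg.isOpen hg.smooth_vol hu)
        (differentiableAt_of_smooth hg.isOpen (hW i) hu), hg.pd_vol hu]
    simp only [Matrix.trace, christoffelMat, Matrix.diag_apply, Matrix.of_apply, ← Finset.sum_mul]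
    ring
  simp only [h, ← Finset.mul_sum, inv_mul_cancel_left₀ hv, Matrix.trace, Matrix.diag_apply,
    covDeriv, Matrix.of_apply, Finset.sum_add_distrib, add_comm]
  rw [Finset.sum_comm]
  congr 2
  exact Finset.sum_congr rfl fun b _ => Finset.sum_congr rfl fun i _ => by
    rw [hg.christoffel_symm hu]

/-- By metric compatibility ∂_i(g_{jk}W^k) is the lowered covariant derivative plus Γ_{ij}^m g_{mk}
W^k. The extra term is symmetric in i, j, so the exterior derivative does not see it. -/
theorem dOne_flat (hg : IsMetricOn g O) (hW : ∀ a, ContDiffOn ℝ ∞ (W a) O) (hu : u ∈ O)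
    (i j : Fin d) :
    dOne (flat g W) i j u = (g u * covDeriv g W u) j i - (g u * covDeriv g W u) i j := by
  have key : ∀ i j, pd i (flat g W j) u = (g u * covDeriv g W u) j i
      + ∑ k, ∑ m, christoffel g m i j u * g u m k * W k u := by
    intro i j
    have dW := fun b => differentiableAt_of_smooth hg.isOpen (hW b) hu
    have dg := fun a b => differentiableAt_of_smooth hg.isOpen (hg.smooth a b) hu
    unfold flat
    rw [pd_sum (f := fun k v => g v j k * W k v) fun k _ => (dg j k).mul (dW k)]
    have h1 : ∀ k, pd i (fun v => g v j k * W k v) u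
        = (∑ m, christoffel g m i j u * g u m k + ∑ m, g u j m * christoffel g m i k u) * W k u
          + g u j k * pd i (W k) u := by
      intro k
      rw [pd_mul (dg j k) (dW k)]
      congr 2
      have := congrFun (congrFun (hg.pdMat_eq hu i) j) k
      simpa [pdMat, christoffelMat, Matrix.mul_apply] using this
    simp only [h1, Matrix.mul_apply, covDeriv, Matrix.of_apply, mul_add, add_mul, Finset.mul_sum,
      Finset.sum_mul, Finset.sum_add_distrib, ← mul_assoc]
    rw [Finset.sum_comm (f := fun k m => g u j m * christoffel g m i k u * W k u)]
    ring
  unfold dOne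
  rw [key, key]
  simp only [fun m => hg.christoffel_symm hu m j i]
  ring

/-- Raising both indices is multiplication by g⁻¹ on both sides, and it sends the lowered ∇W and its
transpose to `covDerivUp` and its transpose. -/
theorem raise_dOne_flat (hg : IsMetricOn g O) (hW : ∀ a, ContDiffOn ℝ ∞ (W a) O) (hu : u ∈ O)
    (i l : Fin d) :
    ∑ a, ∑ b, (g u)⁻¹ i a * (g u)⁻¹ l b * dOne (flat g W) a b u
      = covDerivUp g W u l i - covDerivUp g W u i l := by
  have h : (g u)⁻¹ * ((g u * covDeriv g W u).transpose - g u * covDeriv g W u) * (g u)⁻¹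
      = (covDerivUp g W u).transpose - covDerivUp g W u := by
    unfold covDerivUp
    rw [Matrix.transpose_mul, Matrix.transpose_mul, hg.symm u hu, hg.inv_symm hu, mul_sub, sub_mul,
      ← Matrix.mul_assoc (g u)⁻¹ (g u), hg.inv_mul hu, Matrix.one_mul, Matrix.mul_assoc,
      Matrix.mul_assoc _ (g u), hg.mul_inv hu, Matrix.mul_one]
  have h2 := congrFun (congrFun h i) l
  simp only [Matrix.sub_apply, Matrix.transpose_apply] at h2
  rw [← h2, Matrix.mul_apply, Finset.sum_comm]
  refine Finset.sum_congr rfl fun b _ => ?_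
  rw [Matrix.mul_apply, Finset.sum_mul]
  refine Finset.sum_congr rfl fun a _ => ?_
  rw [dOne_flat hg hW hu, Matrix.sub_apply, Matrix.transpose_apply]
  have : (g u)⁻¹ l b = (g u)⁻¹ b l := by
    conv_lhs => rw [← hg.inv_symm hu, Matrix.transpose_apply]
  rw [this]
  ring

/-- The Hodge Laplacian in terms of the covariant derivative. -/
theorem hodgeLaplacian_eq (hg : IsMetricOn g O) (hW : ∀ a, ContDiffOn ℝ ∞ (W a) O) (hu : u ∈ O)
    (a : Fin d) :
    hodgeLaplacian g W a u = -∑ j, (g u)⁻¹ a j * pd j (fun v => (covDeriv g W v).trace) u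
      - (volDensity g u)⁻¹ * ∑ i, pd i (fun v => volDensity g v *
          (covDerivUp g W v a i - covDerivUp g W v i a)) u := by
  have h1 : ∀ j, pd j (codiffOne g (flat g W)) u
      = -pd j (fun v => (covDeriv g W v).trace) u := by
    intro j
    rw [pd_congr hg.isOpen (fun v hv => codiffOne_flat hg hW hv) hu]
    simp only [pd]
    rw [fderiv_fun_neg]
    rfl
  have h2 : ∀ j, codiffTwo g (dOne (flat g W)) j u = ∑ l, g u j l * (-(volDensity g u)⁻¹ *
      ∑ i, pd i (fun v => volDensity g v * (covDerivUp g W v l i - covDerivUp g W v i l)) u) := by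
    intro j
    unfold codiffTwo
    rw [Finset.mul_sum, ← Finset.sum_neg_distrib]
    refine Finset.sum_congr rfl fun l _ => ?_
    rw [Finset.sum_congr rfl fun i _ => pd_congr hg.isOpen
      (f' := fun v => volDensity g v * (covDerivUp g W v l i - covDerivUp g W v i l))
      (fun v hv => by simp only [raise_dOne_flat hg hW hv]) hu i]
    ring
  unfold hodgeLaplacian
  simp only [h1, h2, mul_add, Finset.sum_add_distrib, mul_neg, Finset.sum_neg_distrib]
  rw [sub_eq_add_neg]
  congr 1
  -- The index lowered inside `codiffTwo` is raised again. Only the point u matters, so the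
  -- components fed to `sum_inv_mul_flat` are constant functions.
  have h3 := sum_inv_mul_flat (W := fun l _ => -(volDensity g u)⁻¹ *
      ∑ i, pd i (fun v => volDensity g v * (covDerivUp g W v l i - covDerivUp g W v i l)) u) hg hu a
  simpa [flat] using h3

/-- The Weitzenböck formula for vector fields: the rough Laplacian is minus the Hodge Laplacian
plus the Ricci curvature. -/
theorem weitzenbock (hg : IsMetricOn g O) (hW : ∀ a, ContDiffOn ℝ ∞ (W a) O) (hu : u ∈ O)
    (a : Fin d) :
    (volDensity g u)⁻¹ * ∑ i, pd i (fun v => volDensity g v * covDerivUp g W v a i) u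
        + ∑ i, ∑ b, christoffel g a i b u * covDerivUp g W u b i
      = -hodgeLaplacian g W a u + ∑ b, ricciMixed g a b u * W b u := by
  have hv := (hg.vol_pos hu).ne'
  have dvol := differentiableAt_of_smooth hg.isOpen hg.smooth_vol hu
  have dQ := fun a b => differentiableAt_of_smooth hg.isOpen (smoothMatOn_covDerivUp hg hW a b) hu
  have dM := fun a b => differentiableAt_of_smooth hg.isOpen (smoothMatOn_covDeriv hg hW a b) hu
  rw [hodgeLaplacian_eq hg hW hu]
  simp only [mul_sub]
  rw [Finset.sum_congr rfl fun i _ => pd_sub (dvol.fun_mul (dQ a i)) (dvol.fun_mul (dQ i a)) i,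
    Finset.sum_sub_distrib]
  -- Trace of the commutator formula: R^a_b W^b = g^{ak}(∇_i∇_k W^i - ∇_k∇_i W^i).
  have hRic : ∑ b, ricciMixed g a b u * W b u = ∑ k, (g u)⁻¹ a k *
      ∑ i, (pd i (fun v => covDeriv g W v i k) u - pd k (fun v => covDeriv g W v i i) u
        + ∑ b, christoffel g i i b u * covDeriv g W u b k
        - ∑ b, christoffel g i k b u * covDeriv g W u b i) := by
    simp only [← sum_riemann_mul hg hW hu, ricciMixed, ricci, Finset.sum_mul, Finset.mul_sum]
    rw [Finset.sum_comm]
    refine Finset.sum_congr rfl fun k _ => ?_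
    rw [Finset.sum_comm]
    simp only [mul_assoc]
  have htr : ∀ k, pd k (fun v => (covDeriv g W v).trace) u
      = ∑ i, pd k (fun v => covDeriv g W v i i) u := fun k =>
    pd_sum (f := fun i v => covDeriv g W v i i) (fun i _ => dM i i) k
  -- The coordinate divergence of the transposed tensor ∇^a W^i, written through derivatives of ∇W
  -- and Christoffel symbols. With the last term moved across it equals ∇_i∇^a W^i, and subtracting
  -- the gradient of the divergence leaves exactly `hRic`.
  have hQ : (volDensity g u)⁻¹ * ∑ i, pd i (fun v => volDensity g v * covDerivUp g W v i a) u
      = ∑ k, (g u)⁻¹ a k * ∑ i, (pd i (fun v => covDeriv g W v i k) u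
          + ∑ b, christoffel g i i b u * covDeriv g W u b k
          - ∑ b, christoffel g i k b u * covDeriv g W u b i)
        - ∑ i, ∑ b, christoffel g a i b u * covDerivUp g W u b i := by
    have h1 : ∀ i, pd i (fun v => volDensity g v * covDerivUp g W v i a) u
        = volDensity g u * ((christoffelMat g i u).trace * covDerivUp g W u i a
          + (pdMat i (covDeriv g W) u * (g u)⁻¹ - covDeriv g W u * christoffelMat g i u * (g u)⁻¹
            - covDerivUp g W u * (christoffelMat g i u).transpose) i a) := by
      intro i
      have h2 : pd i (fun v => covDerivUp g W v i a) u
          = (pdMat i (covDeriv g W) u * (g u)⁻¹ - covDeriv g W u * christoffelMat g i u * (g u)⁻¹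
            - covDerivUp g W u * (christoffelMat g i u).transpose) i a := by
        have h3 := pdMat_mul hg.isOpen (smoothMatOn_covDeriv hg hW) hg.smooth_inv hu i
        rw [hg.pdMat_inv_eq hu] at h3
        have h4 := congrFun (congrFun h3 i) a
        simp only [pdMat, Matrix.of_apply] at h4
        rw [show (fun v => covDerivUp g W v i a)
          = fun v => (covDeriv g W v * (g v)⁻¹) i a from rfl, h4]
        simp only [pdMat, covDerivUp, Matrix.mul_neg, mul_add, Matrix.mul_assoc, Matrix.sub_apply,
          Matrix.add_apply, Matrix.neg_apply]
        ring
      rw [pd_mul dvol (dQ i a), hg.pd_vol hu, h2]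
      ring
    simp only [h1, ← Finset.mul_sum, inv_mul_cancel_left₀ hv]
    have hs : ∀ k, (g u)⁻¹ k a = (g u)⁻¹ a k := fun k => by
      conv_lhs => rw [← hg.inv_symm hu, Matrix.transpose_apply]
    simp only [Finset.sum_add_distrib, Finset.sum_sub_distrib, Matrix.sub_apply]
    have e1 : ∑ i, (christoffelMat g i u).trace * covDerivUp g W u i a
        = ∑ k, (g u)⁻¹ a k * ∑ i, ∑ b, christoffel g i i b u * covDeriv g W u b k := by
      simp only [Matrix.trace, Matrix.diag_apply, christoffelMat, Matrix.of_apply, covDerivUp,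
        Matrix.mul_apply, Finset.mul_sum, Finset.sum_mul, hs]
      rw [Finset.sum_comm]
      refine Finset.sum_congr rfl fun k _ => ?_
      rw [Finset.sum_comm]
      refine Finset.sum_congr rfl fun i _ => Finset.sum_congr rfl fun b _ => ?_
      rw [hg.christoffel_symm hu]
      ring
    have e2 : ∑ i, (pdMat i (covDeriv g W) u * (g u)⁻¹) i a
        = ∑ k, (g u)⁻¹ a k * ∑ i, pd i (fun v => covDeriv g W v i k) u := by
      simp only [Matrix.mul_apply, pdMat, Matrix.of_apply, Finset.mul_sum, hs]
      rw [Finset.sum_comm]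
      simp only [mul_comm]
    have e3 : ∑ i, (covDeriv g W u * christoffelMat g i u * (g u)⁻¹) i a
        = ∑ k, (g u)⁻¹ a k * ∑ i, ∑ b, christoffel g i k b u * covDeriv g W u b i := by
      simp only [Matrix.mul_apply, christoffelMat, Matrix.of_apply, Finset.mul_sum, Finset.sum_mul,
        hs]
      rw [Finset.sum_comm]
      refine Finset.sum_congr rfl fun k _ => ?_
      rw [Finset.sum_comm]
      refine Finset.sum_congr rfl fun i _ => Finset.sum_congr rfl fun b _ => ?_
      rw [hg.christoffel_symm hu]
      ring
    have e4 : ∑ i, (covDerivUp g W u * (christoffelMat g i u).transpose) i a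
        = ∑ i, ∑ b, christoffel g a i b u * covDerivUp g W u b i := by
      simp only [Matrix.mul_apply, christoffelMat, Matrix.of_apply, Matrix.transpose_apply]
      rw [Finset.sum_comm]
      refine Finset.sum_congr rfl fun i _ => Finset.sum_congr rfl fun b _ => ?_
      rw [hg.christoffel_symm hu]
      ring
    rw [e1, e2, e3, e4]
    simp only [mul_add, mul_sub, Finset.sum_add_distrib, Finset.sum_sub_distrib]
    ring
  rw [mul_sub, hQ, hRic]
  simp only [htr, mul_add, mul_sub, Finset.sum_add_distrib, Finset.sum_sub_distrib]
  ring

end VectorField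

end Metric

/-! ### Smoothness of the differential operators. -/

section Smoothness

variable {d : ℕ} {F : Type*} [NormedAddCommGroup F] [NormedSpace ℝ F]
  {g : Coord d → Matrix (Fin d) (Fin d) ℝ} {O : Set (Coord d)}

theorem smooth_laplaceBeltrami (hg : IsMetricOn g O) {f : Coord d → F}
    (hf : ContDiffOn ℝ ∞ f O) : ContDiffOn ℝ ∞ (laplaceBeltrami g f) O := by
  unfold laplaceBeltrami
  refine (hg.smooth_vol.inv fun v hv => (hg.vol_pos hv).ne').smul
    (ContDiffOn.sum fun i _ => contDiffOn_pd hg.isOpen ?_ i)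
  exact hg.smooth_vol.smul (ContDiffOn.sum fun j _ =>
    (hg.smooth_inv i j).smul (contDiffOn_pd hg.isOpen hf j))

theorem smooth_ricciMixed (hg : IsMetricOn g O) (a b : Fin d) :
    ContDiffOn ℝ ∞ (ricciMixed g a b) O := by
  unfold ricciMixed ricci riemann
  refine ContDiffOn.sum fun c _ => (hg.smooth_inv a c).mul (ContDiffOn.sum fun i _ => ?_)
  refine ((contDiffOn_pd hg.isOpen (hg.smooth_christoffel _ _ _) _).sub
    (contDiffOn_pd hg.isOpen (hg.smooth_christoffel _ _ _) _)).add (ContDiffOn.sum fun m _ => ?_)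
  exact ((hg.smooth_christoffel _ _ _).mul (hg.smooth_christoffel _ _ _)).sub
    ((hg.smooth_christoffel _ _ _).mul (hg.smooth_christoffel _ _ _))

theorem smooth_hodgeLaplacian (hg : IsMetricOn g O) {W : Fin d → Coord d → ℝ}
    (hW : ∀ a, ContDiffOn ℝ ∞ (W a) O) (a : Fin d) :
    ContDiffOn ℝ ∞ (hodgeLaplacian g W a) O := by
  have hQ := smoothMatOn_covDerivUp hg hW
  refine ContDiffOn.congr (f₁ := hodgeLaplacian g W a) ?_
    (fun u hu => hodgeLaplacian_eq hg hW hu a)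
  refine (ContDiffOn.sum fun j _ => (hg.smooth_inv a j).mul (contDiffOn_pd hg.isOpen
    (ContDiffOn.sum fun i _ => smoothMatOn_covDeriv hg hW i i) j)).neg.sub
    ((hg.smooth_vol.inv fun v hv => (hg.vol_pos hv).ne').mul (ContDiffOn.sum fun i _ =>
      contDiffOn_pd hg.isOpen (hg.smooth_vol.mul ((hQ a i).sub (hQ i a))) i))

end Smoothness

/-! ### Immersions: projections, Gauss formula, Laplacian of a tangent field. -/

section Immersion

variable {d D : ℕ} {φ : Coord d → EuclideanSpace ℝ (Fin D)} {O : Set (Coord d)} {u : Coord d}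

theorem inducedMetric_apply (i j : Fin d) :
    inducedMetric φ u i j = inner ℝ (pd i φ u) (pd j φ u) := rfl

/-- The induced metric is the Gram matrix of the images of the standard basis, which an injective
derivative keeps linearly independent. -/
theorem det_inducedMetric_pos (h : Function.Injective (fderiv ℝ φ u)) :
    0 < (inducedMetric φ u).det := by
  have hli : LinearIndependent ℝ fun i => pd i φ u := by
    have := (EuclideanSpace.basisFun (Fin d) ℝ).toBasis.linearIndependent.map'
      (fderiv ℝ φ u).toLinearMap (LinearMap.ker_eq_bot.2 h)
    have e : (fun i => pd i φ u) = (fderiv ℝ φ u).toLinearMap ∘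
        (EuclideanSpace.basisFun (Fin d) ℝ).toBasis := by
      ext i
      simp [pd]
    rw [e]
    exact this
  exact (Matrix.posDef_gram_of_linearIndependent hli).det_pos

theorem smoothMatOn_inducedMetric (hO : IsOpen O) (hφ : ContDiffOn ℝ ∞ φ O) :
    SmoothMatOn (inducedMetric φ) O := fun i j =>
  (contDiffOn_pd hO hφ i).inner ℝ (contDiffOn_pd hO hφ j)

theorem isMetricOn_inducedMetric (hO : IsOpen O) (hφ : ContDiffOn ℝ ∞ φ O)
    (h : ∀ u ∈ O, 0 < (inducedMetric φ u).det) : IsMetricOn (inducedMetric φ) O where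
  isOpen := hO
  smooth := smoothMatOn_inducedMetric hO hφ
  symm v _ := by
    ext i j
    simp [inducedMetric_apply, real_inner_comm]
  det_pos := h

theorem tangentCoeff_add (x y : EuclideanSpace ℝ (Fin D)) (a : Fin d) :
    tangentCoeff φ u (x + y) a = tangentCoeff φ u x a + tangentCoeff φ u y a := by
  simp [tangentCoeff, inner_add_left, mul_add, Finset.sum_add_distrib]

theorem tangentProj_add (x y : EuclideanSpace ℝ (Fin D)) :
    tangentProj φ u (x + y) = tangentProj φ u x + tangentProj φ u y := by
  simp [tangentProj, tangentCoeff_add, add_smul, Finset.sum_add_distrib]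

theorem tangentProj_smul (k : ℝ) (x : EuclideanSpace ℝ (Fin D)) :
    tangentProj φ u (k • x) = k • tangentProj φ u x := by
  simp only [tangentProj, tangentCoeff, real_inner_smul_left, Finset.smul_sum, smul_smul,
    Finset.mul_sum, mul_left_comm]

theorem tangentProj_neg (x : EuclideanSpace ℝ (Fin D)) :
    tangentProj φ u (-x) = -tangentProj φ u x := by
  simpa using tangentProj_smul (φ := φ) (u := u) (-1) x

theorem tangentProj_zero : tangentProj φ u 0 = 0 := by
  simp [tangentProj, tangentCoeff]

theorem tangentProj_sum {ι : Type*} (s : Finset ι) (x : ι → EuclideanSpace ℝ (Fin D)) :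
    tangentProj φ u (∑ k ∈ s, x k) = ∑ k ∈ s, tangentProj φ u (x k) := by
  classical
  induction s using Finset.induction_on with
  | empty => simp [tangentProj_zero]
  | insert k s hk ih => rw [Finset.sum_insert hk, Finset.sum_insert hk, tangentProj_add, ih]

/-- Reduces an equality of tangent vectors to testing against the coordinate fields. -/
theorem tangentProj_congr {x y : EuclideanSpace ℝ (Fin D)}
    (h : ∀ c, inner ℝ x (pd c φ u) = inner ℝ y (pd c φ u)) :
    tangentProj φ u x = tangentProj φ u y := by
  simp [tangentProj, tangentCoeff, h]

theorem tangentProj_add_normalProj (x : EuclideanSpace ℝ (Fin D)) :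
    tangentProj φ u x + normalProj φ u x = x := by
  simp [normalProj]

theorem sum_tangentCoeff_mul (hg : IsMetricOn (inducedMetric φ) O) (hu : u ∈ O)
    (x : EuclideanSpace ℝ (Fin D)) (c : Fin d) :
    ∑ a, tangentCoeff φ u x a * inducedMetric φ u a c = inner ℝ x (pd c φ u) := by
  have h : (inducedMetric φ u).mulVec ((inducedMetric φ u)⁻¹.mulVec fun b =>
      inner ℝ x (pd b φ u)) = fun b => inner ℝ x (pd b φ u) := by
    rw [Matrix.mulVec_mulVec, hg.mul_inv hu, Matrix.one_mulVec]
  rw [← congrFun h c]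
  refine Finset.sum_congr rfl fun a _ => ?_
  rw [hg.symm_apply hu a c, mul_comm]
  rfl

theorem inner_tangentProj (hg : IsMetricOn (inducedMetric φ) O) (hu : u ∈ O)
    (x : EuclideanSpace ℝ (Fin D)) (c : Fin d) :
    inner ℝ (tangentProj φ u x) (pd c φ u) = inner ℝ x (pd c φ u) := by
  conv_rhs => rw [← sum_tangentCoeff_mul hg hu]
  simp [tangentProj, sum_inner, inner_smul_left, inducedMetric_apply]

theorem inner_normalProj (hg : IsMetricOn (inducedMetric φ) O) (hu : u ∈ O)
    (x : EuclideanSpace ℝ (Fin D)) (c : Fin d) :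
    inner ℝ (normalProj φ u x) (pd c φ u) = 0 := by
  rw [normalProj, inner_sub_left, inner_tangentProj hg hu, sub_self]

theorem tangentCoeff_pd (hg : IsMetricOn (inducedMetric φ) O) (hu : u ∈ O) (a b : Fin d) :
    tangentCoeff φ u (pd b φ u) a = if a = b then 1 else 0 := by
  have := congrFun (congrFun (hg.inv_mul hu) a) b
  rw [Matrix.one_apply] at this
  rw [← this, Matrix.mul_apply]
  refine Finset.sum_congr rfl fun c _ => ?_
  rw [inducedMetric_apply, real_inner_comm]

theorem tangentCoeff_sum_smul (hg : IsMetricOn (inducedMetric φ) O) (hu : u ∈ O)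
    (k : Fin d → ℝ) (a : Fin d) : tangentCoeff φ u (∑ b, k b • pd b φ u) a = k a := by
  have : tangentCoeff φ u (∑ b, k b • pd b φ u) a
      = ∑ b, k b * tangentCoeff φ u (pd b φ u) a := by
    simp only [tangentCoeff, sum_inner, inner_smul_left, Finset.mul_sum]
    rw [Finset.sum_comm]
    refine Finset.sum_congr rfl fun b _ => Finset.sum_congr rfl fun c _ => ?_
    simp
    ring
  simp [this, tangentCoeff_pd hg hu]

theorem tangentProj_sum_smul (hg : IsMetricOn (inducedMetric φ) O) (hu : u ∈ O)
    (k : Fin d → ℝ) : tangentProj φ u (∑ b, k b • pd b φ u) = ∑ b, k b • pd b φ u := by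
  conv_lhs => rw [tangentProj]
  simp only [tangentCoeff_sum_smul hg hu]

theorem smooth_tangentCoeff (hO : IsOpen O) (hφ : ContDiffOn ℝ ∞ φ O)
    (hg : IsMetricOn (inducedMetric φ) O) {x : Coord d → EuclideanSpace ℝ (Fin D)}
    (hx : ContDiffOn ℝ ∞ x O) (a : Fin d) :
    ContDiffOn ℝ ∞ (fun v => tangentCoeff φ v (x v) a) O :=
  ContDiffOn.sum fun b _ => (hg.smooth_inv a b).mul (hx.inner ℝ (contDiffOn_pd hO hφ b))

theorem smooth_tangentProj (hO : IsOpen O) (hφ : ContDiffOn ℝ ∞ φ O)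
    (hg : IsMetricOn (inducedMetric φ) O) {x : Coord d → EuclideanSpace ℝ (Fin D)}
    (hx : ContDiffOn ℝ ∞ x O) : ContDiffOn ℝ ∞ (fun v => tangentProj φ v (x v)) O :=
  ContDiffOn.sum fun a _ => (smooth_tangentCoeff hO hφ hg hx a).smul (contDiffOn_pd hO hφ a)

theorem smooth_normalProj (hO : IsOpen O) (hφ : ContDiffOn ℝ ∞ φ O)
    (hg : IsMetricOn (inducedMetric φ) O) {x : Coord d → EuclideanSpace ℝ (Fin D)}
    (hx : ContDiffOn ℝ ∞ x O) : ContDiffOn ℝ ∞ (fun v => normalProj φ v (x v)) O :=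
  hx.sub (smooth_tangentProj hO hφ hg hx)

theorem smooth_secondFF (hO : IsOpen O) (hφ : ContDiffOn ℝ ∞ φ O)
    (hg : IsMetricOn (inducedMetric φ) O) (i j : Fin d) :
    ContDiffOn ℝ ∞ (secondFF φ i j) O :=
  smooth_normalProj hO hφ hg (contDiffOn_pd hO (contDiffOn_pd hO hφ j) i)

theorem pd_inducedMetric (hO : IsOpen O) (hφ : ContDiffOn ℝ ∞ φ O) (hu : u ∈ O) (i j l : Fin d) :
    pd i (fun v => inducedMetric φ v j l) u
      = inner ℝ (pd i (pd j φ) u) (pd l φ u) + inner ℝ (pd j φ u) (pd i (pd l φ) u) :=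
  pd_inner (differentiableAt_of_smooth hO (contDiffOn_pd hO hφ j) hu)
    (differentiableAt_of_smooth hO (contDiffOn_pd hO hφ l) hu) i

/-- The Levi-Civita connection is the tangential part of the derivative. -/
theorem tangentCoeff_pd_pd (hO : IsOpen O) (hφ : ContDiffOn ℝ ∞ φ O) (hu : u ∈ O)
    (i j k : Fin d) :
    tangentCoeff φ u (pd i (pd j φ) u) k = christoffel (inducedMetric φ) k i j u := by
  unfold tangentCoeff christoffel
  rw [Finset.mul_sum]
  refine Finset.sum_congr rfl fun l _ => ?_
  -- Of the six inner products produced by the three derivatives of g, four cancel by symmetry of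
  -- second derivatives. The other two agree and absorb the factor 1/2.
  rw [pd_inducedMetric hO hφ hu, pd_inducedMetric hO hφ hu, pd_inducedMetric hO hφ hu,
    pd_comm hO hφ hu j i, pd_comm hO hφ hu l i, pd_comm hO hφ hu l j,
    real_inner_comm (pd j φ u) (pd i (pd l φ) u)]
  ring

/-- The Gauss formula. -/
theorem pd_pd_eq (hO : IsOpen O) (hφ : ContDiffOn ℝ ∞ φ O) (hu : u ∈ O) (i j : Fin d) :
    pd i (pd j φ) u
      = ∑ k, christoffel (inducedMetric φ) k i j u • pd k φ u + secondFF φ i j u := by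
  rw [← tangentProj_add_normalProj (φ := φ) (u := u) (pd i (pd j φ) u)]
  simp only [secondFF, tangentProj, tangentCoeff_pd_pd hO hφ hu]

theorem inner_secondFF (hg : IsMetricOn (inducedMetric φ) O) (hu : u ∈ O) (i j c : Fin d) :
    inner ℝ (secondFF φ i j u) (pd c φ u) = 0 :=
  inner_normalProj hg hu _ c

theorem inner_weingarten (hg : IsMetricOn (inducedMetric φ) O) (hu : u ∈ O)
    (ξ : EuclideanSpace ℝ (Fin D)) (m c : Fin d) :
    inner ℝ (weingarten φ ξ m u) (pd c φ u) = inner ℝ (secondFF φ m c u) ξ := by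
  have h : (inducedMetric φ u).mulVec ((inducedMetric φ u)⁻¹.mulVec fun b =>
      inner ℝ (secondFF φ m b u) ξ) = fun b => inner ℝ (secondFF φ m b u) ξ := by
    rw [Matrix.mulVec_mulVec, hg.mul_inv hu, Matrix.one_mulVec]
  rw [← congrFun h c]
  simp only [weingarten, sum_inner, inner_smul_left, Matrix.mulVec, dotProduct]
  refine Finset.sum_congr rfl fun a _ => ?_
  rw [hg.symm_apply hu c a, inducedMetric_apply, mul_comm]
  rfl

variable {W : Fin d → Coord d → ℝ}

/-- Product rule and Gauss formula: the tangential part is the Levi-Civita derivative, the normal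
part the second fundamental form applied to W. -/
theorem pd_sum_smul_pd (hO : IsOpen O) (hφ : ContDiffOn ℝ ∞ φ O)
    (hW : ∀ a, ContDiffOn ℝ ∞ (W a) O) (hu : u ∈ O) (j : Fin d) :
    pd j (fun v => ∑ a, W a v • pd a φ v) u
      = ∑ a, covDeriv (inducedMetric φ) W u a j • pd a φ u + ∑ a, W a u • secondFF φ j a u := by
  have dW := fun a => differentiableAt_of_smooth hO (hW a) hu
  have de := fun a => differentiableAt_of_smooth hO (contDiffOn_pd hO hφ a) hu
  rw [pd_sum (f := fun a v => W a v • pd a φ v) fun a _ => (dW a).fun_smul (de a)]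
  simp only [fun a => pd_smul (dW a) (de a) j, pd_pd_eq hO hφ hu, covDeriv, Matrix.of_apply,
    add_smul, smul_add, Finset.sum_add_distrib, Finset.sum_smul, Finset.smul_sum, smul_smul]
  rw [Finset.sum_comm (f := fun b a => (W b u * christoffel (inducedMetric φ) a j b u) • pd a φ u)]
  simp only [mul_comm (W _ u)]
  abel

/-- The Laplacian is the normalised divergence of a flux Y_i, and ⟨∂_i Y_i, ∂_c φ⟩ = ∂_i⟨Y_i, ∂_c φ⟩
- ⟨Y_i, ∂_i∂_c φ⟩. The normal part of Y_i enters only through the last term, where it meets the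
normal part of ∂_i∂_c φ and gives the product of second fundamental forms. The tangential part of
Y_i gives the rough Laplacian of W. -/
theorem inner_laplaceBeltrami_tangent (hO : IsOpen O) (hφ : ContDiffOn ℝ ∞ φ O)
    (hg : IsMetricOn (inducedMetric φ) O) (hW : ∀ a, ContDiffOn ℝ ∞ (W a) O) (hu : u ∈ O)
    (c : Fin d) :
    inner ℝ (laplaceBeltrami (inducedMetric φ) (fun v => ∑ a, W a v • pd a φ v) u) (pd c φ u)
      = ∑ a, ((volDensity (inducedMetric φ) u)⁻¹ * ∑ i, pd i (fun v =>
            volDensity (inducedMetric φ) v * covDerivUp (inducedMetric φ) W v a i) u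
          + ∑ i, ∑ b, christoffel (inducedMetric φ) a i b u * covDerivUp (inducedMetric φ) W u b i)
            * inducedMetric φ u a c
        - ∑ m, ∑ n, ∑ a, (inducedMetric φ u)⁻¹ m n * W a u *
            inner ℝ (secondFF φ m c u) (secondFF φ n a u) := by
  set g := inducedMetric φ with hgdef
  have hv := (hg.vol_pos hu).ne'
  have hQ := smoothMatOn_covDerivUp hg hW
  have dvolQ : ∀ a i, DifferentiableAt ℝ (fun v => volDensity g v * covDerivUp g W v a i) u :=
    fun a i => differentiableAt_of_smooth hO (hg.smooth_vol.mul (hQ a i)) hu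
  have de := fun a => differentiableAt_of_smooth hO (contDiffOn_pd hO hφ a) hu
  have dg := fun a b => differentiableAt_of_smooth hO (hg.smooth a b) hu
  have hF : ContDiffOn ℝ ∞ (fun v => ∑ a, W a v • pd a φ v) O :=
    ContDiffOn.sum fun a _ => (hW a).smul (contDiffOn_pd hO hφ a)
  set Y : Fin d → Coord d → EuclideanSpace ℝ (Fin D) := fun i v =>
    volDensity g v • ∑ j, (g v)⁻¹ i j • pd j (fun v => ∑ a, W a v • pd a φ v) v with hY
  have hYs : ∀ i, ContDiffOn ℝ ∞ (Y i) O := fun i => hg.smooth_vol.smul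
    (ContDiffOn.sum fun j _ => (hg.smooth_inv i j).smul (contDiffOn_pd hO hF j))
  -- Splitting of the flux into its tangential and normal parts by `pd_sum_smul_pd`.
  have hYeq : ∀ i, ∀ v ∈ O, Y i v = ∑ a, (volDensity g v * covDerivUp g W v a i) • pd a φ v
      + volDensity g v • ∑ j, ∑ a, ((g v)⁻¹ i j * W a v) • secondFF φ j a v := by
    intro i v hvO
    have hs : ∀ k, (g v)⁻¹ i k = (g v)⁻¹ k i := fun k => by
      conv_lhs => rw [← hg.inv_symm hvO, Matrix.transpose_apply]
    simp only [hY, pd_sum_smul_pd hO hφ hW hvO, smul_add, Finset.sum_add_distrib, Finset.smul_sum,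
      covDerivUp, Matrix.mul_apply, Finset.mul_sum, Finset.sum_smul, smul_smul, mul_assoc, hs]
    congr 1
    rw [Finset.sum_comm]
    simp only [mul_comm ((g v)⁻¹ _ i)]
    rfl
  have hYe : ∀ i, ∀ v ∈ O, inner ℝ (Y i v) (pd c φ v)
      = ∑ a, (volDensity g v * covDerivUp g W v a i) * g v a c := by
    intro i v hvO
    rw [hYeq i v hvO]
    simp [inner_add_left, sum_inner, inner_smul_left, inner_secondFF hg hvO, hgdef,
      inducedMetric_apply]
  have hYde : ∀ i, inner ℝ (Y i u) (pd i (pd c φ) u)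
      = ∑ a, (volDensity g u * covDerivUp g W u a i) * inner ℝ (pd a φ u) (pd i (pd c φ) u)
        + volDensity g u * ∑ j, ∑ a, (g u)⁻¹ i j * W a u *
          inner ℝ (secondFF φ i c u) (secondFF φ j a u) := by
    intro i
    have hn : ∀ j a, inner ℝ (secondFF φ j a u) (pd i (pd c φ) u)
        = inner ℝ (secondFF φ i c u) (secondFF φ j a u) := by
      intro j a
      rw [pd_pd_eq hO hφ hu i c, inner_add_right, inner_sum]
      simp [inner_smul_right, inner_secondFF hg hu, real_inner_comm]
    rw [hYeq i u hu]
    simp only [inner_add_left, sum_inner, real_inner_smul_left, hn]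
  have hdiv : ∀ i, inner ℝ (pd i (Y i) u) (pd c φ u)
      = ∑ a, (pd i (fun v => volDensity g v * covDerivUp g W v a i) u * g u a c
          + (volDensity g u * covDerivUp g W u a i) * inner ℝ (pd i (pd a φ) u) (pd c φ u))
        - volDensity g u * ∑ j, ∑ a, (g u)⁻¹ i j * W a u *
          inner ℝ (secondFF φ i c u) (secondFF φ j a u) := by
    intro i
    have h1 := pd_inner (differentiableAt_of_smooth hO (hYs i) hu) (de c) i
    rw [pd_congr hO (hYe i) hu,
      pd_sum (f := fun a v => (volDensity g v * covDerivUp g W v a i) * g v a c)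
        fun a _ => (dvolQ a i).fun_mul (dg a c), hYde i] at h1
    have h2 : ∀ a, pd i (fun v => g v a c) u
        = inner ℝ (pd i (pd a φ) u) (pd c φ u) + inner ℝ (pd a φ u) (pd i (pd c φ) u) :=
      fun a => pd_inducedMetric hO hφ hu i a c
    have h3 : ∀ a, pd i (fun v => (volDensity g v * covDerivUp g W v a i) * g v a c) u
        = pd i (fun v => volDensity g v * covDerivUp g W v a i) u * g u a c
          + (volDensity g u * covDerivUp g W u a i) * inner ℝ (pd i (pd a φ) u) (pd c φ u)
          + (volDensity g u * covDerivUp g W u a i) * inner ℝ (pd a φ u) (pd i (pd c φ) u) := by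
      intro a
      rw [pd_mul (dvolQ a i) (dg a c), h2]
      ring
    simp only [h3, Finset.sum_add_distrib] at h1 ⊢
    linarith
  have hchr : ∀ i a, inner ℝ (pd i (pd a φ) u) (pd c φ u)
      = ∑ k, christoffel g k i a u * g u k c := by
    intro i a
    rw [pd_pd_eq hO hφ hu i a, inner_add_left, inner_secondFF hg hu, add_zero, sum_inner]
    simp only [real_inner_smul_left, hgdef, inducedMetric_apply]
  have hL : inner ℝ (laplaceBeltrami g (fun v => ∑ a, W a v • pd a φ v) u) (pd c φ u)
      = (volDensity g u)⁻¹ * ∑ i, inner ℝ (pd i (Y i) u) (pd c φ u) := by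
    simp only [laplaceBeltrami, real_inner_smul_left, sum_inner, hY]
  rw [hL]
  simp only [hdiv, hchr, Finset.sum_sub_distrib, Finset.sum_add_distrib, mul_sub, mul_add,
    add_mul, ← Finset.mul_sum, inv_mul_cancel_left₀ hv, mul_assoc]
  congr 2
  · rw [Finset.sum_comm]
    simp only [Finset.mul_sum, Finset.sum_mul]
  · simp only [Finset.mul_sum, Finset.sum_mul]
    rw [Finset.sum_congr rfl fun i _ => Finset.sum_comm, Finset.sum_comm]
    refine Finset.sum_congr rfl fun a _ => Finset.sum_congr rfl fun i _ =>
      Finset.sum_congr rfl fun b _ => ?_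
    ring

/-- The tangential part of the Laplacian of a tangent field. -/
theorem tangentProj_laplaceBeltrami_tangent (hO : IsOpen O) (hφ : ContDiffOn ℝ ∞ φ O)
    (hg : IsMetricOn (inducedMetric φ) O) (hW : ∀ a, ContDiffOn ℝ ∞ (W a) O) (hu : u ∈ O) :
    tangentProj φ u (laplaceBeltrami (inducedMetric φ) (fun v => ∑ a, W a v • pd a φ v) u)
      = -∑ a, hodgeLaplacian (inducedMetric φ) W a u • pd a φ u
        + ∑ a, (∑ b, ricciMixed (inducedMetric φ) a b u * W b u) • pd a φ u
        + -∑ m, ∑ n, ∑ a, ((inducedMetric φ u)⁻¹ m n * W a u) •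
            weingarten φ (secondFF φ n a u) m u := by
  have hwein : tangentProj φ u (-∑ m, ∑ n, ∑ a, ((inducedMetric φ u)⁻¹ m n * W a u) •
        weingarten φ (secondFF φ n a u) m u)
      = -∑ m, ∑ n, ∑ a, ((inducedMetric φ u)⁻¹ m n * W a u) •
        weingarten φ (secondFF φ n a u) m u := by
    simp only [tangentProj_neg, tangentProj_sum, tangentProj_smul, weingarten,
      tangentProj_sum_smul hg hu]
  have hcomb : -∑ a, hodgeLaplacian (inducedMetric φ) W a u • pd a φ u
        + ∑ a, (∑ b, ricciMixed (inducedMetric φ) a b u * W b u) • pd a φ u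
      = ∑ a, (-hodgeLaplacian (inducedMetric φ) W a u
        + ∑ b, ricciMixed (inducedMetric φ) a b u * W b u) • pd a φ u := by
    simp only [add_smul, neg_smul, Finset.sum_add_distrib, Finset.sum_neg_distrib]
  -- Both sides become tangential projections, so it suffices to test against each ∂_c φ. There the
  -- Weitzenböck formula identifies the intrinsic terms.
  rw [hcomb, ← hwein, ← tangentProj_sum_smul hg hu, ← tangentProj_add]
  refine tangentProj_congr fun c => ?_
  rw [inner_laplaceBeltrami_tangent hO hφ hg hW hu, inner_add_left, inner_neg_left, sub_eq_add_neg]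
  simp only [weitzenbock hg hW hu, sum_inner, real_inner_smul_left, inner_weingarten hg hu,
    inducedMetric_apply]

end Immersion

/-! ### Divergence theorem for compactly supported fields. -/

section Divergence

variable {d : ℕ} {S O K : Set (Coord d)}

/-- The integral of a partial derivative of a compactly supported function vanishes. -/
theorem integral_pd_eq_zero {f : Coord d → ℝ} (hf : ContDiff ℝ ∞ f) (hc : HasCompactSupport f)
    (i : Fin d) : ∫ u, pd i f u = 0 := by
  have hd : Differentiable ℝ f := hf.differentiable (by simp)
  have hcont : Continuous fun u => fderiv ℝ f u (EuclideanSpace.single i 1) :=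
    (hf.continuous_fderiv (by simp)).clm_apply continuous_const
  have hcs : HasCompactSupport fun u => fderiv ℝ f u (EuclideanSpace.single i 1) :=
    hc.fderiv_apply ℝ (v := EuclideanSpace.single i 1)
  -- Integration by parts against the constant function 1.
  have := integral_mul_fderiv_eq_neg_fderiv_mul_of_integrable (μ := (volume : Measure (Coord d)))
    (f := fun _ => (1 : ℝ)) (g := f) (v := EuclideanSpace.single i 1) (by simp)
    (by simpa using hcont.integrable_of_hasCompactSupport hcs)
    (by simpa using hf.continuous.integrable_of_hasCompactSupport hc) (by simp)
    fun u _ => hd u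
  simpa [pd] using this

/-- The function is smooth only near S, but it vanishes on O outside K. Its extension by zero is
smooth on the whole space, has the same derivatives on O, and reduces the claim to the global one.
-/
theorem setIntegral_pd_eq_zero {f : Coord d → ℝ} (hS : IsCompact S) (hO : IsOpen O) (hSO : S ⊆ O)
    (hK : IsCompact K) (hKS : K ⊆ S) (hf : ContDiffOn ℝ ∞ f O) (h0 : ∀ u ∈ O \ K, f u = 0)
    (i : Fin d) : ∫ u in S, pd i f u = 0 := by
  set f' : Coord d → ℝ := K.indicator f with hf'
  have heq : Set.EqOn f f' O := by
    intro u hu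
    by_cases hk : u ∈ K
    · simp [hf', hk]
    · simp [hf', hk, h0 u ⟨hu, hk⟩]
  have hzero : ∀ u ∉ K, f' =ᶠ[nhds u] fun _ => 0 := fun u hu =>
    Filter.eventuallyEq_of_mem (hK.isClosed.isOpen_compl.mem_nhds hu)
      fun v hv => Set.indicator_of_notMem hv f
  have hsm : ContDiff ℝ ∞ f' := by
    refine contDiff_iff_contDiffAt.2 fun u => ?_
    by_cases hu : u ∈ O
    · exact (hf.contDiffAt (hO.mem_nhds hu)).congr_of_eventuallyEq
        (heq.symm.eventuallyEq_of_mem (hO.mem_nhds hu))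
    · exact contDiffAt_const.congr_of_eventuallyEq (hzero u fun hk => hu (hSO (hKS hk)))
  have hcs : HasCompactSupport f' :=
    HasCompactSupport.intro hK fun u hu => Set.indicator_of_notMem hu f
  rw [setIntegral_congr_fun hS.measurableSet
    (fun u hu => pd_congr hO heq (hSO hu) i : Set.EqOn (pd i f) (pd i f') S),
    setIntegral_eq_integral_of_forall_compl_eq_zero, integral_pd_eq_zero hsm hcs]
  intro u hu
  unfold pd
  rw [(hzero u fun hk => hu (hKS hk)).fderiv_eq]
  simp

/-- The divergence theorem for a vector field with compact support in `S`. -/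
theorem setIntegral_div_eq_zero {X : Fin d → Coord d → ℝ} (hS : IsCompact S) (hO : IsOpen O)
    (hSO : S ⊆ O) (hK : IsCompact K) (hKS : K ⊆ S) (hX : ∀ i, ContDiffOn ℝ ∞ (X i) O)
    (h0 : ∀ i, ∀ u ∈ O \ K, X i u = 0) : ∫ u in S, ∑ i, pd i (X i) u = 0 := by
  rw [integral_finsetSum]
  · exact Finset.sum_eq_zero fun i _ => setIntegral_pd_eq_zero hS hO hSO hK hKS (hX i) (h0 i) i
  · exact fun i _ => ((contDiffOn_pd hO (hX i) i).continuousOn.mono hSO).integrableOn_compact hS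

theorem pd_eq_zero_of_eq_zero {F : Type*} [NormedAddCommGroup F] [NormedSpace ℝ F]
    {f : Coord d → F} (hO : IsOpen O) (hK : IsCompact K) (h0 : ∀ u ∈ O \ K, f u = 0) (i : Fin d) :
    ∀ u ∈ O \ K, pd i f u = 0 := fun u hu => by
  rw [pd_congr (f' := fun _ => 0) (hO.sdiff hK.isClosed) h0 hu, pd_const]

end Divergence

/-! ### Green's identities. -/

section Green

variable {d : ℕ} {H : Type*} [NormedAddCommGroup H] [InnerProductSpace ℝ H]
  {g : Coord d → Matrix (Fin d) (Fin d) ℝ} {S O K : Set (Coord d)}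

/-- The Dirichlet form of a metric. -/
def dirichletForm (g : Coord d → Matrix (Fin d) (Fin d) ℝ) (S : Set (Coord d))
    (f f' : Coord d → H) : ℝ :=
  ∫ u in S, (∑ i, ∑ j, (g u)⁻¹ i j * inner ℝ (pd i f u) (pd j f' u)) * volDensity g u

theorem dirichletForm_comm (hg : IsMetricOn g O) (hS : IsCompact S) (hSO : S ⊆ O)
    (f f' : Coord d → H) : dirichletForm g S f f' = dirichletForm g S f' f := by
  refine setIntegral_congr_fun hS.measurableSet fun u hu => ?_
  rw [Finset.sum_comm]
  congr 1
  refine Finset.sum_congr rfl fun j _ => Finset.sum_congr rfl fun i _ => ?_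
  have : (g u)⁻¹ i j = (g u)⁻¹ j i := by
    conv_lhs => rw [← hg.inv_symm (hSO hu), Matrix.transpose_apply]
  rw [this, real_inner_comm]

/-- Green's first identity. -/
theorem integral_inner_laplaceBeltrami (hg : IsMetricOn g O) (hS : IsCompact S) (hSO : S ⊆ O)
    (hK : IsCompact K) (hKS : K ⊆ S) {f f' : Coord d → H} (hf : ContDiffOn ℝ ∞ f O)
    (hf' : ContDiffOn ℝ ∞ f' O) (h0 : (∀ u ∈ O \ K, f u = 0) ∨ ∀ u ∈ O \ K, f' u = 0) :
    ∫ u in S, inner ℝ (f u) (laplaceBeltrami g f' u) * volDensity g u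
      = -dirichletForm g S f f' := by
  have hO := hg.isOpen
  set Y : Fin d → Coord d → H := fun i v =>
    volDensity g v • ∑ j, (g v)⁻¹ i j • pd j f' v with hY
  have hYs : ∀ i, ContDiffOn ℝ ∞ (Y i) O := fun i => hg.smooth_vol.smul
    (ContDiffOn.sum fun j _ => (hg.smooth_inv i j).smul (contDiffOn_pd hO hf' j))
  -- The field ⟨f, Y_i⟩ vanishes off K whichever factor does: if f' is zero on the open set O \ K,
  -- so are its derivatives.
  have hdiv := setIntegral_div_eq_zero (X := fun i v => inner ℝ (f v) (Y i v)) hS hO hSO hK hKS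
    (fun i => hf.inner ℝ (hYs i)) (by
      intro i u hu
      rcases h0 with h0 | h0
      · simp [h0 u hu]
      · simp [hY, pd_eq_zero_of_eq_zero hO hK h0 _ u hu])
  have hpt : ∀ u ∈ S, ∑ i, pd i (fun v => inner ℝ (f v) (Y i v)) u
      = (∑ i, ∑ j, (g u)⁻¹ i j * inner ℝ (pd i f u) (pd j f' u)) * volDensity g u
        + inner ℝ (f u) (laplaceBeltrami g f' u) * volDensity g u := by
    intro u hu
    have hu := hSO hu
    have hv := (hg.vol_pos hu).ne'
    simp only [fun i => pd_inner (differentiableAt_of_smooth hO hf hu)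
      (differentiableAt_of_smooth hO (hYs i) hu) i, Finset.sum_add_distrib]
    congr 1
    · simp only [hY, inner_smul_right, inner_sum, Finset.sum_mul, Finset.mul_sum]
      exact Finset.sum_congr rfl fun i _ => Finset.sum_congr rfl fun j _ => by ring
    · simp only [laplaceBeltrami, inner_smul_right, inner_sum, hY]
      field_simp
  rw [setIntegral_congr_fun hS.measurableSet hpt, integral_add] at hdiv
  · rw [dirichletForm]
    linarith
  · refine ContinuousOn.integrableOn_compact hS ?_
    refine ContinuousOn.mono (ContDiffOn.continuousOn (𝕜 := ℝ) (n := ∞) ?_) hSO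
    exact (ContDiffOn.sum fun i _ => ContDiffOn.sum fun j _ => (hg.smooth_inv i j).mul
      ((contDiffOn_pd hO hf i).inner ℝ (contDiffOn_pd hO hf' j))).mul hg.smooth_vol
  · refine ContinuousOn.integrableOn_compact hS ?_
    refine ContinuousOn.mono (ContDiffOn.continuousOn (𝕜 := ℝ) (n := ∞) ?_) hSO
    exact (hf.inner ℝ (smooth_laplaceBeltrami hg hf')).mul hg.smooth_vol

/-- Green's second identity. -/
theorem integral_inner_laplaceBeltrami_comm (hg : IsMetricOn g O) (hS : IsCompact S)
    (hSO : S ⊆ O) (hK : IsCompact K) (hKS : K ⊆ S) {f f' : Coord d → H}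
    (hf : ContDiffOn ℝ ∞ f O) (hf' : ContDiffOn ℝ ∞ f' O) (h0 : ∀ u ∈ O \ K, f' u = 0) :
    ∫ u in S, inner ℝ (f u) (laplaceBeltrami g f' u) * volDensity g u
      = ∫ u in S, inner ℝ (f' u) (laplaceBeltrami g f u) * volDensity g u := by
  rw [integral_inner_laplaceBeltrami hg hS hSO hK hKS hf hf' (Or.inr h0),
    integral_inner_laplaceBeltrami hg hS hSO hK hKS hf' hf (Or.inl h0),
    dirichletForm_comm hg hS hSO]

end Green

/-! ### Time derivatives, and differentiation under the integral. -/

section Time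

variable {d D : ℕ} {ψ : Coord d → ℝ → EuclideanSpace ℝ (Fin D)} {t : ℝ}
  {U : Set (Coord d)} {I : Set ℝ}

theorem hasFDerivAt_uncurry (hU : IsOpen U) (hI : IsOpen I)
    (h : ContDiffOn ℝ ∞ (fun p : Coord d × ℝ => ψ p.1 p.2) (U ×ˢ I)) {u : Coord d} {s : ℝ}
    (hu : u ∈ U) (hs : s ∈ I) :
    HasFDerivAt (fun p : Coord d × ℝ => ψ p.1 p.2)
      (fderiv ℝ (fun p : Coord d × ℝ => ψ p.1 p.2) (u, s)) (u, s) :=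
  ((h.contDiffAt ((hU.prod hI).mem_nhds ⟨hu, hs⟩)).differentiableAt (by simp)).hasFDerivAt

/-- Expresses a spatial derivative at fixed time through the derivative of the map in space and time
jointly, which gives joint regularity in (u, s). -/
theorem pd_slice (hU : IsOpen U) (hI : IsOpen I)
    (h : ContDiffOn ℝ ∞ (fun p : Coord d × ℝ => ψ p.1 p.2) (U ×ˢ I)) {u : Coord d} {s : ℝ}
    (hu : u ∈ U) (hs : s ∈ I) (i : Fin d) :
    pd i (fun v => ψ v s) u
      = fderiv ℝ (fun p : Coord d × ℝ => ψ p.1 p.2) (u, s) (EuclideanSpace.single i 1, 0) := by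
  have h1 : HasFDerivAt (fun v : Coord d => (v, s)) (ContinuousLinearMap.inl ℝ (Coord d) ℝ) u :=
    (hasFDerivAt_id u).prodMk (hasFDerivAt_const s u)
  have h2 := (hasFDerivAt_uncurry hU hI h hu hs).comp u h1
  unfold pd
  rw [show (fun v => ψ v s) = (fun p : Coord d × ℝ => ψ p.1 p.2) ∘ fun v => (v, s) from rfl,
    h2.fderiv]
  simp

theorem hasDerivAt_slice {F : Type*} [NormedAddCommGroup F] [NormedSpace ℝ F]
    {f : Coord d × ℝ → F} (hU : IsOpen U) (hI : IsOpen I)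
    (h : ContDiffOn ℝ ∞ f (U ×ˢ I)) {u : Coord d} {s : ℝ} (hu : u ∈ U) (hs : s ∈ I) :
    HasDerivAt (fun r => f (u, r)) (fderiv ℝ f (u, s) (0, 1)) s := by
  have h1 : HasDerivAt (fun r : ℝ => (u, r)) ((0 : Coord d), (1 : ℝ)) s :=
    (hasDerivAt_const s u).prodMk (hasDerivAt_id s)
  exact ((h.contDiffAt ((hU.prod hI).mem_nhds ⟨hu, hs⟩)).differentiableAt
    (by simp)).hasFDerivAt.comp_hasDerivAt s h1

theorem velocity_eq (hU : IsOpen U) (hI : IsOpen I)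
    (h : ContDiffOn ℝ ∞ (fun p : Coord d × ℝ => ψ p.1 p.2) (U ×ˢ I)) {u : Coord d} {s : ℝ}
    (hu : u ∈ U) (hs : s ∈ I) :
    velocity ψ s u = fderiv ℝ (fun p : Coord d × ℝ => ψ p.1 p.2) (u, s) (0, 1) :=
  (hasDerivAt_slice hU hI h hu hs).deriv

theorem smooth_slice (h : ContDiffOn ℝ ∞ (fun p : Coord d × ℝ => ψ p.1 p.2) (U ×ˢ I))
    {s : ℝ} (hs : s ∈ I) : ContDiffOn ℝ ∞ (fun v => ψ v s) U :=
  h.comp (contDiff_id.prodMk contDiff_const).contDiffOn fun _ hv => ⟨hv, hs⟩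

theorem smooth_velocity (hU : IsOpen U) (hI : IsOpen I)
    (h : ContDiffOn ℝ ∞ (fun p : Coord d × ℝ => ψ p.1 p.2) (U ×ˢ I)) {s : ℝ} (hs : s ∈ I) :
    ContDiffOn ℝ ∞ (velocity ψ s) U := by
  refine ContDiffOn.congr ?_ fun u hu => velocity_eq hU hI h hu hs
  exact ((h.fderiv_of_isOpen (hU.prod hI) (m := ∞) (by simp)).comp
    (contDiff_id.prodMk contDiff_const).contDiffOn fun _ hv => ⟨hv, hs⟩).clm_apply contDiffOn_const

/-- Space and time derivatives commute. -/
theorem hasDerivAt_pd (hU : IsOpen U) (hI : IsOpen I)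
    (h : ContDiffOn ℝ ∞ (fun p : Coord d × ℝ => ψ p.1 p.2) (U ×ˢ I)) {u : Coord d} {s : ℝ}
    (hu : u ∈ U) (hs : s ∈ I) (i : Fin d) :
    HasDerivAt (fun r => pd i (fun v => ψ v r) u) (pd i (velocity ψ s) u) s := by
  set Ψ : Coord d × ℝ → EuclideanSpace ℝ (Fin D) := fun p => ψ p.1 p.2 with hΨ
  have hd : HasFDerivAt (fderiv ℝ Ψ) (fderiv ℝ (fderiv ℝ Ψ) (u, s)) (u, s) :=
    (((h.fderiv_of_isOpen (hU.prod hI) (m := ∞) (by simp)).contDiffAt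
      ((hU.prod hI).mem_nhds ⟨hu, hs⟩)).differentiableAt (by simp)).hasFDerivAt
  have h1 : HasDerivAt (fun r => fderiv ℝ Ψ (u, r) (EuclideanSpace.single i 1, 0))
      (fderiv ℝ (fderiv ℝ Ψ) (u, s) (0, 1) (EuclideanSpace.single i 1, 0)) s := by
    have := (hd.comp_hasDerivAt s ((hasDerivAt_const s u).prodMk (hasDerivAt_id s))).clm_apply
      (hasDerivAt_const s ((EuclideanSpace.single i 1 : Coord d), (0 : ℝ)))
    simpa using this
  have h2 : pd i (velocity ψ s) u
      = fderiv ℝ (fderiv ℝ Ψ) (u, s) (EuclideanSpace.single i 1, 0) (0, 1) := by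
    rw [pd_congr hU (fun v hv => velocity_eq hU hI h hv hs) hu]
    have hin : HasFDerivAt (fun v : Coord d => (v, s)) (ContinuousLinearMap.inl ℝ (Coord d) ℝ) u :=
      (hasFDerivAt_id u).prodMk (hasFDerivAt_const s u)
    have := (hd.comp u hin).clm_apply (hasFDerivAt_const ((0 : Coord d), (1 : ℝ)) u)
    unfold pd
    rw [show (fun v => fderiv ℝ Ψ (v, s) (0, 1))
      = fun v => (fderiv ℝ Ψ ∘ fun v => (v, s)) v (0, 1) from rfl, this.fderiv]
    simp
  have h3 : fderiv ℝ (fderiv ℝ Ψ) (u, s) (EuclideanSpace.single i 1, 0) (0, 1)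
      = fderiv ℝ (fderiv ℝ Ψ) (u, s) (0, 1) (EuclideanSpace.single i 1, 0) :=
    (h.contDiffAt ((hU.prod hI).mem_nhds ⟨hu, hs⟩)).isSymmSndFDerivAt
      (by rw [minSmoothness_of_isRCLikeNormedField]; exact WithTop.coe_le_coe.2 le_top) _ _
  rw [h2, h3]
  refine h1.congr_of_eventuallyEq (Filter.eventuallyEq_of_mem (hI.mem_nhds hs) fun r hr => ?_)
  exact pd_slice hU hI h hu hr i

/-- Differentiation of the energy under the integral sign. -/
theorem hasDerivAt_energy {S : Set (Coord d)} {g : Coord d → Matrix (Fin d) (Fin d) ℝ}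
    (hS : IsCompact S) (hg : ∀ i j, ContinuousOn (fun v => (g v)⁻¹ i j) S)
    (hvol : ContinuousOn (volDensity g) S) (hU : IsOpen U) (hSU : S ⊆ U) (hI : IsOpen I)
    (h : ContDiffOn ℝ ∞ (fun p : Coord d × ℝ => ψ p.1 p.2) (U ×ˢ I)) (ht : t ∈ I) :
    HasDerivAt (fun s => energy S g (fun v => ψ v s)) (energyRate S g ψ t) t := by
  set Ψ : Coord d × ℝ → EuclideanSpace ℝ (Fin D) := fun p => ψ p.1 p.2 with hΨ
  have hP : ∀ i : Fin d, ContinuousOn (fun p : Coord d × ℝ => pd i (fun v => ψ v p.2) p.1)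
      (U ×ˢ I) := fun i => by
    refine ContinuousOn.congr ?_ fun p hp => pd_slice hU hI h hp.1 hp.2 i
    exact ((h.fderiv_of_isOpen (hU.prod hI) (m := ∞) (by simp)).clm_apply
      contDiffOn_const).continuousOn
  -- Joint continuity of the mixed derivative: it is a component of the second derivative of the
  -- space-time map, by uniqueness of the time derivative of ∂_i ψ.
  have hP' : ∀ i : Fin d, ContinuousOn (fun p : Coord d × ℝ => pd i (velocity ψ p.2) p.1)
      (U ×ˢ I) := fun i => by
    have hsm : ContDiffOn ℝ ∞ (fun p => fderiv ℝ Ψ p ((EuclideanSpace.single i 1 : Coord d),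
        (0 : ℝ))) (U ×ˢ I) :=
      (h.fderiv_of_isOpen (hU.prod hI) (m := ∞) (by simp)).clm_apply contDiffOn_const
    have hsm' := ((hsm.fderiv_of_isOpen (hU.prod hI) (m := ∞) (by simp)).clm_apply
      (contDiffOn_const (c := ((0 : Coord d), (1 : ℝ))))).continuousOn
    refine hsm'.congr fun p hp => ?_
    refine (hasDerivAt_pd hU hI h hp.1 hp.2 i).unique ?_
    refine (hasDerivAt_slice hU hI hsm hp.1 hp.2).congr_of_eventuallyEq
      (Filter.eventuallyEq_of_mem (hI.mem_nhds hp.2) fun r hr => ?_)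
    exact pd_slice hU hI h hp.1 hr i
  set F : ℝ → Coord d → ℝ := fun s u => (∑ i, ∑ j, (g u)⁻¹ i j *
    inner ℝ (pd i (fun v => ψ v s) u) (pd j (fun v => ψ v s) u)) * volDensity g u with hF
  set F' : ℝ → Coord d → ℝ := fun s u => (∑ i, ∑ j, (g u)⁻¹ i j *
      (inner ℝ (pd i (velocity ψ s) u) (pd j (fun v => ψ v s) u)
        + inner ℝ (pd i (fun v => ψ v s) u) (pd j (velocity ψ s) u)))
    * volDensity g u with hF'
  have hfst : Set.MapsTo (Prod.fst : Coord d × ℝ → Coord d) (S ×ˢ I) S := fun p hp => hp.1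
  have hsub : S ×ˢ I ⊆ U ×ˢ I := Set.prod_mono hSU subset_rfl
  have hFc : ContinuousOn (fun p : Coord d × ℝ => F p.2 p.1) (S ×ˢ I) := by
    refine ContinuousOn.mul (continuousOn_finsetSum _ fun i _ => continuousOn_finsetSum _
      fun j _ => ?_) (hvol.comp continuousOn_fst hfst)
    exact ((hg i j).comp continuousOn_fst hfst).mul (((hP i).mono hsub).inner ((hP j).mono hsub))
  have hFc' : ContinuousOn (fun p : Coord d × ℝ => F' p.2 p.1) (S ×ˢ I) := by
    refine ContinuousOn.mul (continuousOn_finsetSum _ fun i _ => continuousOn_finsetSum _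
      fun j _ => ?_) (hvol.comp continuousOn_fst hfst)
    exact ((hg i j).comp continuousOn_fst hfst).mul
      ((((hP' i).mono hsub).inner ((hP j).mono hsub)).add
        (((hP i).mono hsub).inner ((hP' j).mono hsub)))
  have hslice : ∀ {G : ℝ → Coord d → ℝ}, ContinuousOn (fun p : Coord d × ℝ => G p.2 p.1)
      (S ×ˢ I) → ∀ s ∈ I, ContinuousOn (G s) S := fun hG s hs =>
    hG.comp (continuousOn_id.prodMk continuousOn_const) fun v hv => ⟨hv, hs⟩
  have hderiv : ∀ u ∈ S, ∀ s ∈ I, HasDerivAt (F · u) (F' s u) s := by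
    intro u hu s hs
    have hp := fun i => hasDerivAt_pd hU hI h (hSU hu) hs i
    refine HasDerivAt.mul_const (HasDerivAt.fun_sum fun i _ => HasDerivAt.fun_sum fun j _ =>
      HasDerivAt.const_mul _ ?_) _
    have := (hp i).inner ℝ (hp j)
    rwa [add_comm] at this
  -- The product of S with a small closed time interval is compact, so the time derivative of the
  -- integrand is bounded there. The constant bound is integrable on S.
  obtain ⟨ε, hε, hball⟩ := Metric.nhds_basis_closedBall.mem_iff.1 (hI.mem_nhds ht)
  obtain ⟨C, hC⟩ := (hS.prod (isCompact_closedBall t ε)).exists_bound_of_continuousOn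
    (hFc'.mono (Set.prod_mono subset_rfl hball))
  have := (hasDerivAt_integral_of_dominated_loc_of_deriv_le (μ := volume.restrict S) (F := F)
    (F' := F') (x₀ := t) (s := Metric.closedBall t ε) (bound := fun _ => C)
    (Metric.closedBall_mem_nhds t hε)
    (Filter.eventually_of_mem (hI.mem_nhds ht) fun s hs =>
      ((hslice hFc s hs).integrableOn_compact hS).aestronglyMeasurable)
    ((hslice hFc t ht).integrableOn_compact hS)
    ((hslice hFc' t ht).integrableOn_compact hS).aestronglyMeasurable
    ((ae_restrict_iff' hS.measurableSet).2 (Filter.Eventually.of_forall fun u hu s hs =>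
      hC (u, s) ⟨hu, hs⟩))
    (continuous_const.continuousOn.integrableOn_compact hS :
      IntegrableOn (fun _ : Coord d => C) S volume)
    ((ae_restrict_iff' hS.measurableSet).2 (Filter.Eventually.of_forall fun u hu s hs =>
      hderiv u hu s (hball hs)))).2
  have hrate : energyRate S g ψ t = ∫ u in S, F' t u := by
    refine setIntegral_congr_fun hS.measurableSet fun u hu => ?_
    simp only [hF', (hasDerivAt_pd hU hI h (hSU hu) ht _).deriv]
  rw [hrate]
  exact this

end Time

/-! ### The energy rate and the loss of an admissible flow. -/

section FlowIdentities

variable {d D : ℕ} {ψ : Coord d → ℝ → EuclideanSpace ℝ (Fin D)} {t : ℝ}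
  {S U O : Set (Coord d)} {I : Set ℝ}

theorem laplaceBeltrami_add {F : Type*} [NormedAddCommGroup F] [NormedSpace ℝ F]
    {g : Coord d → Matrix (Fin d) (Fin d) ℝ} (hg : IsMetricOn g O) {f f' : Coord d → F}
    (hf : ContDiffOn ℝ ∞ f O) (hf' : ContDiffOn ℝ ∞ f' O) {u : Coord d} (hu : u ∈ O) :
    laplaceBeltrami g (fun v => f v + f' v) u = laplaceBeltrami g f u + laplaceBeltrami g f' u := by
  have hO := hg.isOpen
  have hY : ∀ f : Coord d → F, ContDiffOn ℝ ∞ f O → ∀ i, DifferentiableAt ℝ (fun v =>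
      volDensity g v • ∑ j, (g v)⁻¹ i j • pd j f v) u := fun f hf i =>
    differentiableAt_of_smooth hO (hg.smooth_vol.smul
      (ContDiffOn.sum fun j _ => (hg.smooth_inv i j).smul (contDiffOn_pd hO hf j))) hu
  unfold laplaceBeltrami
  rw [← smul_add, ← Finset.sum_add_distrib]
  congr 1
  refine Finset.sum_congr rfl fun i _ => ?_
  rw [← pd_add (hY f hf i) (hY f' hf' i)]
  refine pd_congr hO (fun v hv => ?_) hu i
  simp only [pd_add (differentiableAt_of_smooth hO hf hv) (differentiableAt_of_smooth hO hf' hv),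
    smul_add, Finset.sum_add_distrib]

/-- Injectivity is assumed on S only. The determinant of the metric is continuous on U and positive
on S, hence positive on an open neighbourhood, which provides the room needed to differentiate. -/
theorem Admissible.exists_isMetricOn (h : Admissible ψ t S U I) :
    ∃ O, IsMetricOn (metricAt ψ t) O ∧ S ⊆ O ∧ O ⊆ U := by
  have hφ := smooth_slice h.smooth h.mem_time
  have hdet := (smoothMatOn_inducedMetric h.isOpen_space hφ).det
  have hO := hdet.continuousOn.isOpen_inter_preimage h.isOpen_space (isOpen_Ioi (a := (0 : ℝ)))
  exact ⟨_, isMetricOn_inducedMetric hO (hφ.mono Set.inter_subset_left) fun u hu => hu.2,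
    fun u hu => ⟨h.subset hu, det_inducedMetric_pos (h.immersion u hu)⟩, Set.inter_subset_left⟩

theorem pairing_add (hS : IsCompact S) (hSO : S ⊆ O) (hg : IsMetricOn (metricAt ψ t) O)
    {X Y Z : Coord d → EuclideanSpace ℝ (Fin D)} (hX : ContDiffOn ℝ ∞ X O)
    (hY : ContDiffOn ℝ ∞ Y O) (hZ : ContDiffOn ℝ ∞ Z O) :
    pairing ψ t S X (fun u => Y u + Z u) = pairing ψ t S X Y + pairing ψ t S X Z := by
  have hint : ∀ Y : Coord d → EuclideanSpace ℝ (Fin D), ContDiffOn ℝ ∞ Y O →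
      IntegrableOn (fun u => inner ℝ (X u) (Y u) * volDensity (metricAt ψ t) u) S := fun Y hY =>
    (((hX.inner ℝ hY).mul hg.smooth_vol).continuousOn.mono hSO).integrableOn_compact hS
  unfold pairing
  rw [← integral_add (hint Y hY) (hint Z hZ)]
  simp only [inner_add_right, add_mul]

/-- Space and time derivatives commute, and since the metric is frozen the two terms of the product
rule are the same symmetric form. -/
theorem Admissible.energyRate_eq_dirichletForm (h : Admissible ψ t S U I)
    (hg : IsMetricOn (metricAt ψ t) O) (hSO : S ⊆ O) (hOU : O ⊆ U) :
    energyRate S (metricAt ψ t) ψ t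
      = 2 * dirichletForm (metricAt ψ t) S (velocity ψ t) (fun v => ψ v t) := by
  have hO := hg.isOpen
  have hφ := (smooth_slice h.smooth h.mem_time).mono hOU
  have hV := (smooth_velocity h.isOpen_space h.isOpen_time h.smooth h.mem_time).mono hOU
  have hint : ∀ X Y : Coord d → EuclideanSpace ℝ (Fin D), ContDiffOn ℝ ∞ X O →
      ContDiffOn ℝ ∞ Y O → IntegrableOn (fun u => (∑ i, ∑ j, (metricAt ψ t u)⁻¹ i j *
        inner ℝ (pd i X u) (pd j Y u)) * volDensity (metricAt ψ t) u) S := by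
    intro X Y hX hY
    refine ContinuousOn.integrableOn_compact h.compact (ContinuousOn.mono
      (ContDiffOn.continuousOn (𝕜 := ℝ) (n := ∞) ?_) hSO)
    exact (ContDiffOn.sum fun i _ => ContDiffOn.sum fun j _ => (hg.smooth_inv i j).mul
      ((contDiffOn_pd hO hX i).inner ℝ (contDiffOn_pd hO hY j))).mul hg.smooth_vol
  have hsum : energyRate S (metricAt ψ t) ψ t
      = dirichletForm (metricAt ψ t) S (velocity ψ t) (fun v => ψ v t)
        + dirichletForm (metricAt ψ t) S (fun v => ψ v t) (velocity ψ t) := by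
    unfold energyRate dirichletForm
    rw [← integral_add (hint _ _ hV hφ) (hint _ _ hφ hV)]
    refine setIntegral_congr_fun h.compact.measurableSet fun u hu => ?_
    simp only [(hasDerivAt_pd h.isOpen_space h.isOpen_time h.smooth (h.subset hu)
      h.mem_time _).deriv, mul_add, add_mul, Finset.sum_add_distrib]
  rw [hsum, dirichletForm_comm hg h.compact hSO (fun v => ψ v t)]
  ring

/-- Green's first identity. The velocity vanishes near the boundary, so the position needs no
boundary condition. -/
theorem Admissible.energyRate_eq_velocity_laplace (h : Admissible ψ t S U I) :
    energyRate S (metricAt ψ t) ψ t = -2 * pairing ψ t S (velocity ψ t)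
      (laplaceBeltrami (metricAt ψ t) (fun v => ψ v t)) := by
  obtain ⟨O, hg, hSO, hOU⟩ := h.exists_isMetricOn
  obtain ⟨K, hK, hKS, h0⟩ := h.support
  rw [h.energyRate_eq_dirichletForm hg hSO hOU, pairing, integral_inner_laplaceBeltrami hg h.compact
    hSO hK (hKS.trans interior_subset)
    ((smooth_velocity h.isOpen_space h.isOpen_time h.smooth h.mem_time).mono hOU)
    ((smooth_slice h.smooth h.mem_time).mono hOU) (Or.inl fun u hu => h0 u ⟨hOU hu.1, hu.2⟩)]
  ring

theorem Admissible.energyRate_eq_laplace_velocity (h : Admissible ψ t S U I) :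
    energyRate S (metricAt ψ t) ψ t = -2 * pairing ψ t S (fun v => ψ v t)
      (laplaceBeltrami (metricAt ψ t) (velocity ψ t)) := by
  obtain ⟨O, hg, hSO, hOU⟩ := h.exists_isMetricOn
  obtain ⟨K, hK, hKS, h0⟩ := h.support
  rw [h.energyRate_eq_dirichletForm hg hSO hOU, dirichletForm_comm hg h.compact hSO, pairing,
    integral_inner_laplaceBeltrami hg h.compact hSO hK (hKS.trans interior_subset)
    ((smooth_slice h.smooth h.mem_time).mono hOU)
    ((smooth_velocity h.isOpen_space h.isOpen_time h.smooth h.mem_time).mono hOU)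
    (Or.inr fun u hu => h0 u ⟨hOU hu.1, hu.2⟩)]
  ring

/-- The tangential part of the Laplacian of the tangential velocity. -/
theorem Admissible.tangentProj_laplaceBeltrami (h : Admissible ψ t S U I)
    (hg : IsMetricOn (metricAt ψ t) O) (hOU : O ⊆ U) {u : Coord d} (hu : u ∈ O) :
    tangentProj (fun v => ψ v t) u (laplaceBeltrami (metricAt ψ t) (tangentVel ψ t) u)
      = hodgeTerm ψ t u + ricciTerm ψ t u + weingartenTerm ψ t u := by
  have hφ := (smooth_slice h.smooth h.mem_time).mono hOU
  have hV := (smooth_velocity h.isOpen_space h.isOpen_time h.smooth h.mem_time).mono hOU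
  exact tangentProj_laplaceBeltrami_tangent (W := tangentVelCoeff ψ t) hg.isOpen hφ hg
    (fun a => smooth_tangentCoeff hg.isOpen hφ hg hV a) hu

/-- The rate of change of the energy as a sum of five pairings. -/
theorem Admissible.energyRate_eq_sum (h : Admissible ψ t S U I) :
    energyRate S (metricAt ψ t) ψ t = -2 * (pairing ψ t S (fun v => ψ v t) (hodgeTerm ψ t)
      + pairing ψ t S (fun v => ψ v t) (ricciTerm ψ t)
      + pairing ψ t S (fun v => ψ v t) (weingartenTerm ψ t)
      + pairing ψ t S (fun v => ψ v t) (normalVelTerm ψ t)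
      + pairing ψ t S (fun v => ψ v t) (otherTerm ψ t)) := by
  rw [h.energyRate_eq_laplace_velocity]
  obtain ⟨O, hg, hSO, hOU⟩ := h.exists_isMetricOn
  have hO := hg.isOpen
  have hφ := (smooth_slice h.smooth h.mem_time).mono hOU
  have hV := (smooth_velocity h.isOpen_space h.isOpen_time h.smooth h.mem_time).mono hOU
  have hW : ∀ a, ContDiffOn ℝ ∞ (tangentVelCoeff ψ t a) O := fun a =>
    smooth_tangentCoeff hO hφ hg hV a
  have hT : ContDiffOn ℝ ∞ (tangentVel ψ t) O := smooth_tangentProj hO hφ hg hV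
  have hN : ContDiffOn ℝ ∞ (normalVel ψ t) O := smooth_normalProj hO hφ hg hV
  have h1 : ContDiffOn ℝ ∞ (hodgeTerm ψ t) O := (ContDiffOn.sum fun a _ =>
    (smooth_hodgeLaplacian hg hW a).smul (contDiffOn_pd hO hφ a)).neg
  have h2 : ContDiffOn ℝ ∞ (ricciTerm ψ t) O := ContDiffOn.sum fun a _ =>
    (ContDiffOn.sum fun b _ => (smooth_ricciMixed hg a b).mul (hW b)).smul (contDiffOn_pd hO hφ a)
  have h3 : ContDiffOn ℝ ∞ (weingartenTerm ψ t) O := (ContDiffOn.sum fun m _ =>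
    ContDiffOn.sum fun n _ => ContDiffOn.sum fun a _ => ((hg.smooth_inv m n).mul (hW a)).smul
      (ContDiffOn.sum fun b _ => (ContDiffOn.sum fun c _ => (hg.smooth_inv b c).mul
        ((smooth_secondFF hO hφ hg m c).inner ℝ (smooth_secondFF hO hφ hg n a))).smul
          (contDiffOn_pd hO hφ b))).neg
  have h4 : ContDiffOn ℝ ∞ (normalVelTerm ψ t) O :=
    smooth_tangentProj hO hφ hg (smooth_laplaceBeltrami hg hN)
  have h5 : ContDiffOn ℝ ∞ (otherTerm ψ t) O :=
    smooth_normalProj hO hφ hg (smooth_laplaceBeltrami hg hV)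
  rw [← pairing_add h.compact hSO hg hφ h1 h2, ← pairing_add h.compact hSO hg hφ (h1.add h2) h3,
    ← pairing_add h.compact hSO hg hφ ((h1.add h2).add h3) h4,
    ← pairing_add h.compact hSO hg hφ (((h1.add h2).add h3).add h4) h5]
  congr 1
  refine setIntegral_congr_fun h.compact.measurableSet fun u hu => ?_
  have hu := hSO hu
  have hsplit : laplaceBeltrami (metricAt ψ t) (velocity ψ t) u
      = laplaceBeltrami (metricAt ψ t) (tangentVel ψ t) u
        + laplaceBeltrami (metricAt ψ t) (normalVel ψ t) u := by
    rw [← laplaceBeltrami_add hg hT hN hu]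
    congr 1
    funext v
    exact (tangentProj_add_normalProj (φ := fun v => ψ v t) (velocity ψ t v)).symm
  -- The first four terms add up to the tangential projection of Δ_g of the whole velocity, and the
  -- fifth is its normal projection.
  have hsum : hodgeTerm ψ t u + ricciTerm ψ t u + weingartenTerm ψ t u + normalVelTerm ψ t u
      + otherTerm ψ t u = laplaceBeltrami (metricAt ψ t) (velocity ψ t) u := by
    rw [← h.tangentProj_laplaceBeltrami hg hOU hu, normalVelTerm, ← tangentProj_add, ← hsplit]
    exact tangentProj_add_normalProj _
  simp only [hsum]

theorem Admissible.harmonicLoss_eq (h : Admissible ψ t S U I) (c : ℝ) :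
    harmonicLoss S (metricAt ψ t) c ψ t
      = |c - 2 * abs (pairing ψ t S (fun v => ψ v t) (hodgeTerm ψ t)
          + pairing ψ t S (fun v => ψ v t) (ricciTerm ψ t)
          + pairing ψ t S (fun v => ψ v t) (weingartenTerm ψ t)
          + pairing ψ t S (fun v => ψ v t) (normalVelTerm ψ t)
          + pairing ψ t S (fun v => ψ v t) (otherTerm ψ t))| := by
  rw [harmonicLoss, h.energyRate_eq_sum, abs_mul]
  norm_num

theorem Admissible.hasDerivAt_energy (h : Admissible ψ t S U I) :
    HasDerivAt (fun s => energy S (metricAt ψ t) (fun v => ψ v s))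
      (energyRate S (metricAt ψ t) ψ t) t := by
  obtain ⟨O, hg, hSO, hOU⟩ := h.exists_isMetricOn
  exact HarmonicFlow.hasDerivAt_energy h.compact
    (fun i j => (hg.smooth_inv i j).continuousOn.mono hSO) (hg.smooth_vol.continuousOn.mono hSO)
    h.isOpen_space h.subset h.isOpen_time h.smooth h.mem_time

end FlowIdentities

/-! ### The Hodge Laplacian paired with gradients. -/

section HodgeAdjoint

variable {d : ℕ} {g : Coord d → Matrix (Fin d) (Fin d) ℝ} {S O K : Set (Coord d)}
  {W : Fin d → Coord d → ℝ}

theorem integrableOn_of_smooth {f : Coord d → ℝ} (hS : IsCompact S) (hSO : S ⊆ O)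
    (hf : ContDiffOn ℝ ∞ f O) : IntegrableOn f S :=
  (hf.continuousOn.mono hSO).integrableOn_compact hS

theorem sum_pd_vol_mul (hg : IsMetricOn g O) (hW : ∀ a, ContDiffOn ℝ ∞ (W a) O) {u : Coord d}
    (hu : u ∈ O) : ∑ i, pd i (fun v => volDensity g v * W i v) u
      = volDensity g u * (covDeriv g W u).trace := by
  have hv := (hg.vol_pos hu).ne'
  have h := codiffOne_flat hg hW hu
  rw [codiffOne, neg_inj, Finset.sum_congr rfl fun i _ => pd_congr hg.isOpen
    (f' := fun v => volDensity g v * W i v)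
    (fun v hv => by simp only [sum_inv_mul_flat hg hv]) hu i] at h
  rw [← h, mul_inv_cancel_left₀ hv]

/-- On gradients, the formal adjoint of the Hodge Laplacian is minus the gradient of the
Laplacian. -/
theorem integral_hodgeLaplacian_mul_pd (hg : IsMetricOn g O) (hS : IsCompact S) (hSO : S ⊆ O)
    (hK : IsCompact K) (hKS : K ⊆ S) (hW : ∀ a, ContDiffOn ℝ ∞ (W a) O)
    (hW0 : ∀ a, ∀ u ∈ O \ K, W a u = 0) {f : Coord d → ℝ} (hf : ContDiffOn ℝ ∞ f O) :
    ∫ u in S, (∑ a, hodgeLaplacian g W a u * pd a f u) * volDensity g u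
      = -∫ u in S, (∑ i, W i u * pd i (laplaceBeltrami g f) u) * volDensity g u := by
  have hO := hg.isOpen
  have hM := smoothMatOn_covDeriv hg hW
  have hQ := smoothMatOn_covDerivUp hg hW
  have hL := smooth_laplaceBeltrami hg hf
  have hvol := hg.smooth_vol
  set α : Coord d → ℝ := fun v => (covDeriv g W v).trace with hα
  have hαs : ContDiffOn ℝ ∞ α O := ContDiffOn.sum fun i _ => hM i i
  have hM0 : ∀ u ∈ O \ K, covDeriv g W u = 0 := fun u hu => by
    ext a j
    simp [covDeriv, pd_eq_zero_of_eq_zero hO hK (hW0 a) j u hu, fun b => hW0 b u hu]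
  have hα0 : ∀ u ∈ O \ K, α u = 0 := fun u hu => by simp [hα, hM0 u hu]
  -- The δd part of Δ_H W, contracted with the gradient of f, is up to sign and density the
  -- divergence of this field, which is supported in K. Hence it integrates to zero.
  set X : Fin d → Coord d → ℝ := fun i v => ∑ a, pd a f v *
    (volDensity g v * (covDerivUp g W v a i - covDerivUp g W v i a)) with hX
  have hBs : ∀ a i, ContDiffOn ℝ ∞ (fun v => volDensity g v *
      (covDerivUp g W v a i - covDerivUp g W v i a)) O :=
    fun a i => hvol.mul ((hQ a i).sub (hQ i a))
  have hXs : ∀ i, ContDiffOn ℝ ∞ (X i) O := fun i => ContDiffOn.sum fun a _ =>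
    (contDiffOn_pd hO hf a).mul (hBs a i)
  have hX0 := setIntegral_div_eq_zero hS hO hSO hK hKS hXs
    (fun i u hu => by simp [hX, covDerivUp, hM0 u hu])
  have hdivX : ∀ u ∈ O, ∑ i, pd i (X i) u = ∑ a, pd a f u * ∑ i, pd i (fun v =>
      volDensity g v * (covDerivUp g W v a i - covDerivUp g W v i a)) u := by
    intro u hu
    have hpd : ∀ i, pd i (X i) u = ∑ a, (pd i (pd a f) u *
        (volDensity g u * (covDerivUp g W u a i - covDerivUp g W u i a)) + pd a f u *
        pd i (fun v => volDensity g v * (covDerivUp g W v a i - covDerivUp g W v i a)) u) := by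
      intro i
      have d1 := fun a => differentiableAt_of_smooth hO (contDiffOn_pd hO hf a) hu
      have d2 := fun a => differentiableAt_of_smooth hO (hBs a i) hu
      rw [hX, pd_sum (f := fun a v => pd a f v *
        (volDensity g v * (covDerivUp g W v a i - covDerivUp g W v i a)))
        fun a _ => (d1 a).fun_mul (d2 a)]
      exact Finset.sum_congr rfl fun a _ => pd_mul (d1 a) (d2 a) i
    -- The Hessian ∂_i∂_a f is symmetric and the contracted tensor antisymmetric.
    have hanti : ∑ i, ∑ a, pd i (pd a f) u *
        (volDensity g u * (covDerivUp g W u a i - covDerivUp g W u i a)) = 0 := by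
      have : ∑ i, ∑ a, pd i (pd a f) u *
          (volDensity g u * (covDerivUp g W u a i - covDerivUp g W u i a))
          = -∑ i, ∑ a, pd i (pd a f) u *
          (volDensity g u * (covDerivUp g W u a i - covDerivUp g W u i a)) := by
        conv_lhs => rw [Finset.sum_comm]
        rw [← Finset.sum_neg_distrib]
        refine Finset.sum_congr rfl fun i _ => ?_
        rw [← Finset.sum_neg_distrib]
        refine Finset.sum_congr rfl fun a _ => ?_
        rw [pd_comm hO hf hu a i]
        ring
      linarith
    simp only [hpd, Finset.sum_add_distrib, hanti, zero_add, Finset.mul_sum]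
    rw [Finset.sum_comm]
  have h1 : ∫ u in S, (∑ a, hodgeLaplacian g W a u * pd a f u) * volDensity g u
      = -dirichletForm g S f α := by
    have hpt : ∀ u ∈ S, (∑ a, hodgeLaplacian g W a u * pd a f u) * volDensity g u
        = -((∑ i, ∑ j, (g u)⁻¹ i j * inner ℝ (pd i f u) (pd j α u)) * volDensity g u)
          - ∑ i, pd i (X i) u := by
      intro u huS
      have hu := hSO huS
      have hv := (hg.vol_pos hu).ne'
      rw [hdivX u hu]
      simp only [hodgeLaplacian_eq hg hW hu, sub_mul, neg_mul, Finset.sum_sub_distrib,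
        Finset.sum_neg_distrib, Finset.sum_mul, ← hα, RCLike.inner_apply, conj_trivial]
      congr 1
      · congr 1
        exact Finset.sum_congr rfl fun i _ => Finset.sum_congr rfl fun j _ => by ring
      · refine Finset.sum_congr rfl fun a _ => ?_
        field_simp
    rw [setIntegral_congr_fun hS.measurableSet hpt, integral_sub, hX0, sub_zero, integral_neg]
    · rfl
    · refine (integrableOn_of_smooth hS hSO ?_).neg
      exact (ContDiffOn.sum fun i _ => ContDiffOn.sum fun j _ => (hg.smooth_inv i j).mul
        ((contDiffOn_pd hO hf i).inner ℝ (contDiffOn_pd hO hαs j))).mul hvol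
    · exact integrableOn_of_smooth hS hSO (ContDiffOn.sum fun i _ => contDiffOn_pd hO (hXs i) i)
  -- The dδ part has left the Dirichlet form of f and div W. One integration by parts puts the
  -- Laplacian on f, and a second one moves the divergence off W.
  have h2 := integral_inner_laplaceBeltrami hg hS hSO hK hKS hαs hf (Or.inl hα0)
  have h3 := setIntegral_div_eq_zero (X := fun i v => laplaceBeltrami g f v *
      (volDensity g v * W i v)) hS hO hSO hK hKS (fun i => hL.mul (hvol.mul (hW i)))
    (fun i u hu => by simp [hW0 i u hu])
  have h4 : ∀ u ∈ S, ∑ i, pd i (fun v => laplaceBeltrami g f v * (volDensity g v * W i v)) u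
      = (∑ i, W i u * pd i (laplaceBeltrami g f) u) * volDensity g u
        + inner ℝ (α u) (laplaceBeltrami g f u) * volDensity g u := by
    intro u huS
    have hu := hSO huS
    simp only [fun i => pd_mul (differentiableAt_of_smooth hO hL hu)
      (differentiableAt_of_smooth hO (hvol.mul (hW i)) hu) i, Finset.sum_add_distrib,
      ← Finset.mul_sum, sum_pd_vol_mul hg hW hu, Finset.sum_mul, RCLike.inner_apply, conj_trivial]
    congr 1
    · exact Finset.sum_congr rfl fun i _ => by ring
    · ring
  rw [setIntegral_congr_fun hS.measurableSet h4, integral_add, h2] at h3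
  · rw [h1, dirichletForm_comm hg hS hSO]
    linarith
  · exact integrableOn_of_smooth hS hSO ((ContDiffOn.sum fun i _ =>
      (hW i).mul (contDiffOn_pd hO hL i)).mul hvol)
  · exact integrableOn_of_smooth hS hSO ((hαs.inner ℝ hL).mul hvol)

end HodgeAdjoint

/-! ### Test functions with prescribed moments. -/

section TestFunctions

variable {d : ℕ}

/-- Smooth functions with compact support in an open set. -/
def testFunctions (B : Set (Coord d)) : Submodule ℝ (Coord d → ℝ) where
  carrier := {w | ContDiff ℝ ∞ w ∧ HasCompactSupport w ∧ tsupport w ⊆ B}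
  add_mem' := fun {v w} hv hw => ⟨hv.1.add hw.1, hv.2.1.add hw.2.1,
    (tsupport_add v w).trans (Set.union_subset hv.2.2 hw.2.2)⟩
  zero_mem' := ⟨contDiff_const, HasCompactSupport.zero, by simp [tsupport]⟩
  smul_mem' := fun c w hw => ⟨contDiff_const.smul hw.1, hw.2.1.smul_left (f := fun _ => c),
    (closure_mono (Function.support_const_smul_subset c w)).trans hw.2.2⟩

/-- Moments of a test function against linearly independent continuous functions can be
prescribed. -/
theorem exists_testFunction_integral_eq {B : Set (Coord d)} (hB : IsOpen B) {n : ℕ}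
    (F : Fin n → Coord d → ℝ) (hF : ∀ i, Continuous (F i))
    (hind : ∀ k : Fin n → ℝ, (∀ u ∈ B, ∑ i, k i * F i u = 0) → k = 0) (y : Fin n → ℝ) :
    ∃ w ∈ testFunctions B, ∀ i, ∫ u, w u * F i u = y i := by
  have hint : ∀ w ∈ testFunctions B, ∀ i, Integrable fun u => w u * F i u := fun w hw i =>
    (hw.1.continuous.mul (hF i)).integrable_of_hasCompactSupport hw.2.1.mul_right
  let Λ : testFunctions B →ₗ[ℝ] Fin n → ℝ :=
    { toFun := fun w i => ∫ u, (w : Coord d → ℝ) u * F i u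
      map_add' := fun v w => by
        ext i
        simp only [Submodule.coe_add, Pi.add_apply, add_mul]
        exact integral_add (hint v v.2 i) (hint w w.2 i)
      map_smul' := fun c w => by
        ext i
        simp only [Submodule.coe_smul, Pi.smul_apply, smul_eq_mul, mul_assoc, RingHom.id_apply]
        exact integral_const_mul c _ }
  have htop : LinearMap.range Λ = ⊤ := by
    -- If the moment map is not onto, a nonzero functional annihilates its range. Its coefficients
    -- combine the F_i into a continuous function orthogonal to every test function, hence zero
    -- almost everywhere and then everywhere on B, against independence.
    by_contra hne
    obtain ⟨f, hf0, hf⟩ := Submodule.exists_le_ker_of_lt_top _ (lt_top_iff_ne_top.2 hne)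
    have hfsum : ∀ z : Fin n → ℝ, f z = ∑ i, f (Pi.single i 1) * z i := by
      intro z
      conv_lhs => rw [pi_eq_sum_univ' z]
      rw [map_sum]
      refine Finset.sum_congr rfl fun i _ => ?_
      rw [map_smul, smul_eq_mul, mul_comm]
    have hk := hind (fun i => f (Pi.single i 1)) ?_
    · refine hf0 (LinearMap.ext fun z => ?_)
      rw [hfsum]
      simp [fun i => congrFun hk i]
    have hcont : Continuous fun u => ∑ i, f (Pi.single i 1) * F i u :=
      continuous_finsetSum _ fun i _ => continuous_const.mul (hF i)
    have hae := hB.ae_eq_zero_of_integral_contDiff_smul_eq_zero (μ := volume)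
      (f := fun u => ∑ i, f (Pi.single i 1) * F i u)
      (hcont.locallyIntegrable.locallyIntegrableOn B) (by
        intro w h1 h2 h3
        have hw : w ∈ testFunctions B := ⟨h1, h2, h3⟩
        have h4 : f (Λ ⟨w, hw⟩) = 0 := hf ⟨⟨w, hw⟩, rfl⟩
        rw [hfsum] at h4
        simp only [smul_eq_mul, Finset.mul_sum]
        rw [integral_finsetSum _ fun i _ => ?_]
        · rw [← h4]
          refine Finset.sum_congr rfl fun i _ => ?_
          rw [show Λ ⟨w, hw⟩ i = ∫ u, w u * F i u from rfl, ← integral_const_mul]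
          simp only [mul_left_comm]
        · simp only [mul_left_comm (w _)]
          exact (hint w hw i).const_mul _)
    have := Measure.eqOn_open_of_ae_eq (μ := (volume : Measure (Coord d))) (g := fun _ => (0 : ℝ))
      ((ae_restrict_iff' hB.measurableSet).2 hae) hB hcont.continuousOn continuousOn_const
    exact fun u hu => this hu
  obtain ⟨w, hw⟩ := LinearMap.range_eq_top.1 htop y
  exact ⟨w, w.2, fun i => congrFun hw i⟩

end TestFunctions

/-! ### Flows with constant velocity. -/

section AffineFlow

variable {d D : ℕ}

/-- The flow moving every point with constant velocity. -/
def affineFlow (Φ v : Coord d → EuclideanSpace ℝ (Fin D)) (u : Coord d) (s : ℝ) :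
    EuclideanSpace ℝ (Fin D) :=
  Φ u + s • v u

variable {Φ v : Coord d → EuclideanSpace ℝ (Fin D)}

theorem affineFlow_zero : (fun u => affineFlow Φ v u 0) = Φ := by
  funext u
  simp [affineFlow]

@[simp]
theorem metricAt_affineFlow : metricAt (affineFlow Φ v) 0 = inducedMetric Φ := by
  rw [metricAt, affineFlow_zero]

@[simp]
theorem velocity_affineFlow : velocity (affineFlow Φ v) 0 = v := by
  funext u
  have : HasDerivAt (fun s : ℝ => Φ u + s • v u) ((1 : ℝ) • v u) 0 :=
    ((hasDerivAt_id (0 : ℝ)).smul_const (v u)).const_add (Φ u)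
  exact this.deriv.trans (one_smul ℝ _)

/-- Lets an explicitly computed metric certify the immersion condition: vectors with nonsingular
Gram matrix are independent. -/
theorem injective_fderiv_of_det_ne_zero {u : Coord d} (h : (inducedMetric Φ u).det ≠ 0) :
    Function.Injective (fderiv ℝ Φ u) := by
  have hli : LinearIndependent ℝ fun i => pd i Φ u :=
    Matrix.linearIndependent_of_det_gram_ne_zero (𝕜 := ℝ) h
  refine (injective_iff_map_eq_zero _).2 fun x hx => ?_
  have hsum : x = ∑ i, x i • EuclideanSpace.single i (1 : ℝ) := by
    ext j
    simp [Pi.single_apply]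
  rw [hsum, map_sum] at hx
  simp only [map_smul] at hx
  have := Fintype.linearIndependent_iff.1 hli (fun i => x i) hx
  ext j
  exact this j

theorem admissible_affineFlow {S K : Set (Coord d)} (hS : IsCompact S) (hΦ : ContDiff ℝ ∞ Φ)
    (hv : ContDiff ℝ ∞ v) (hg : IsMetricOn (inducedMetric Φ) Set.univ) (hK : IsCompact K)
    (hKS : K ⊆ interior S) (h0 : ∀ u ∉ K, v u = 0) :
    Admissible (affineFlow Φ v) 0 S Set.univ Set.univ where
  compact := hS
  isOpen_space := isOpen_univ
  subset := Set.subset_univ S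
  isOpen_time := isOpen_univ
  mem_time := Set.mem_univ 0
  smooth := ContDiff.contDiffOn (by unfold affineFlow; fun_prop)
  immersion := fun u _ => by
    rw [affineFlow_zero]
    exact injective_fderiv_of_det_ne_zero (hg.det_ne_zero u (Set.mem_univ u))
  support := ⟨K, hK, hKS, fun u hu => by rw [velocity_affineFlow]; exact h0 u hu.2⟩

end AffineFlow

/-! ### Self-adjointness of the projections. -/

section Projection

variable {d D : ℕ} {φ : Coord d → EuclideanSpace ℝ (Fin D)} {O : Set (Coord d)} {u : Coord d}

/-- Both sides equal the inner product of the two projections. In a pairing with the position, this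
transfers the projection from a Laplacian to the position, where it is explicit. -/
theorem inner_tangentProj_comm (hg : IsMetricOn (inducedMetric φ) O) (hu : u ∈ O)
    (x y : EuclideanSpace ℝ (Fin D)) :
    inner ℝ x (tangentProj φ u y) = inner ℝ (tangentProj φ u x) y := by
  have h : ∀ x y, inner ℝ x (tangentProj φ u y)
      = inner ℝ (tangentProj φ u x) (tangentProj φ u y) := by
    intro x y
    conv_lhs => rw [tangentProj]
    conv_rhs => rw [tangentProj.eq_def φ u y]
    simp only [inner_sum, inner_smul_right, inner_tangentProj hg hu]
  rw [h x y, real_inner_comm, ← h y x, real_inner_comm]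

theorem inner_normalProj_comm (hg : IsMetricOn (inducedMetric φ) O) (hu : u ∈ O)
    (x y : EuclideanSpace ℝ (Fin D)) :
    inner ℝ x (normalProj φ u y) = inner ℝ (normalProj φ u x) y := by
  simp only [normalProj, inner_sub_right, inner_sub_left, inner_tangentProj_comm hg hu]

end Projection

/-! ### Derivatives of functions of a single coordinate. -/

section Coordinates

variable {d : ℕ} {u : Coord d}

theorem pd_comp_coord {F : Type*} [NormedAddCommGroup F] [NormedSpace ℝ F] {r : ℝ → F} {r' : F}
    {j : Fin d} (h : HasDerivAt r r' (u j)) (i : Fin d) :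
    pd i (fun v : Coord d => r (v j)) u = if i = j then r' else 0 := by
  have h1 : HasFDerivAt (fun v : Coord d => v j)
      (EuclideanSpace.proj j : Coord d →L[ℝ] ℝ) u :=
    (EuclideanSpace.proj j : Coord d →L[ℝ] ℝ).hasFDerivAt
  have h2 := (h.hasFDerivAt.comp u h1).fderiv
  unfold pd
  rw [show (fun v : Coord d => r (v j)) = r ∘ fun v : Coord d => v j from rfl, h2]
  simp [eq_comm]

theorem pd_coord (i j : Fin d) : pd i (fun v : Coord d => v j) u = if i = j then 1 else 0 :=
  pd_comp_coord (hasDerivAt_id (u j)) i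

theorem pd_cos_coord (i j : Fin d) :
    pd i (fun v : Coord d => Real.cos (v j)) u = if i = j then -Real.sin (u j) else 0 :=
  pd_comp_coord (Real.hasDerivAt_cos (u j)) i

theorem pd_sin_coord (i j : Fin d) :
    pd i (fun v : Coord d => Real.sin (v j)) u = if i = j then Real.cos (u j) else 0 :=
  pd_comp_coord (Real.hasDerivAt_sin (u j)) i

end Coordinates

/-! ### The flat comparison flow. -/

section FlatFlow

variable {d D : ℕ} {f : Fin d → EuclideanSpace ℝ (Fin D)}

/-- The linear map sending the standard basis to the vectors `f i`. -/
def linearEmbedding (f : Fin d → EuclideanSpace ℝ (Fin D)) (u : Coord d) :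
    EuclideanSpace ℝ (Fin D) :=
  ∑ k, u k • f k

theorem contDiff_linearEmbedding : ContDiff ℝ ∞ (linearEmbedding f) := by
  unfold linearEmbedding
  fun_prop

theorem pd_linearEmbedding (i : Fin d) (u : Coord d) : pd i (linearEmbedding f) u = f i := by
  unfold linearEmbedding
  rw [pd_sum (f := fun k (v : Coord d) => v k • f k) fun k _ => by fun_prop]
  rw [Finset.sum_congr rfl fun k _ => pd_smul (f := fun _ => f k) (by fun_prop) (by fun_prop) i]
  simp [pd_coord]

theorem inducedMetric_linearEmbedding
    (hf : ∀ j k, inner ℝ (f j) (f k) = if j = k then (1 : ℝ) else 0)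
    (u : Coord d) : inducedMetric (linearEmbedding f) u = 1 := by
  ext i j
  rw [inducedMetric_apply, pd_linearEmbedding, pd_linearEmbedding, hf, Matrix.one_apply]

theorem isMetricOn_linearEmbedding
    (hf : ∀ j k, inner ℝ (f j) (f k) = if j = k then (1 : ℝ) else 0) :
    IsMetricOn (inducedMetric (linearEmbedding f)) Set.univ :=
  isMetricOn_inducedMetric isOpen_univ contDiff_linearEmbedding.contDiffOn fun u _ => by
    simp [inducedMetric_linearEmbedding hf]

theorem ricci_eq_zero_of_const (A : Matrix (Fin d) (Fin d) ℝ) (j k : Fin d) (u : Coord d) :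
    ricci (fun _ => A) j k u = 0 := by
  have h : ∀ k i j, christoffel (fun _ : Coord d => A) k i j = fun _ => 0 := by
    intro k i j
    funext v
    simp [christoffel]
  simp [ricci, riemann, h]

/-- A tangential deformation of a linear isometric embedding: everything but the tangential
velocity is trivial. -/
theorem flat_flow_properties (hf : ∀ j k, inner ℝ (f j) (f k) = if j = k then (1 : ℝ) else 0)
    {S K : Set (Coord d)} (hS : IsCompact S) (hK : IsCompact K) (hKS : K ⊆ interior S)
    {w : Coord d → ℝ} (hw : ContDiff ℝ ∞ w) (h0 : ∀ u ∉ K, w u = 0) (i₀ : Fin d)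
    {ψ : Coord d → ℝ → EuclideanSpace ℝ (Fin D)}
    (hψ : ψ = affineFlow (linearEmbedding f) fun u => w u • f i₀) :
    Admissible ψ 0 S Set.univ Set.univ ∧
      (∀ u, ∀ j k, ricci (metricAt ψ 0) j k u = 0) ∧
      (∀ u a, tangentVelCoeff ψ 0 a u = if a = i₀ then w u else 0) ∧
      pairing ψ 0 S (fun v => ψ v 0) (hodgeTerm ψ 0) = 0 ∧
      pairing ψ 0 S (fun v => ψ v 0) (weingartenTerm ψ 0) = 0 ∧
      pairing ψ 0 S (fun v => ψ v 0) (normalVelTerm ψ 0) = 0 ∧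
      pairing ψ 0 S (fun v => ψ v 0) (otherTerm ψ 0) = 0 ∧
      energyRate S (metricAt ψ 0) ψ 0 = 0 := by
  subst hψ
  set Φ := linearEmbedding f with hΦ
  set v : Coord d → EuclideanSpace ℝ (Fin D) := fun u => w u • f i₀ with hv
  set ψ := affineFlow Φ v with hψ
  have hΦs : ContDiff ℝ ∞ Φ := contDiff_linearEmbedding
  have hg : IsMetricOn (inducedMetric Φ) Set.univ := isMetricOn_linearEmbedding hf
  have hg1 : inducedMetric Φ = fun _ => 1 := funext (inducedMetric_linearEmbedding hf)
  have hadm : Admissible ψ 0 S Set.univ Set.univ := admissible_affineFlow hS hΦs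
    (hw.smul contDiff_const) hg hK hKS fun u hu => by simp [hv, h0 u hu]
  have hvsum : ∀ u, v u = ∑ b, (if b = i₀ then w u else 0) • pd b Φ u := by
    intro u
    simp [hv, hΦ, pd_linearEmbedding]
  have hΦsum : ∀ u, Φ u = ∑ b, u b • pd b Φ u := by
    intro u
    simp only [hΦ, pd_linearEmbedding]
    rfl
  have hricci : ∀ u, ∀ j k, ricci (metricAt ψ 0) j k u = 0 := fun u j k => by
    rw [metricAt_affineFlow, hg1, ricci_eq_zero_of_const]
  have hII : ∀ i j u, secondFF Φ i j u = 0 := by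
    intro i j u
    have : pd j Φ = fun _ => f j := funext fun u => pd_linearEmbedding j u
    simp [secondFF, this, normalProj, tangentProj_zero]
  have hR : ricciTerm ψ 0 = 0 := by
    funext u
    simp [ricciTerm, ricciMixed, hricci]
  have hA : weingartenTerm ψ 0 = 0 := by
    funext u
    simp [weingartenTerm, weingarten, hψ, affineFlow_zero, hII]
  have hN : normalVel ψ 0 = fun _ => 0 := by
    funext u
    rw [normalVel, velocity_affineFlow, affineFlow_zero, normalProj, hvsum u,
      tangentProj_sum_smul hg (Set.mem_univ u), sub_self]
  have hV : normalVelTerm ψ 0 = 0 := by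
    funext u
    simp [normalVelTerm, hN, laplaceBeltrami, tangentProj_zero]
  -- The position of a linear embedding is a combination of the coordinate fields, so it has no
  -- normal part for the normal term to meet.
  have hO : pairing ψ 0 S (fun v => ψ v 0) (otherTerm ψ 0) = 0 := by
    have hz : ∀ u, inner ℝ (Φ u) (otherTerm ψ 0 u) = 0 := by
      intro u
      rw [otherTerm, affineFlow_zero, inner_normalProj_comm hg (Set.mem_univ u), normalProj,
        hΦsum u, tangentProj_sum_smul hg (Set.mem_univ u), sub_self, inner_zero_left]
    rw [hψ, affineFlow_zero, ← hψ]
    simp [pairing, hz]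
  have hL : laplaceBeltrami (inducedMetric Φ) Φ = fun _ => 0 := by
    have hpd : ∀ j, pd j Φ = fun _ => f j := fun j => funext fun u => pd_linearEmbedding j u
    funext u
    simp [laplaceBeltrami, hg1, volDensity, hpd]
  have hE : energyRate S (metricAt ψ 0) ψ 0 = 0 := by
    rw [hadm.energyRate_eq_velocity_laplace, hψ, metricAt_affineFlow, affineFlow_zero, hL]
    simp [pairing]
  have hpz : pairing ψ 0 S (fun v => ψ v 0) 0 = 0 := by simp [pairing]
  -- The Hodge pairing is not computed: the rate and the other four pairings vanish, and the
  -- decomposition of the rate forces it to be zero.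
  have hH := hadm.energyRate_eq_sum
  rw [hE, hR, hA, hV, hO, hpz] at hH
  refine ⟨hadm, hricci, fun u a => ?_, by linarith, by rw [hA, hpz], by rw [hV, hpz], hO, hE⟩
  rw [tangentVelCoeff, affineFlow_zero, velocity_affineFlow, hvsum u,
    tangentCoeff_sum_smul hg (Set.mem_univ u)]

end FlatFlow

/-! ### The torus of revolution times a Euclidean space, and its moving frame. -/

section Torus

/-- Orthonormal vectors in `ℝᴰ` used to write down the product of a torus of revolution with a
Euclidean space: the torus lies in the span of `a`, `b`, `e`, and its two angles are the
coordinates `i₀` and `i₁`. -/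
structure TorusFrame (d D : ℕ) where
  i₀ : Fin d
  i₁ : Fin d
  ne : i₀ ≠ i₁
  a : EuclideanSpace ℝ (Fin D)
  b : EuclideanSpace ℝ (Fin D)
  e : EuclideanSpace ℝ (Fin D)
  f : Fin d → EuclideanSpace ℝ (Fin D)
  aa : inner ℝ a a = (1 : ℝ)
  bb : inner ℝ b b = (1 : ℝ)
  ee : inner ℝ e e = (1 : ℝ)
  ab : inner ℝ a b = (0 : ℝ)
  ae : inner ℝ a e = (0 : ℝ)
  be : inner ℝ b e = (0 : ℝ)
  f_zero : f i₀ = 0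
  f_one : f i₁ = 0
  fa : ∀ k, inner ℝ (f k) a = (0 : ℝ)
  fb : ∀ k, inner ℝ (f k) b = (0 : ℝ)
  fe : ∀ k, inner ℝ (f k) e = (0 : ℝ)
  ff : ∀ j k, j ≠ i₀ → j ≠ i₁ → inner ℝ (f j) (f k) = if j = k then (1 : ℝ) else 0

theorem exists_torusFrame {d D : ℕ} (hd : 2 ≤ d) (hD : d < D) : Nonempty (TorusFrame d D) := by
  let ε : ℕ → EuclideanSpace ℝ (Fin D) := fun n =>
    if h : n < D then EuclideanSpace.single ⟨n, h⟩ 1 else 0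
  have hε : ∀ m n, m < D → n < D → inner ℝ (ε m) (ε n) = if m = n then (1 : ℝ) else 0 := by
    intro m n hm hn
    simp [ε, hm, hn, EuclideanSpace.inner_single_left]
  -- The torus uses the basis vectors 0, 1, 2 for two coordinates, so each remaining index k ≥ 2 is
  -- shifted to k + 1. It fits since k + 1 ≤ d < D.
  let f : Fin d → EuclideanSpace ℝ (Fin D) := fun k => if (k : ℕ) < 2 then 0 else ε (k + 1)
  have hf : ∀ n < 3, ∀ k, inner ℝ (f k) (ε n) = (0 : ℝ) := by
    intro n hn k
    by_cases hk : (k : ℕ) < 2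
    · simp only [f, if_pos hk, inner_zero_left]
    · have : ¬ (k : ℕ) + 1 = n := by omega
      simp only [f, hk, if_false]
      rw [hε _ _ (by omega) (by omega), if_neg this]
  refine ⟨⟨⟨0, by omega⟩, ⟨1, by omega⟩, by simp, ε 0, ε 1, ε 2, f, ?_, ?_, ?_, ?_, ?_, ?_, ?_, ?_,
    hf 0 (by omega), hf 1 (by omega), hf 2 (by omega), ?_⟩⟩
  · exact (hε 0 0 (by omega) (by omega)).trans (by simp)
  · exact (hε 1 1 (by omega) (by omega)).trans (by simp)
  · exact (hε 2 2 (by omega) (by omega)).trans (by simp)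
  · exact (hε 0 1 (by omega) (by omega)).trans (by simp)
  · exact (hε 0 2 (by omega) (by omega)).trans (by simp)
  · exact (hε 1 2 (by omega) (by omega)).trans (by simp)
  · simp [f]
  · simp [f]
  · intro j k h0 h1
    have hj : ¬ (j : ℕ) < 2 := by
      have : (j : ℕ) ≠ 0 := fun h => h0 (Fin.ext h)
      have : (j : ℕ) ≠ 1 := fun h => h1 (Fin.ext h)
      omega
    by_cases hk : (k : ℕ) < 2
    · have : j ≠ k := fun h => hj (h ▸ hk)
      simp only [f, if_pos hk, inner_zero_right, if_neg this]
    · simp only [f, hj, hk, if_false]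
      rw [hε _ _ (by omega) (by omega)]
      simp [Fin.ext_iff]

namespace TorusFrame

variable {d D : ℕ} (T : TorusFrame d D)

/-- The radial unit vector. -/
def er (u : Coord d) : EuclideanSpace ℝ (Fin D) := Real.cos (u T.i₁) • T.a + Real.sin (u T.i₁) • T.b

/-- The angular unit vector. -/
def et (u : Coord d) : EuclideanSpace ℝ (Fin D) :=
  -Real.sin (u T.i₁) • T.a + Real.cos (u T.i₁) • T.b

/-- The unit normal of the torus. -/
def nu (u : Coord d) : EuclideanSpace ℝ (Fin D) :=
  Real.cos (u T.i₀) • T.er u + Real.sin (u T.i₀) • T.e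

/-- The unit tangent vector of the meridians. -/
def tau (u : Coord d) : EuclideanSpace ℝ (Fin D) :=
  -Real.sin (u T.i₀) • T.er u + Real.cos (u T.i₀) • T.e

/-- The distance from the axis. -/
def rho (u : Coord d) : ℝ := 2 + Real.cos (u T.i₀)

/-- The product of a torus of revolution with a Euclidean space. -/
def map (u : Coord d) : EuclideanSpace ℝ (Fin D) :=
  T.rho u • T.er u + Real.sin (u T.i₀) • T.e + linearEmbedding T.f u

/-- The support function of the torus. -/
def supp (u : Coord d) : ℝ := 1 + 2 * Real.cos (u T.i₀)

/-- The axis distance 2 of the tube's centre exceeds the tube radius 1, so the torus avoids its axis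
and the metric never degenerates. -/
theorem rho_pos (u : Coord d) : 0 < T.rho u := by
  have := Real.neg_one_le_cos (u T.i₀)
  unfold rho
  linarith

@[fun_prop]
theorem contDiff_er : ContDiff ℝ ∞ T.er := by unfold er; fun_prop

@[fun_prop]
theorem contDiff_et : ContDiff ℝ ∞ T.et := by unfold et; fun_prop

@[fun_prop]
theorem contDiff_nu : ContDiff ℝ ∞ T.nu := by unfold nu; fun_prop

@[fun_prop]
theorem contDiff_tau : ContDiff ℝ ∞ T.tau := by unfold tau; fun_prop

@[fun_prop]
theorem contDiff_rho : ContDiff ℝ ∞ T.rho := by unfold rho; fun_prop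

@[fun_prop]
theorem contDiff_supp : ContDiff ℝ ∞ T.supp := by unfold supp; fun_prop

@[fun_prop]
theorem contDiff_map : ContDiff ℝ ∞ T.map := by
  have := contDiff_linearEmbedding (f := T.f)
  unfold map
  fun_prop

theorem ba : inner ℝ T.b T.a = (0 : ℝ) := by rw [real_inner_comm, T.ab]

section Inner

variable (u : Coord d)

theorem er_er : inner ℝ (T.er u) (T.er u) = (1 : ℝ) := by
  simp only [er, inner_add_left, inner_add_right, real_inner_smul_left, real_inner_smul_right, T.aa,
    T.bb, T.ab, T.ba]
  nlinarith [Real.sin_sq_add_cos_sq (u T.i₁)]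

theorem et_et : inner ℝ (T.et u) (T.et u) = (1 : ℝ) := by
  simp only [et, inner_add_left, inner_add_right, real_inner_smul_left, real_inner_smul_right, T.aa,
    T.bb, T.ab, T.ba]
  nlinarith [Real.sin_sq_add_cos_sq (u T.i₁)]

theorem er_et : inner ℝ (T.er u) (T.et u) = (0 : ℝ) := by
  simp only [er, et, inner_add_left, inner_add_right, real_inner_smul_left, real_inner_smul_right,
    T.aa, T.bb, T.ab, T.ba]
  ring

theorem er_e : inner ℝ (T.er u) T.e = (0 : ℝ) := by
  simp [er, inner_add_left, inner_smul_left, T.ae, T.be]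

theorem e_er : inner ℝ T.e (T.er u) = (0 : ℝ) := by rw [real_inner_comm, T.er_e]

theorem et_e : inner ℝ (T.et u) T.e = (0 : ℝ) := by
  simp [et, inner_add_left, inner_smul_left, T.ae, T.be]

theorem f_er (k : Fin d) : inner ℝ (T.f k) (T.er u) = (0 : ℝ) := by
  simp [er, inner_add_right, inner_smul_right, T.fa, T.fb]

theorem f_et (k : Fin d) : inner ℝ (T.f k) (T.et u) = (0 : ℝ) := by
  simp [et, inner_add_right, inner_smul_right, T.fa, T.fb]

theorem f_nu (k : Fin d) : inner ℝ (T.f k) (T.nu u) = (0 : ℝ) := by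
  simp [nu, inner_add_right, inner_smul_right, T.f_er, T.fe]

theorem f_tau (k : Fin d) : inner ℝ (T.f k) (T.tau u) = (0 : ℝ) := by
  simp [tau, inner_add_right, inner_smul_right, T.f_er, T.fe]

theorem nu_nu : inner ℝ (T.nu u) (T.nu u) = (1 : ℝ) := by
  simp only [nu, inner_add_left, inner_add_right, real_inner_smul_left, real_inner_smul_right,
    T.er_er, T.er_e, T.e_er, T.ee]
  nlinarith [Real.sin_sq_add_cos_sq (u T.i₀)]

theorem tau_tau : inner ℝ (T.tau u) (T.tau u) = (1 : ℝ) := by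
  simp only [tau, inner_add_left, inner_add_right, real_inner_smul_left, real_inner_smul_right,
    T.er_er, T.er_e, T.e_er, T.ee]
  nlinarith [Real.sin_sq_add_cos_sq (u T.i₀)]

theorem nu_tau : inner ℝ (T.nu u) (T.tau u) = (0 : ℝ) := by
  simp only [nu, tau, inner_add_left, inner_add_right, real_inner_smul_left,
    real_inner_smul_right, T.er_er, T.er_e, T.e_er, T.ee]
  ring

theorem nu_et : inner ℝ (T.nu u) (T.et u) = (0 : ℝ) := by
  rw [nu, inner_add_left, real_inner_smul_left, real_inner_smul_left, T.er_et,
    real_inner_comm, T.et_e]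
  ring

theorem tau_et : inner ℝ (T.tau u) (T.et u) = (0 : ℝ) := by
  rw [tau, inner_add_left, real_inner_smul_left, real_inner_smul_left, T.er_et,
    real_inner_comm, T.et_e]
  ring

end Inner

section Derivatives

variable (u : Coord d) (i : Fin d)

theorem pd_er : pd i T.er u = if i = T.i₁ then T.et u else 0 := by
  unfold er
  rw [pd_add (by fun_prop) (by fun_prop), pd_smul (f := fun _ => T.a) (by fun_prop) (by fun_prop),
    pd_smul (f := fun _ => T.b) (by fun_prop) (by fun_prop), pd_cos_coord, pd_sin_coord]
  split_ifs <;> simp [et]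

theorem pd_et : pd i T.et u = if i = T.i₁ then -T.er u else 0 := by
  unfold et
  have h := pd_comp_coord (r := fun s => -Real.sin s) (u := u) (j := T.i₁)
    (Real.hasDerivAt_sin (u T.i₁)).neg i
  rw [pd_add (by fun_prop) (by fun_prop), pd_smul (f := fun _ => T.a) (by fun_prop) (by fun_prop),
    pd_smul (f := fun _ => T.b) (by fun_prop) (by fun_prop), pd_cos_coord, h]
  split_ifs <;> simp [er]
  abel

theorem differentiable_er : Differentiable ℝ T.er := T.contDiff_er.differentiable (by simp)

theorem differentiable_et : Differentiable ℝ T.et := T.contDiff_et.differentiable (by simp)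

theorem differentiable_nu : Differentiable ℝ T.nu := T.contDiff_nu.differentiable (by simp)

theorem differentiable_tau : Differentiable ℝ T.tau := T.contDiff_tau.differentiable (by simp)

theorem differentiable_rho : Differentiable ℝ T.rho := T.contDiff_rho.differentiable (by simp)

theorem differentiable_supp : Differentiable ℝ T.supp := T.contDiff_supp.differentiable (by simp)

theorem pd_rho : pd i T.rho u = if i = T.i₀ then -Real.sin (u T.i₀) else 0 :=
  pd_comp_coord ((Real.hasDerivAt_cos (u T.i₀)).const_add 2) i

theorem pd_supp : pd i T.supp u = if i = T.i₀ then -2 * Real.sin (u T.i₀) else 0 := by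
  have h : HasDerivAt (fun s => 1 + 2 * Real.cos s) (-2 * Real.sin (u T.i₀)) (u T.i₀) :=
    (((Real.hasDerivAt_cos (u T.i₀)).const_mul 2).const_add 1).congr_deriv (by ring)
  exact pd_comp_coord h i

theorem pd_nu : pd i T.nu u
    = if i = T.i₀ then T.tau u else if i = T.i₁ then Real.cos (u T.i₀) • T.et u else 0 := by
  have := T.differentiable_er u
  unfold nu
  rw [pd_add (by fun_prop) (by fun_prop), pd_smul (by fun_prop) this,
    pd_smul (f := fun _ => T.e) (by fun_prop) (by fun_prop), pd_cos_coord, pd_sin_coord, pd_er]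
  by_cases h0 : i = T.i₀
  · simp [h0, T.ne, tau]
  · simp [h0]

theorem pd_tau : pd i T.tau u
    = if i = T.i₀ then -T.nu u else if i = T.i₁ then -Real.sin (u T.i₀) • T.et u else 0 := by
  have := T.differentiable_er u
  have h := pd_comp_coord (r := fun s => -Real.sin s) (u := u) (j := T.i₀)
    (Real.hasDerivAt_sin (u T.i₀)).neg i
  unfold tau
  rw [pd_add (by fun_prop) (by fun_prop), pd_smul (by fun_prop) this,
    pd_smul (f := fun _ => T.e) (by fun_prop) (by fun_prop), pd_cos_coord, h, pd_er]
  by_cases h0 : i = T.i₀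
  · simp [h0, T.ne, nu]
    abel
  · simp [h0]

theorem pd_map : pd i T.map u
    = if i = T.i₀ then T.tau u else if i = T.i₁ then T.rho u • T.et u else T.f i := by
  have h1 := T.differentiable_er u
  have h2 := T.differentiable_rho u
  have h3 : DifferentiableAt ℝ (linearEmbedding T.f) u :=
    contDiff_linearEmbedding.differentiable (by simp) u
  unfold map
  rw [pd_add (by fun_prop) h3, pd_add (by fun_prop) (by fun_prop), pd_smul h2 h1,
    pd_smul (f := fun _ => T.e) (by fun_prop) (by fun_prop), pd_sin_coord, pd_er, pd_rho,
    pd_linearEmbedding]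
  by_cases h0 : i = T.i₀
  · simp [h0, T.ne, tau, T.f_zero]
  · by_cases h1 : i = T.i₁
    · simp [h1, T.ne.symm, T.f_one]
    · simp [h0, h1]

end Derivatives

end TorusFrame

end Torus

namespace TorusFrame

variable {d D : ℕ} (T : TorusFrame d D)

/-! ### Metric of the torus, and the tangential and normal parts of the position. -/

section Metric

variable (u : Coord d)

theorem inducedMetric_map :
    inducedMetric T.map u = Matrix.diagonal fun i => if i = T.i₁ then T.rho u ^ 2 else 1 := by
  ext i j
  rw [inducedMetric_apply, T.pd_map, T.pd_map, Matrix.diagonal_apply]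
  have hff := T.ff i j
  have htf : inner ℝ (T.tau u) (T.f j) = (0 : ℝ) := by rw [real_inner_comm, T.f_tau]
  have hef : inner ℝ (T.et u) (T.f j) = (0 : ℝ) := by rw [real_inner_comm, T.f_et]
  have het : inner ℝ (T.et u) (T.tau u) = (0 : ℝ) := by rw [real_inner_comm, T.tau_et]
  have hne := T.ne
  have hne' := T.ne.symm
  split_ifs <;> (try simp only [real_inner_smul_left, real_inner_smul_right, T.tau_tau, T.et_et,
    T.tau_et, T.f_tau, T.f_et, htf, hef, het]) <;>
    first | grind | (rw [hff ‹_› ‹_›]; simp [*])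

theorem det_inducedMetric_map : (inducedMetric T.map u).det = T.rho u ^ 2 := by
  rw [inducedMetric_map, Matrix.det_diagonal, Finset.prod_ite_eq' Finset.univ T.i₁]
  simp

theorem isMetricOn_map : IsMetricOn (inducedMetric T.map) Set.univ :=
  isMetricOn_inducedMetric isOpen_univ T.contDiff_map.contDiffOn fun u _ => by
    rw [T.det_inducedMetric_map]
    exact pow_pos (T.rho_pos u) 2

theorem volDensity_map : volDensity (inducedMetric T.map) u = T.rho u := by
  rw [volDensity, det_inducedMetric_map, Real.sqrt_sq (T.rho_pos u).le]

theorem inv_inducedMetric_map : (inducedMetric T.map u)⁻¹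
    = Matrix.diagonal fun i => if i = T.i₁ then (T.rho u ^ 2)⁻¹ else 1 := by
  have hr := (T.rho_pos u).ne'
  refine Matrix.inv_eq_left_inv ?_
  rw [inducedMetric_map, Matrix.diagonal_mul_diagonal, ← Matrix.diagonal_one]
  congr 1
  funext i
  split_ifs
  · field_simp
  · simp

/-- The metric is diagonal with density `rho`, so the weight √det g · g^{ii} is `rho` in every
direction except the rotation angle, where it is its reciprocal. -/
theorem laplaceBeltrami_map {F : Type*} [NormedAddCommGroup F] [NormedSpace ℝ F]
    (f : Coord d → F) : laplaceBeltrami (inducedMetric T.map) f u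
      = (T.rho u)⁻¹ • (pd T.i₀ (fun v => T.rho v • pd T.i₀ f v) u
        + pd T.i₁ (fun v => (T.rho v)⁻¹ • pd T.i₁ f v) u
        + ∑ i, if i = T.i₀ ∨ i = T.i₁ then 0 else pd i (fun v => T.rho v • pd i f v) u) := by
  have h : ∀ i, (fun v => volDensity (inducedMetric T.map) v •
        ∑ j, (inducedMetric T.map v)⁻¹ i j • pd j f v)
      = fun v => (if i = T.i₁ then (T.rho v)⁻¹ else T.rho v) • pd i f v := by
    intro i
    funext v
    have hr := (T.rho_pos v).ne'
    simp only [volDensity_map, inv_inducedMetric_map, Matrix.diagonal_apply, ite_smul, zero_smul,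
      Finset.sum_ite_eq, Finset.mem_univ, if_true]
    split_ifs
    · rw [smul_smul]
      congr 1
      field_simp
    · simp
  unfold laplaceBeltrami
  rw [volDensity_map]
  simp only [h]
  congr 1
  have hsplit : ∀ i, pd i (fun v => (if i = T.i₁ then (T.rho v)⁻¹ else T.rho v) • pd i f v) u
      = (if i = T.i₀ then pd T.i₀ (fun v => T.rho v • pd T.i₀ f v) u else 0)
        + (if i = T.i₁ then pd T.i₁ (fun v => (T.rho v)⁻¹ • pd T.i₁ f v) u else 0)
        + if i = T.i₀ ∨ i = T.i₁ then 0 else pd i (fun v => T.rho v • pd i f v) u := by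
    intro i
    by_cases i0 : i = T.i₀
    · simp [i0, T.ne]
    · by_cases i1 : i = T.i₁
      · simp [i1, T.ne.symm]
      · simp [i0, i1]
  simp only [hsplit, Finset.sum_add_distrib, Finset.sum_ite_eq', Finset.mem_univ, if_true]

theorem inner_nu_pd (c : Fin d) : inner ℝ (T.nu u) (pd c T.map u) = (0 : ℝ) := by
  rw [T.pd_map]
  split_ifs
  · exact T.nu_tau u
  · rw [real_inner_smul_right, T.nu_et, mul_zero]
  · rw [real_inner_comm, T.f_nu]

/-- Components of the tangential part of the position vector. -/
def posCoeff (b : Fin d) : ℝ :=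
  if b = T.i₀ then -2 * Real.sin (u T.i₀) else if b = T.i₁ then 0 else u b

theorem map_eq : T.map u = ∑ b, T.posCoeff u b • pd b T.map u + T.supp u • T.nu u := by
  have h : ∀ b, T.posCoeff u b • pd b T.map u
      = (if b = T.i₀ then (-2 * Real.sin (u T.i₀)) • T.tau u else 0) + u b • T.f b := by
    intro b
    rw [T.pd_map, posCoeff]
    by_cases b0 : b = T.i₀
    · simp [b0, T.f_zero]
    · by_cases b1 : b = T.i₁
      · simp [b1, T.ne.symm, T.f_one]
      · simp [b0, b1]
  simp only [h, Finset.sum_add_distrib, Finset.sum_ite_eq', Finset.mem_univ, if_true]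
  rw [map, linearEmbedding, rho, supp, nu, tau]
  have hsc := Real.sin_sq_add_cos_sq (u T.i₀)
  have h1 : (2 + Real.cos (u T.i₀)) • T.er u + Real.sin (u T.i₀) • T.e
      = (-2 * Real.sin (u T.i₀)) • (-Real.sin (u T.i₀) • T.er u + Real.cos (u T.i₀) • T.e)
        + (1 + 2 * Real.cos (u T.i₀)) • (Real.cos (u T.i₀) • T.er u + Real.sin (u T.i₀) • T.e) := by
    have e1 : (2 + Real.cos (u T.i₀)) = 2 * Real.sin (u T.i₀) ^ 2
        + (1 + 2 * Real.cos (u T.i₀)) * Real.cos (u T.i₀) := by linear_combination -2 * hsc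
    rw [e1]
    module
  rw [h1]
  abel

theorem tangentProj_nu : tangentProj T.map u (T.nu u) = 0 := by
  rw [tangentProj_congr (y := 0) fun c => by rw [T.inner_nu_pd, inner_zero_left], tangentProj_zero]

theorem tangentProj_map : tangentProj T.map u (T.map u) = T.map u - T.supp u • T.nu u := by
  conv_lhs => rw [T.map_eq u]
  rw [tangentProj_add, tangentProj_sum_smul T.isMetricOn_map (Set.mem_univ u), tangentProj_smul,
    tangentProj_nu, smul_zero, add_zero]
  conv_rhs => rw [T.map_eq u]
  rw [add_sub_cancel_right]

theorem normalProj_map : normalProj T.map u (T.map u) = T.supp u • T.nu u := by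
  rw [normalProj, tangentProj_map, sub_sub_cancel]

theorem inner_map_pd (c : Fin d) :
    inner ℝ (T.map u) (pd c T.map u)
      = if c = T.i₁ then 0 else T.posCoeff u c := by
  have hcomp : ∀ b, inducedMetric T.map u b c
      = if b = c then (if b = T.i₁ then T.rho u ^ 2 else 1) else 0 := by
    intro b
    rw [inducedMetric_map, Matrix.diagonal_apply]
  conv_lhs => rw [T.map_eq u]
  rw [inner_add_left, real_inner_smul_left, T.inner_nu_pd, sum_inner]
  simp only [real_inner_smul_left, ← inducedMetric_apply, hcomp]
  simp only [mul_ite, mul_zero, mul_one, Finset.sum_ite_eq', Finset.mem_univ, if_true, add_zero]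
  split_ifs with h
  · simp [h, posCoeff, T.ne.symm]
  · rfl

end Metric

/-! ### Laplacians of the position, of its normal part and of half its squared length. -/

section Laplacians

variable (u : Coord d)

theorem er_eq : T.er u = Real.cos (u T.i₀) • T.nu u - Real.sin (u T.i₀) • T.tau u := by
  rw [nu, tau]
  have h : Real.cos (u T.i₀) • (Real.cos (u T.i₀) • T.er u + Real.sin (u T.i₀) • T.e)
      - Real.sin (u T.i₀) • (-Real.sin (u T.i₀) • T.er u + Real.cos (u T.i₀) • T.e)
      = (Real.sin (u T.i₀) ^ 2 + Real.cos (u T.i₀) ^ 2) • T.er u := by module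
  rw [h, Real.sin_sq_add_cos_sq, one_smul]

/-- The mean curvature vector of the torus. -/
theorem laplace_map : laplaceBeltrami (inducedMetric T.map) T.map u
    = (-(2 + 2 * Real.cos (u T.i₀)) / T.rho u) • T.nu u := by
  have hr := (T.rho_pos u).ne'
  have h0 : pd T.i₀ (fun v => T.rho v • pd T.i₀ T.map v) u
      = -Real.sin (u T.i₀) • T.tau u - T.rho u • T.nu u := by
    have : (fun v => T.rho v • pd T.i₀ T.map v) = fun v => T.rho v • T.tau v := by
      funext v
      simp [T.pd_map]
    rw [this, pd_smul (T.differentiable_rho u) (T.differentiable_tau u), T.pd_rho, T.pd_tau]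
    simp [sub_eq_add_neg]
  have h1 : pd T.i₁ (fun v => (T.rho v)⁻¹ • pd T.i₁ T.map v) u = -T.er u := by
    have : (fun v => (T.rho v)⁻¹ • pd T.i₁ T.map v) = T.et := by
      funext v
      have hr := (T.rho_pos v).ne'
      simp [T.pd_map, T.ne.symm, smul_smul, hr]
    rw [this, T.pd_et, if_pos rfl]
  have h2 : ∀ i, (if i = T.i₀ ∨ i = T.i₁ then 0 else
      pd i (fun v => T.rho v • pd i T.map v) u) = 0 := by
    intro i
    split_ifs with h
    · rfl
    · have hi : ¬ i = T.i₀ ∧ ¬ i = T.i₁ := not_or.1 h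
      have : (fun v => T.rho v • pd i T.map v) = fun v => T.rho v • T.f i := by
        funext v
        simp [T.pd_map, hi.1, hi.2]
      rw [this, pd_smul (f := fun _ => T.f i) (T.differentiable_rho u) (by fun_prop), T.pd_rho]
      simp [hi.1]
  rw [laplaceBeltrami_map, h0, h1, T.er_eq]
  simp only [h2, Finset.sum_const_zero]
  have e : -(2 + 2 * Real.cos (u T.i₀)) / T.rho u
      = (T.rho u)⁻¹ * (-T.rho u - Real.cos (u T.i₀)) := by
    rw [rho]
    ring
  rw [e, mul_smul]
  congr 1
  module

/-- Green's second identity replaces the Laplacian of the velocity by that of the normal part of the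
position. Both components of the latter are needed, since the velocity has a ν and a τ part. -/
theorem laplace_supp_nu : laplaceBeltrami (inducedMetric T.map) (fun v => T.supp v • T.nu v) u
    = (T.rho u)⁻¹ • ((2 * Real.sin (u T.i₀) ^ 2 - T.rho u * (2 * Real.cos (u T.i₀) + T.supp u)
        - T.supp u * Real.cos (u T.i₀) ^ 2 / T.rho u) • T.nu u
      + (-Real.sin (u T.i₀) * T.supp u - 4 * T.rho u * Real.sin (u T.i₀)
        + T.supp u * Real.cos (u T.i₀) * Real.sin (u T.i₀) / T.rho u) • T.tau u) := by
  have hr := (T.rho_pos u).ne'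
  have hd : ∀ i v, pd i (fun v => T.supp v • T.nu v) v
      = pd i T.supp v • T.nu v + T.supp v • pd i T.nu v := fun i v =>
    pd_smul (T.differentiable_supp v) (T.differentiable_nu v) i
  have hs : DifferentiableAt ℝ (fun v : Coord d => -2 * Real.sin (v T.i₀)) u := by fun_prop
  have hsd : pd T.i₀ (fun v : Coord d => -2 * Real.sin (v T.i₀)) u = -2 * Real.cos (u T.i₀) := by
    rw [pd_comp_coord (r := fun s => -2 * Real.sin s)
      ((Real.hasDerivAt_sin (u T.i₀)).const_mul (-2)), if_pos rfl]
  have h0 : pd T.i₀ (fun v => T.rho v • pd T.i₀ (fun v => T.supp v • T.nu v) v) u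
      = -Real.sin (u T.i₀) • ((-2 * Real.sin (u T.i₀)) • T.nu u + T.supp u • T.tau u)
        + T.rho u • ((-2 * Real.cos (u T.i₀)) • T.nu u + (-2 * Real.sin (u T.i₀)) • T.tau u
          + ((-2 * Real.sin (u T.i₀)) • T.tau u - T.supp u • T.nu u)) := by
    have : (fun v => T.rho v • pd T.i₀ (fun v => T.supp v • T.nu v) v)
        = fun v => T.rho v • ((-2 * Real.sin (v T.i₀)) • T.nu v + T.supp v • T.tau v) := by
      funext v
      simp only [hd, T.pd_supp, T.pd_nu, if_true]
    have d1 := hs.fun_smul (T.differentiable_nu u)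
    have d2 := (T.differentiable_supp u).fun_smul (T.differentiable_tau u)
    rw [this, pd_smul (T.differentiable_rho u) (d1.fun_add d2), pd_add d1 d2,
      pd_smul hs (T.differentiable_nu u), pd_smul (T.differentiable_supp u) (T.differentiable_tau u),
      hsd, T.pd_rho, T.pd_supp, T.pd_nu, T.pd_tau]
    simp only [if_true, smul_neg, sub_eq_add_neg]
  have h1 : pd T.i₁ (fun v => (T.rho v)⁻¹ • pd T.i₁ (fun v => T.supp v • T.nu v) v) u
      = -(T.supp u * Real.cos (u T.i₀) / T.rho u) • T.er u := by
    have : (fun v => (T.rho v)⁻¹ • pd T.i₁ (fun v => T.supp v • T.nu v) v)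
        = fun v => ((1 + 2 * Real.cos (v T.i₀)) * Real.cos (v T.i₀) / (2 + Real.cos (v T.i₀)))
          • T.et v := by
      funext v
      simp only [hd, T.pd_supp, T.pd_nu, T.ne.symm, if_true, if_false, zero_smul, zero_add,
        smul_smul]
      congr 1
      rw [supp, rho]
      ring
    -- Only differentiability matters here: the coefficient depends on the meridian angle alone, so
    -- its derivative in the rotation angle is zero and `deriv` is left unevaluated.
    have hk : HasDerivAt (fun s => (1 + 2 * Real.cos s) * Real.cos s / (2 + Real.cos s))
        (deriv (fun s => (1 + 2 * Real.cos s) * Real.cos s / (2 + Real.cos s)) (u T.i₀))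
        (u T.i₀) := by
      refine DifferentiableAt.hasDerivAt ?_
      have hr : 2 + Real.cos (u T.i₀) ≠ 0 := hr
      fun_prop (disch := assumption)
    have hk' : DifferentiableAt ℝ (fun v : Coord d =>
        (1 + 2 * Real.cos (v T.i₀)) * Real.cos (v T.i₀) / (2 + Real.cos (v T.i₀))) u := by
      have hr : 2 + Real.cos (u T.i₀) ≠ 0 := hr
      fun_prop (disch := assumption)
    rw [this, pd_smul hk' (T.differentiable_et u), pd_comp_coord hk, T.pd_et]
    simp only [T.ne.symm, if_true, if_false, zero_smul, zero_add, smul_neg, neg_smul]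
    rfl
  have h2 : ∀ i, (if i = T.i₀ ∨ i = T.i₁ then 0 else
      pd i (fun v => T.rho v • pd i (fun v => T.supp v • T.nu v) v) u) = 0 := by
    intro i
    split_ifs with h
    · rfl
    · have hi : ¬ i = T.i₀ ∧ ¬ i = T.i₁ := not_or.1 h
      simp [hd, T.pd_supp, T.pd_nu, hi.1, hi.2]
  rw [laplaceBeltrami_map, h0, h1, T.er_eq]
  simp only [h2, Finset.sum_const_zero]
  congr 1
  module

theorem inner_nu_laplace_supp_nu :
    inner ℝ (T.nu u) (laplaceBeltrami (inducedMetric T.map) (fun v => T.supp v • T.nu v) u)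
      = (2 * Real.sin (u T.i₀) ^ 2 - T.rho u * (2 * Real.cos (u T.i₀) + T.supp u)
        - T.supp u * Real.cos (u T.i₀) ^ 2 / T.rho u) / T.rho u := by
  rw [laplace_supp_nu, real_inner_smul_right, inner_add_right, real_inner_smul_right,
    real_inner_smul_right, T.nu_nu, T.nu_tau]
  ring

theorem inner_tau_laplace_supp_nu :
    inner ℝ (T.tau u) (laplaceBeltrami (inducedMetric T.map) (fun v => T.supp v • T.nu v) u)
      = (-Real.sin (u T.i₀) * T.supp u - 4 * T.rho u * Real.sin (u T.i₀)
        + T.supp u * Real.cos (u T.i₀) * Real.sin (u T.i₀) / T.rho u) / T.rho u := by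
  rw [laplace_supp_nu, real_inner_smul_right, inner_add_right, real_inner_smul_right,
    real_inner_smul_right, T.tau_tau, real_inner_comm, T.nu_tau]
  ring

/-- Half the squared distance from the origin. -/
def halfSq : ℝ := inner ℝ (T.map u) (T.map u) / 2

theorem contDiff_halfSq : ContDiff ℝ ∞ T.halfSq := by
  unfold halfSq
  exact (T.contDiff_map.inner ℝ T.contDiff_map).div_const 2

/-- The tangential part of the position is a gradient, which is what makes
`integral_hodgeLaplacian_mul_pd` applicable to the Hodge pairing. -/
theorem pd_halfSq (i : Fin d) :
    pd i T.halfSq u = inner ℝ (T.map u) (pd i T.map u) := by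
  have hm := T.contDiff_map.differentiable (by simp) u
  have h : T.halfSq = fun v => (1 / 2 : ℝ) * inner ℝ (T.map v) (T.map v) := by
    funext v
    rw [halfSq]
    ring
  rw [h, pd_mul (a := fun _ => 1 / 2) (by fun_prop) (hm.inner ℝ hm), pd_inner hm hm, pd_const,
    real_inner_comm (T.map u) (pd i T.map u)]
  ring

/-- Each Euclidean direction contributes the constant 1, which the next derivative removes; the rest
comes from the meridian component -2 sin of the position. -/
theorem laplace_halfSq : laplaceBeltrami (inducedMetric T.map) T.halfSq
    = fun u => (2 * Real.sin (u T.i₀) ^ 2 - 2 * (2 + Real.cos (u T.i₀)) * Real.cos (u T.i₀))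
      / (2 + Real.cos (u T.i₀)) + ∑ i : Fin d, if i = T.i₀ ∨ i = T.i₁ then 0 else 1 := by
  funext u
  have hr := (T.rho_pos u).ne'
  have h0 : pd T.i₀ (fun v => T.rho v • pd T.i₀ T.halfSq v) u
      = 2 * Real.sin (u T.i₀) ^ 2 - 2 * (2 + Real.cos (u T.i₀)) * Real.cos (u T.i₀) := by
    have : (fun v => T.rho v • pd T.i₀ T.halfSq v)
        = fun v => (2 + Real.cos (v T.i₀)) * (-2 * Real.sin (v T.i₀)) := by
      funext v
      simp [pd_halfSq, inner_map_pd, T.ne, posCoeff, rho]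
    have hk : HasDerivAt (fun s => (2 + Real.cos s) * (-2 * Real.sin s))
        (2 * Real.sin (u T.i₀) ^ 2 - 2 * (2 + Real.cos (u T.i₀)) * Real.cos (u T.i₀)) (u T.i₀) :=
      (((Real.hasDerivAt_cos (u T.i₀)).const_add 2).mul
        ((Real.hasDerivAt_sin (u T.i₀)).const_mul (-2))).congr_deriv (by ring)
    rw [this, pd_comp_coord hk, if_pos rfl]
  have h1 : pd T.i₁ (fun v => (T.rho v)⁻¹ • pd T.i₁ T.halfSq v) u = 0 := by
    simp [pd_halfSq, inner_map_pd]
  have h2 : ∀ i, (if i = T.i₀ ∨ i = T.i₁ then 0 else pd i (fun v => T.rho v • pd i T.halfSq v) u)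
      = T.rho u * if i = T.i₀ ∨ i = T.i₁ then 0 else 1 := by
    intro i
    split_ifs with h
    · simp
    · have hi : ¬ i = T.i₀ ∧ ¬ i = T.i₁ := not_or.1 h
      have : (fun v => T.rho v • pd i T.halfSq v) = fun v => T.rho v * v i := by
        funext v
        simp [pd_halfSq, inner_map_pd, hi.1, hi.2, posCoeff]
      rw [this, pd_mul (T.differentiable_rho u) (by fun_prop), T.pd_rho, pd_coord]
      simp [hi.1]
  rw [laplaceBeltrami_map, h0, h1]
  simp only [h2, ← Finset.mul_sum]
  rw [smul_eq_mul, add_zero, mul_add, inv_mul_cancel_left₀ hr, rho]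
  ring

theorem pd_laplace_halfSq : pd T.i₀ (laplaceBeltrami (inducedMetric T.map) T.halfSq) u
    = Real.sin (u T.i₀) * (4 - 6 / (2 + Real.cos (u T.i₀)) ^ 2) := by
  have hr : 2 + Real.cos (u T.i₀) ≠ 0 := (T.rho_pos u).ne'
  have hk : HasDerivAt (fun s => (2 * Real.sin s ^ 2 - 2 * (2 + Real.cos s) * Real.cos s)
      / (2 + Real.cos s) + ∑ i : Fin d, if i = T.i₀ ∨ i = T.i₁ then (0 : ℝ) else 1)
      (Real.sin (u T.i₀) * (4 - 6 / (2 + Real.cos (u T.i₀)) ^ 2)) (u T.i₀) := by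
    have hc := Real.hasDerivAt_cos (u T.i₀)
    have hs := Real.hasDerivAt_sin (u T.i₀)
    refine (((((hs.pow 2).const_mul 2).sub (((hc.const_add 2).const_mul 2).mul hc)).div
      (hc.const_add 2) hr).add_const _).congr_deriv ?_
    have hsc : Real.sin (u T.i₀) ^ 2 = 1 - Real.cos (u T.i₀) ^ 2 := by
      linear_combination Real.sin_sq_add_cos_sq (u T.i₀)
    simp only [Pi.pow_apply, Pi.mul_apply, Pi.sub_apply]
    field_simp
    ring_nf
    rw [show Real.sin (u T.i₀) ^ 3 = Real.sin (u T.i₀) * Real.sin (u T.i₀) ^ 2 by ring, hsc]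
    ring
  rw [laplace_halfSq, pd_comp_coord hk, if_pos rfl]

end Laplacians

/-! ### Second fundamental form along the meridians. -/

section SecondFundamentalForm

variable (u : Coord d)

theorem normalProj_pd (c : Fin d) : normalProj T.map u (pd c T.map u) = 0 := by
  have h := tangentProj_sum_smul T.isMetricOn_map (Set.mem_univ u) (Pi.single c (1 : ℝ))
  simp only [Pi.single_apply, ite_smul, one_smul, zero_smul, Finset.sum_ite_eq', Finset.mem_univ,
    if_true] at h
  rw [normalProj, h, sub_self]

theorem tangentProj_pd (c : Fin d) : tangentProj T.map u (pd c T.map u) = pd c T.map u := by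
  have := T.normalProj_pd u c
  rw [normalProj, sub_eq_zero] at this
  exact this.symm

theorem tangentProj_et : tangentProj T.map u (T.et u) = T.et u := by
  have h := T.tangentProj_pd u T.i₁
  simp only [T.pd_map, T.ne.symm, if_true, if_false, tangentProj_smul] at h
  exact smul_right_injective _ (T.rho_pos u).ne' h

/-- The meridians are unit circles and lines of curvature: differentiating τ along them gives -ν,
while the mixed derivatives with the other coordinates are tangential or zero. -/
theorem secondFF_meridian (c : Fin d) :
    secondFF T.map T.i₀ c u = if c = T.i₀ then -T.nu u else 0 := by
  have hm : ∀ j, pd j T.map = fun v => if j = T.i₀ then T.tau v else if j = T.i₁ then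
      T.rho v • T.et v else T.f j := fun j => funext fun v => T.pd_map v j
  rw [secondFF, hm]
  by_cases c0 : c = T.i₀
  · simp only [c0, if_true]
    rw [show (fun v => T.tau v) = T.tau from rfl, T.pd_tau, if_pos rfl, normalProj,
      tangentProj_neg, tangentProj_nu]
    simp
  · by_cases c1 : c = T.i₁
    · simp only [c1, T.ne.symm, if_true, if_false]
      rw [pd_smul (T.differentiable_rho u) (T.differentiable_et u), T.pd_rho, T.pd_et, if_pos rfl,
        if_neg T.ne, smul_zero, add_zero, normalProj, tangentProj_smul, tangentProj_et, sub_self]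
    · simp only [c0, c1, if_false, pd_const, normalProj, tangentProj_zero, sub_self]

theorem weingarten_meridian : weingarten T.map (-T.nu u) T.i₀ u = T.tau u := by
  have h : ∀ b, (∑ c, (inducedMetric T.map u)⁻¹ b c *
      inner ℝ (secondFF T.map T.i₀ c u) (-T.nu u)) = if b = T.i₀ then 1 else 0 := by
    intro b
    simp only [inv_inducedMetric_map, Matrix.diagonal_apply, secondFF_meridian, ite_mul, zero_mul,
      Finset.sum_ite_eq, Finset.mem_univ, if_true]
    by_cases b0 : b = T.i₀
    · simp only [b0, T.ne, if_true, if_false, inner_neg_neg, T.nu_nu, one_mul]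
    · simp [b0]
  unfold weingarten
  simp only [h, ite_smul, one_smul, zero_smul, Finset.sum_ite_eq', Finset.mem_univ, if_true,
    T.pd_map]

theorem secondFF_meridian' (c : Fin d) :
    secondFF T.map c T.i₀ u = if c = T.i₀ then -T.nu u else 0 := by
  rw [← secondFF_meridian, secondFF, secondFF,
    pd_comm isOpen_univ T.contDiff_map.contDiffOn (Set.mem_univ u)]

end SecondFundamentalForm

end TorusFrame

/-! ### Linear independence of the moment functions. -/

section Independence

/-- On a coordinate line through a point of B the combination is analytic and vanishes near that
point, so it vanishes identically. This lets independence on a small open set be tested at any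
convenient angles. -/
theorem sum_mul_eq_zero_of_analytic {d n : ℕ} {B : Set (Coord d)} (hB : IsOpen B)
    (hne : B.Nonempty) (j : Fin d) {r : Fin n → ℝ → ℝ} (hr : ∀ i s, AnalyticAt ℝ (r i) s)
    {k : Fin n → ℝ} (h : ∀ u ∈ B, ∑ i, k i * r i (u j) = 0) (s : ℝ) :
    ∑ i, k i * r i s = 0 := by
  obtain ⟨p, hp⟩ := hne
  have han : AnalyticOnNhd ℝ (fun s => ∑ i, k i * r i s) Set.univ := fun s _ =>
    Finset.analyticAt_fun_sum _ fun i _ => analyticAt_const.mul (hr i s)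
  have hc : Continuous fun s : ℝ => p + (s - p j) • EuclideanSpace.single j (1 : ℝ) := by
    fun_prop
  have hev : (fun s => ∑ i, k i * r i s) =ᶠ[nhds (p j)] fun _ => 0 := by
    have hmem : B ∈ nhds (p + (p j - p j) • EuclideanSpace.single j (1 : ℝ)) := by
      simpa using hB.mem_nhds hp
    filter_upwards [hc.continuousAt.preimage_mem_nhds hmem] with s hs
    have := h _ hs
    simpa using this
  exact congrFun (han.eq_of_eventuallyEq (fun s _ => analyticAt_const) hev) s

/-- Moments of the normal component. -/
def normalMoment : Fin 2 → ℝ → ℝ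
  -- With the density `rho` included, these are `rho` times the ν-components of the Laplacians of
  -- the position and of its normal part.
  | 0, s => -(2 + 2 * Real.cos s)
  | 1, s => 2 * Real.sin s ^ 2 - (2 + Real.cos s) * (2 * Real.cos s + (1 + 2 * Real.cos s))
      - (1 + 2 * Real.cos s) * Real.cos s ^ 2 / (2 + Real.cos s)

/-- Moments of the tangential component. -/
def tangentMoment : Fin 3 → ℝ → ℝ
  -- With `rho` included: the meridian derivative of the Laplacian of `halfSq`, minus the
  -- τ-component of the position, and the τ-component of the Laplacian of its normal part.
  | 0, s => Real.sin s * (4 - 6 / (2 + Real.cos s) ^ 2) * (2 + Real.cos s)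
  | 1, s => 2 * Real.sin s * (2 + Real.cos s)
  | 2, s => -Real.sin s * (1 + 2 * Real.cos s) - 4 * (2 + Real.cos s) * Real.sin s
      + (1 + 2 * Real.cos s) * Real.cos s * Real.sin s / (2 + Real.cos s)

theorem two_add_cos_ne_zero (s : ℝ) : 2 + Real.cos s ≠ 0 := by
  have := Real.neg_one_le_cos s
  linarith

theorem analyticAt_normalMoment (i : Fin 2) (s : ℝ) : AnalyticAt ℝ (normalMoment i) s := by
  have h := two_add_cos_ne_zero s
  have hc : AnalyticAt ℝ Real.cos s := Real.analyticAt_cos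
  have hs : AnalyticAt ℝ Real.sin s := Real.analyticAt_sin
  match i with
  | 0 | 1 => unfold normalMoment; fun_prop (disch := assumption)

theorem analyticAt_tangentMoment (i : Fin 3) (s : ℝ) : AnalyticAt ℝ (tangentMoment i) s := by
  have h := two_add_cos_ne_zero s
  have h2 := pow_ne_zero 2 h
  have hc : AnalyticAt ℝ Real.cos s := Real.analyticAt_cos
  have hs : AnalyticAt ℝ Real.sin s := Real.analyticAt_sin
  match i with
  | 0 | 1 | 2 => unfold tangentMoment; fun_prop (disch := assumption)

theorem normalMoment_independent {k : Fin 2 → ℝ} (h : ∀ s, ∑ i, k i * normalMoment i s = 0) :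
    -- At π the first function is 0 and the second is 4; at 0 the first is -4.
    k = 0 := by
  have h1 := h Real.pi
  have h2 := h 0
  simp [Fin.sum_univ_two, normalMoment] at h1 h2
  norm_num at h1 h2
  ext i
  fin_cases i <;> simp <;> grind

theorem tangentMoment_independent {k : Fin 3 → ℝ} (h : ∀ s, ∑ i, k i * tangentMoment i s = 0) :
    k = 0 := by
  -- All three functions are divisible by sin, so symmetric angles about 0 give nothing new. At π/2,
  -- π/3 and 2π/3 the quotients form a nonsingular matrix.
  have h1 := h (Real.pi / 2)
  have h2 := h (Real.pi / 3)
  have h3 := h (Real.pi - Real.pi / 3)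
  have hs : Real.sin (Real.pi / 3) ≠ 0 := by
    rw [Real.sin_pi_div_three]
    positivity
  simp only [Fin.sum_univ_three, tangentMoment, Real.sin_pi_div_two, Real.cos_pi_div_two,
    Real.cos_pi_sub, Real.sin_pi_sub, Real.cos_pi_div_three] at h1 h2 h3
  norm_num at h1 h2 h3
  have e2 : k 0 * (38 / 5) + k 1 * 5 + k 2 * (-58 / 5) = 0 := by
    refine (mul_eq_zero.1 (?_ : Real.sin (Real.pi / 3) * _ = 0)).resolve_left hs
    rw [Real.sin_pi_div_three]
    linear_combination h2
  have e3 : k 0 * 2 + k 1 * 3 + k 2 * (-6) = 0 := by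
    refine (mul_eq_zero.1 (?_ : Real.sin (Real.pi / 3) * _ = 0)).resolve_left hs
    rw [Real.sin_pi_div_three]
    linear_combination h3
  ext i
  fin_cases i <;> simp <;> linarith

end Independence

/-! ### The pairings of the torus flow as moments of its velocity components. -/

namespace TorusFrame

variable {d D : ℕ} (T : TorusFrame d D) {S : Set (Coord d)} {w φ : Coord d → ℝ}

/-- A velocity along the torus with prescribed meridian and normal components. -/
def field (w φ : Coord d → ℝ) (u : Coord d) : EuclideanSpace ℝ (Fin D) :=
  w u • T.tau u + φ u • T.nu u

theorem contDiff_field (hw : ContDiff ℝ ∞ w) (hφ : ContDiff ℝ ∞ φ) :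
    ContDiff ℝ ∞ (T.field w φ) := by
  unfold field
  fun_prop

theorem field_eq (u : Coord d) :
    T.field w φ u = ∑ b, (if b = T.i₀ then w u else 0) • pd b T.map u + φ u • T.nu u := by
  rw [Finset.sum_eq_single T.i₀ (fun b _ hb => by rw [if_neg hb, zero_smul]) (by simp), if_pos rfl,
    T.pd_map, if_pos rfl, field]

theorem tangentVelCoeff_field :
    tangentVelCoeff (affineFlow T.map (T.field w φ)) 0
      = fun a u => if a = T.i₀ then w u else 0 := by
  funext a u
  rw [tangentVelCoeff, affineFlow_zero, velocity_affineFlow, field_eq, tangentCoeff_add,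
    tangentCoeff_sum_smul T.isMetricOn_map (Set.mem_univ u)]
  simp [tangentCoeff, real_inner_smul_left, T.inner_nu_pd]

theorem normalVel_field :
    normalVel (affineFlow T.map (T.field w φ)) 0 = fun u => φ u • T.nu u := by
  funext u
  rw [normalVel, affineFlow_zero, velocity_affineFlow, normalProj, field_eq, tangentProj_add,
    tangentProj_sum_smul T.isMetricOn_map (Set.mem_univ u), tangentProj_smul, tangentProj_nu,
    smul_zero, add_zero, add_sub_cancel_left]

theorem setIntegral_testFunction (hw : w ∈ testFunctions (interior S)) (r : Coord d → ℝ) :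
    ∫ u in S, w u * r u = ∫ u, w u * r u :=
  setIntegral_eq_integral_of_forall_compl_eq_zero fun u hu => by
    rw [image_eq_zero_of_notMem_tsupport fun h => hu (interior_subset (hw.2.2 h)), zero_mul]

theorem admissible_field (hS : IsCompact S) (hw : w ∈ testFunctions (interior S))
    (hφ : φ ∈ testFunctions (interior S)) :
    Admissible (affineFlow T.map (T.field w φ)) 0 S Set.univ Set.univ :=
  admissible_affineFlow hS T.contDiff_map (T.contDiff_field hw.1 hφ.1) T.isMetricOn_map
    (hw.2.1.isCompact.union hφ.2.1.isCompact) (Set.union_subset hw.2.2 hφ.2.2) fun u hu => by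
      simp only [Set.mem_union, not_or] at hu
      simp [field, image_eq_zero_of_notMem_tsupport hu.1, image_eq_zero_of_notMem_tsupport hu.2]

/-- The inner product of the position with ∂_a is ∂_a of `halfSq`, so the adjoint identity for
gradients turns the pairing into w against the meridian derivative of the Laplacian of `halfSq`. -/
theorem pairing_hodgeTerm_field (hS : IsCompact S) (hw : w ∈ testFunctions (interior S)) :
    pairing (affineFlow T.map (T.field w φ)) 0 S (fun u => affineFlow T.map (T.field w φ) u 0)
        (hodgeTerm (affineFlow T.map (T.field w φ)) 0)
      = ∫ u, w u * tangentMoment 0 (u T.i₀) := by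
  have h := integral_hodgeLaplacian_mul_pd T.isMetricOn_map hS (Set.subset_univ S)
    hw.2.1.isCompact (hw.2.2.trans interior_subset)
    (W := fun a u => if a = T.i₀ then w u else 0)
    (fun a => by split_ifs; exacts [hw.1.contDiffOn, contDiffOn_const])
    (fun a u hu => by rw [image_eq_zero_of_notMem_tsupport hu.2, ite_self])
    T.contDiff_halfSq.contDiffOn
  rw [← setIntegral_testFunction hw, affineFlow_zero, pairing]
  simp only [hodgeTerm, metricAt_affineFlow, affineFlow_zero, tangentVelCoeff_field]
  have h1 : ∀ u, inner ℝ (T.map u) (-∑ a, hodgeLaplacian (inducedMetric T.map)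
        (fun a u => if a = T.i₀ then w u else 0) a u • pd a T.map u)
          * volDensity (inducedMetric T.map) u
      = -((∑ a, hodgeLaplacian (inducedMetric T.map)
        (fun a u => if a = T.i₀ then w u else 0) a u * pd a T.halfSq u)
          * volDensity (inducedMetric T.map) u) := by
    intro u
    simp only [inner_neg_right, inner_sum, real_inner_smul_right, T.pd_halfSq, neg_mul]
  simp only [h1]
  rw [integral_neg, h, neg_neg]
  refine integral_congr_ae (Filter.Eventually.of_forall fun u => ?_)
  simp only [ite_mul, zero_mul, Finset.sum_ite_eq', Finset.mem_univ, if_true,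
    T.pd_laplace_halfSq, T.volDensity_map, tangentMoment, rho]
  ring

theorem pairing_weingartenTerm_field (hw : w ∈ testFunctions (interior S)) :
    pairing (affineFlow T.map (T.field w φ)) 0 S (fun u => affineFlow T.map (T.field w φ) u 0)
        (weingartenTerm (affineFlow T.map (T.field w φ)) 0)
      = ∫ u, w u * tangentMoment 1 (u T.i₀) := by
  -- Only the indices equal to the meridian one survive: W and the meridian rows of the second
  -- fundamental form are concentrated there, and the inverse metric is diagonal.
  have h : ∀ u, weingartenTerm (affineFlow T.map (T.field w φ)) 0 u = -(w u • T.tau u) := by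
    intro u
    have hz : ∀ m, weingarten T.map 0 m u = 0 := fun m => by simp [weingarten]
    simp only [weingartenTerm, metricAt_affineFlow, affineFlow_zero, tangentVelCoeff_field]
    congr 1
    rw [Finset.sum_eq_single T.i₀, Finset.sum_eq_single T.i₀, Finset.sum_eq_single T.i₀]
    · rw [secondFF_meridian, if_pos rfl, if_pos rfl, weingarten_meridian, inv_inducedMetric_map,
        Matrix.diagonal_apply_eq, if_neg T.ne, one_mul]
    · intro a _ ha
      rw [if_neg ha, mul_zero, zero_smul]
    · simp
    · intro n _ hn
      refine Finset.sum_eq_zero fun a _ => ?_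
      rw [inv_inducedMetric_map, Matrix.diagonal_apply_ne _ hn.symm, zero_mul, zero_smul]
    · simp
    · intro m _ hm
      refine Finset.sum_eq_zero fun n _ => Finset.sum_eq_zero fun a _ => ?_
      by_cases ha : a = T.i₀
      · by_cases hn : n = T.i₀
        · rw [inv_inducedMetric_map, Matrix.diagonal_apply_ne _ (hn ▸ hm), zero_mul, zero_smul]
        · rw [ha, secondFF_meridian', if_neg hn, hz, smul_zero]
      · rw [if_neg ha, mul_zero, zero_smul]
    · simp
  have ht : ∀ u, inner ℝ (T.map u) (T.tau u) = -2 * Real.sin (u T.i₀) := by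
    intro u
    have := T.inner_map_pd u T.i₀
    rwa [if_neg T.ne, T.pd_map, if_pos rfl, posCoeff, if_pos rfl] at this
  rw [← setIntegral_testFunction hw, affineFlow_zero, pairing]
  refine integral_congr_ae (Filter.Eventually.of_forall fun u => ?_)
  simp only [h, inner_neg_right, real_inner_smul_right, ht, metricAt_affineFlow, volDensity_map,
    tangentMoment, rho]
  ring

theorem contDiff_supp_nu : ContDiff ℝ ∞ fun u => T.supp u • T.nu u := by fun_prop

theorem integral_inner_nu (hS : IsCompact S) (hφ : φ ∈ testFunctions (interior S)) :
    ∫ u in S, inner ℝ (T.map u) (laplaceBeltrami (inducedMetric T.map) (fun v => φ v • T.nu v) u)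
        * volDensity (inducedMetric T.map) u = ∫ u, φ u * normalMoment 0 (u T.i₀) := by
  have hr := fun u => (T.rho_pos u).ne'
  have hφν : ContDiffOn ℝ ∞ (fun v => φ v • T.nu v) Set.univ :=
    (hφ.1.smul T.contDiff_nu).contDiffOn
  rw [integral_inner_laplaceBeltrami_comm T.isMetricOn_map hS (Set.subset_univ S)
    hφ.2.1.isCompact (hφ.2.2.trans interior_subset) T.contDiff_map.contDiffOn hφν
    (fun u hu => by simp [image_eq_zero_of_notMem_tsupport hu.2]), ← setIntegral_testFunction hφ]
  refine integral_congr_ae (Filter.Eventually.of_forall fun u => ?_)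
  simp only [laplace_map, real_inner_smul_left, real_inner_smul_right, T.nu_nu, volDensity_map,
    normalMoment]
  field_simp [hr u]

/-- Moved to the position, the tangential projection becomes the position minus its normal part.
Green's second identity then applies to each of the two. -/
theorem pairing_normalVelTerm_field (hS : IsCompact S) (hφ : φ ∈ testFunctions (interior S)) :
    pairing (affineFlow T.map (T.field w φ)) 0 S (fun u => affineFlow T.map (T.field w φ) u 0)
        (normalVelTerm (affineFlow T.map (T.field w φ)) 0)
      = (∫ u, φ u * normalMoment 0 (u T.i₀)) - ∫ u, φ u * normalMoment 1 (u T.i₀) := by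
  have hr := fun u => (T.rho_pos u).ne'
  have hg := T.isMetricOn_map
  have hφν : ContDiffOn ℝ ∞ (fun v => φ v • T.nu v) Set.univ :=
    (hφ.1.smul T.contDiff_nu).contDiffOn
  have hL := smooth_laplaceBeltrami hg hφν
  have h2 : ∫ u in S, inner ℝ (T.supp u • T.nu u)
        (laplaceBeltrami (inducedMetric T.map) (fun v => φ v • T.nu v) u)
        * volDensity (inducedMetric T.map) u = ∫ u, φ u * normalMoment 1 (u T.i₀) := by
    rw [integral_inner_laplaceBeltrami_comm T.isMetricOn_map hS (Set.subset_univ S)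
      hφ.2.1.isCompact (hφ.2.2.trans interior_subset) T.contDiff_supp_nu.contDiffOn hφν
      (fun u hu => by simp [image_eq_zero_of_notMem_tsupport hu.2]), ← setIntegral_testFunction hφ]
    refine integral_congr_ae (Filter.Eventually.of_forall fun u => ?_)
    have hr := hr u
    simp only [real_inner_smul_left, inner_nu_laplace_supp_nu, volDensity_map, normalMoment]
    rw [mul_assoc, div_mul_cancel₀ _ hr]
    rfl
  rw [← T.integral_inner_nu hS hφ, ← h2, ← integral_sub]
  · rw [affineFlow_zero, pairing]
    refine integral_congr_ae (Filter.Eventually.of_forall fun u => ?_)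
    simp only [normalVelTerm, affineFlow_zero, metricAt_affineFlow, normalVel_field]
    rw [inner_tangentProj_comm hg (Set.mem_univ u), tangentProj_map, inner_sub_left, sub_mul]
  · exact integrableOn_of_smooth hS (Set.subset_univ S)
      ((T.contDiff_map.contDiffOn.inner ℝ hL).mul hg.smooth_vol)
  · exact integrableOn_of_smooth hS (Set.subset_univ S)
      ((T.contDiff_supp_nu.contDiffOn.inner ℝ hL).mul hg.smooth_vol)

theorem integrable_testFunction (hw : w ∈ testFunctions (interior S)) {r : ℝ → ℝ}
    (hr : Continuous r) (j : Fin d) : Integrable fun u : Coord d => w u * r (u j) :=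
  (hw.1.continuous.mul (by fun_prop)).integrable_of_hasCompactSupport hw.2.1.mul_right

/-- The normal projection moves to the position and leaves the support function times ν. Green's
identity transfers the Laplacian to it, and w and φ pick out its τ and ν components. -/
theorem pairing_otherTerm_field (hS : IsCompact S) (hw : w ∈ testFunctions (interior S))
    (hφ : φ ∈ testFunctions (interior S)) :
    pairing (affineFlow T.map (T.field w φ)) 0 S (fun u => affineFlow T.map (T.field w φ) u 0)
        (otherTerm (affineFlow T.map (T.field w φ)) 0)
      = (∫ u, w u * tangentMoment 2 (u T.i₀)) + ∫ u, φ u * normalMoment 1 (u T.i₀) := by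
  have hg := T.isMetricOn_map
  have hr := fun u => (T.rho_pos u).ne'
  have hS' : ∀ u ∉ S, w u = 0 ∧ φ u = 0 := fun u hu =>
    ⟨image_eq_zero_of_notMem_tsupport fun h => hu (interior_subset (hw.2.2 h)),
      image_eq_zero_of_notMem_tsupport fun h => hu (interior_subset (hφ.2.2 h))⟩
  have hcont : ∀ {n : ℕ} {r : Fin n → ℝ → ℝ}, (∀ i s, AnalyticAt ℝ (r i) s) → ∀ i,
      Continuous (r i) := fun hr i => continuous_iff_continuousAt.2 fun s => (hr i s).continuousAt
  rw [← integral_add (integrable_testFunction hw (hcont analyticAt_tangentMoment 2) T.i₀)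
    (integrable_testFunction hφ (hcont analyticAt_normalMoment 1) T.i₀),
    ← setIntegral_eq_integral_of_forall_compl_eq_zero (s := S)
      fun u hu => by rw [(hS' u hu).1, (hS' u hu).2]; ring]
  have h1 : pairing (affineFlow T.map (T.field w φ)) 0 S
        (fun u => affineFlow T.map (T.field w φ) u 0)
        (otherTerm (affineFlow T.map (T.field w φ)) 0)
      = ∫ u in S, inner ℝ (T.supp u • T.nu u)
        (laplaceBeltrami (inducedMetric T.map) (T.field w φ) u)
        * volDensity (inducedMetric T.map) u := by
    rw [affineFlow_zero, pairing]
    refine integral_congr_ae (Filter.Eventually.of_forall fun u => ?_)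
    simp only [otherTerm, affineFlow_zero, metricAt_affineFlow, velocity_affineFlow]
    rw [inner_normalProj_comm hg (Set.mem_univ u), normalProj_map]
  rw [h1, integral_inner_laplaceBeltrami_comm T.isMetricOn_map hS (Set.subset_univ S)
    (hw.2.1.isCompact.union hφ.2.1.isCompact)
    ((Set.union_subset hw.2.2 hφ.2.2).trans interior_subset)
    T.contDiff_supp_nu.contDiffOn (T.contDiff_field hw.1 hφ.1).contDiffOn (fun u hu => by
      have hu := hu.2
      simp only [Set.mem_union, not_or] at hu
      simp [field, image_eq_zero_of_notMem_tsupport hu.1, image_eq_zero_of_notMem_tsupport hu.2])]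
  refine integral_congr_ae (Filter.Eventually.of_forall fun u => ?_)
  have hr := hr u
  simp only [field, inner_add_left, real_inner_smul_left, inner_nu_laplace_supp_nu,
    inner_tau_laplace_supp_nu, volDensity_map, normalMoment, tangentMoment]
  rw [add_mul, mul_assoc (w u), div_mul_cancel₀ _ hr, mul_assoc (φ u), div_mul_cancel₀ _ hr]
  rfl

/-- The Laplacian of the position is the mean curvature vector, which is normal, so the meridian
component w does not contribute. -/
theorem energyRate_field (hS : IsCompact S) (hw : w ∈ testFunctions (interior S))
    (hφ : φ ∈ testFunctions (interior S)) :
    energyRate S (metricAt (affineFlow T.map (T.field w φ)) 0) (affineFlow T.map (T.field w φ)) 0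
      = -2 * ∫ u, φ u * normalMoment 0 (u T.i₀) := by
  rw [(T.admissible_field hS hw hφ).energyRate_eq_velocity_laplace,
    ← setIntegral_testFunction hφ, affineFlow_zero, velocity_affineFlow, metricAt_affineFlow,
    pairing]
  congr 1
  refine integral_congr_ae (Filter.Eventually.of_forall fun u => ?_)
  have hr := (T.rho_pos u).ne'
  have htn : inner ℝ (T.tau u) (T.nu u) = (0 : ℝ) := by rw [real_inner_comm, T.nu_tau]
  simp only [laplace_map, field, inner_add_left, real_inner_smul_left, real_inner_smul_right,
    T.nu_nu, htn, metricAt_affineFlow, volDensity_map, normalMoment]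
  field_simp
  ring

end TorusFrame

/-- A flow of a flat domain and a flow of a torus which differ only in the Ricci term. -/
theorem exists_flows_of_different_loss {d D : ℕ} {S : Set (Coord d)} (hS : IsCompact S) {c : ℝ}
    (hc : 0 < c) (hd : 2 ≤ d) (hD : d < D) (hne : (interior S).Nonempty) :
    ∃ (U₀ U₁ : Set (Coord d)) (I₀ I₁ : Set ℝ)
      (ψ₀ ψ₁ : Coord d → ℝ → EuclideanSpace ℝ (Fin D)) (t : ℝ),
      Admissible ψ₀ t S U₀ I₀ ∧ Admissible ψ₁ t S U₁ I₁ ∧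
      (∀ u ∈ S, ∀ j k, ricci (metricAt ψ₀ t) j k u = 0) ∧
      (∀ u ∈ S, ∀ a, tangentVelCoeff ψ₀ t a u = tangentVelCoeff ψ₁ t a u) ∧
      pairing ψ₀ t S (fun v => ψ₀ v t) (hodgeTerm ψ₀ t)
        = pairing ψ₁ t S (fun v => ψ₁ v t) (hodgeTerm ψ₁ t) ∧
      pairing ψ₀ t S (fun v => ψ₀ v t) (weingartenTerm ψ₀ t)
        = pairing ψ₁ t S (fun v => ψ₁ v t) (weingartenTerm ψ₁ t) ∧
      pairing ψ₀ t S (fun v => ψ₀ v t) (normalVelTerm ψ₀ t)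
        = pairing ψ₁ t S (fun v => ψ₁ v t) (normalVelTerm ψ₁ t) ∧
      pairing ψ₀ t S (fun v => ψ₀ v t) (otherTerm ψ₀ t)
        = pairing ψ₁ t S (fun v => ψ₁ v t) (otherTerm ψ₁ t) ∧
      harmonicLoss S (metricAt ψ₀ t) c ψ₀ t ≠ harmonicLoss S (metricAt ψ₁ t) c ψ₁ t := by
  obtain ⟨T⟩ := exists_torusFrame hd hD
  have hcont : ∀ {n : ℕ} {r : Fin n → ℝ → ℝ}, (∀ i s, AnalyticAt ℝ (r i) s) → ∀ i,
      Continuous fun u : Coord d => r i (u T.i₀) := fun hr i =>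
    (continuous_iff_continuousAt.2 fun s => (hr i s).continuousAt).comp (by fun_prop)
  -- The first moment makes the energy rate -c. The second equals it so that the V pairing, their
  -- difference, is zero.
  obtain ⟨φ, hφ, hφ'⟩ := exists_testFunction_integral_eq isOpen_interior
    (fun i u => normalMoment i (u T.i₀)) (hcont analyticAt_normalMoment)
    (fun k hk => normalMoment_independent (sum_mul_eq_zero_of_analytic isOpen_interior hne T.i₀
      analyticAt_normalMoment hk)) ![c / 2, c / 2]
  -- The two zeros remove the Hodge and Weingarten pairings. The value -c/2 cancels the contribution
  -- c/2 of φ to the normal pairing.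
  obtain ⟨w, hw, hw'⟩ := exists_testFunction_integral_eq isOpen_interior
    (fun i u => tangentMoment i (u T.i₀)) (hcont analyticAt_tangentMoment)
    (fun k hk => tangentMoment_independent (sum_mul_eq_zero_of_analytic isOpen_interior hne T.i₀
      analyticAt_tangentMoment hk)) ![0, 0, -(c / 2)]
  have p0 : ∫ u, φ u * normalMoment 0 (u T.i₀) = c / 2 := hφ' 0
  have p1 : ∫ u, φ u * normalMoment 1 (u T.i₀) = c / 2 := hφ' 1
  have q0 : ∫ u, w u * tangentMoment 0 (u T.i₀) = 0 := hw' 0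
  have q1 : ∫ u, w u * tangentMoment 1 (u T.i₀) = 0 := hw' 1
  have q2 : ∫ u, w u * tangentMoment 2 (u T.i₀) = -(c / 2) := hw' 2
  let f : Fin d → EuclideanSpace ℝ (Fin D) := fun k => EuclideanSpace.single (Fin.castLE hD.le k) 1
  have hf : ∀ j k, inner ℝ (f j) (f k) = if j = k then (1 : ℝ) else 0 := by
    intro j k
    simp [f, EuclideanSpace.inner_single_left]
  obtain ⟨hadm, hric, hW, hH, hA, hV, hN, hE⟩ := flat_flow_properties hf hS hw.2.1.isCompact
    hw.2.2 hw.1 (fun u hu => image_eq_zero_of_notMem_tsupport hu) T.i₀ rfl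
  refine ⟨Set.univ, Set.univ, Set.univ, Set.univ, _, _, 0, hadm, T.admissible_field hS hw hφ,
    fun u _ => hric u, fun u _ a => ?_, ?_, ?_, ?_, ?_, ?_⟩
  · rw [hW, T.tangentVelCoeff_field]
  · rw [hH, T.pairing_hodgeTerm_field hS hw, q0]
  · rw [hA, T.pairing_weingartenTerm_field hw, q1]
  · rw [hV, T.pairing_normalVelTerm_field hS hφ, p0, p1, sub_self]
  · rw [hN, T.pairing_otherTerm_field hS hw hφ, q2, p1, neg_add_cancel]
  -- The flat flow has rate 0 and loss c, the torus flow rate -c and loss 0.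
  · rw [harmonicLoss, harmonicLoss, hE, T.energyRate_field hS hw hφ, p0]
    have : -2 * (c / 2) = -c := by ring
    simp [this, abs_of_pos hc, hc.ne']

end

end HarmonicFlow

theorem theorem5 {d D : ℕ} (S : Set (EuclideanSpace ℝ (Fin d))) (hS : IsCompact S)
    (c : ℝ) (hc : 0 < c) :
    -- the loss for every admissible flow: it comes from the time derivative of the energy,
    -- and integration by parts and splitting the velocity bring in the Ricci term
    (∀ (U : Set (EuclideanSpace ℝ (Fin d))) (I : Set ℝ)
        (ψ : EuclideanSpace ℝ (Fin d) → ℝ → EuclideanSpace ℝ (Fin D)) (t : ℝ),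
        Admissible ψ t S U I →
        HasDerivAt (fun s => energy S (metricAt ψ t) (fun v => ψ v s))
          (energyRate S (metricAt ψ t) ψ t) t ∧
        energyRate S (metricAt ψ t) ψ t
          = -2 * pairing ψ t S (velocity ψ t)
              (laplaceBeltrami (metricAt ψ t) (fun v => ψ v t)) ∧
        energyRate S (metricAt ψ t) ψ t
          = -2 * pairing ψ t S (fun v => ψ v t)
              (laplaceBeltrami (metricAt ψ t) (velocity ψ t)) ∧
        (∀ u ∈ S, tangentProj (fun v => ψ v t) u
            (laplaceBeltrami (metricAt ψ t) (tangentVel ψ t) u)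
          = hodgeTerm ψ t u + ricciTerm ψ t u + weingartenTerm ψ t u) ∧
        harmonicLoss S (metricAt ψ t) c ψ t
          = |c - 2 * abs (pairing ψ t S (fun v => ψ v t) (hodgeTerm ψ t)
              + pairing ψ t S (fun v => ψ v t) (ricciTerm ψ t)
              + pairing ψ t S (fun v => ψ v t) (weingartenTerm ψ t)
              + pairing ψ t S (fun v => ψ v t) (normalVelTerm ψ t)
              + pairing ψ t S (fun v => ψ v t) (otherTerm ψ t))|) ∧
    -- the Ricci term is not cancelled: two flows with the same tangential velocity components
    -- and the same value of every other term, the first one Ricci-flat, with different losses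
    (2 ≤ d → d < D → (interior S).Nonempty →
      ∃ (U₀ U₁ : Set (EuclideanSpace ℝ (Fin d))) (I₀ I₁ : Set ℝ)
        (ψ₀ ψ₁ : EuclideanSpace ℝ (Fin d) → ℝ → EuclideanSpace ℝ (Fin D)) (t : ℝ),
        Admissible ψ₀ t S U₀ I₀ ∧ Admissible ψ₁ t S U₁ I₁ ∧
        (∀ u ∈ S, ∀ j k, ricci (metricAt ψ₀ t) j k u = 0) ∧
        (∀ u ∈ S, ∀ a, tangentVelCoeff ψ₀ t a u = tangentVelCoeff ψ₁ t a u) ∧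
        pairing ψ₀ t S (fun v => ψ₀ v t) (hodgeTerm ψ₀ t)
          = pairing ψ₁ t S (fun v => ψ₁ v t) (hodgeTerm ψ₁ t) ∧
        pairing ψ₀ t S (fun v => ψ₀ v t) (weingartenTerm ψ₀ t)
          = pairing ψ₁ t S (fun v => ψ₁ v t) (weingartenTerm ψ₁ t) ∧
        pairing ψ₀ t S (fun v => ψ₀ v t) (normalVelTerm ψ₀ t)
          = pairing ψ₁ t S (fun v => ψ₁ v t) (normalVelTerm ψ₁ t) ∧
        pairing ψ₀ t S (fun v => ψ₀ v t) (otherTerm ψ₀ t)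
          = pairing ψ₁ t S (fun v => ψ₁ v t) (otherTerm ψ₁ t) ∧
        harmonicLoss S (metricAt ψ₀ t) c ψ₀ t ≠ harmonicLoss S (metricAt ψ₁ t) c ψ₁ t) := by
  refine ⟨fun U I ψ t h => ⟨h.hasDerivAt_energy, h.energyRate_eq_velocity_laplace,
    h.energyRate_eq_laplace_velocity, fun u hu => ?_, h.harmonicLoss_eq c⟩,
    fun hd hD hne => exists_flows_of_different_loss hS hc hd hD hne⟩
  obtain ⟨O, hg, hSO, hOU⟩ := h.exists_isMetricOn
  exact h.tangentProj_laplaceBeltrami hg hOU (hSO hu)
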